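/- **Setting.** Let $\mathbb S=[0,1]/(0\sim1)$, let $q,\ell\in\mathbb N$ with $\ell\ge1$, and let $\mathcal P=(0,\tfrac12]\times\mathbb R\times\mathbb R\ni p=(r,\lambda,\mu)$. Put $W_r(x)=1$ if $\min(x,1-x)\le r$ and $W_r(x)=0$ otherwise ($x\in[0,1]$), and for a phase configuration $\Psi$ on $\mathbb S$ let $$\begin{aligned}F(\Psi,p)(x)&=\int_{\mathbb S} W_r(x-y)\sin(\Psi(y)-\Psi(x))\,dy-\int_{\mathbb S} W_r(y)\sin\Psi(y)\,dy\\&+\lambda\Big[\int_{\mathbb S}\int_{\mathbb S} W_r(z+y-2x)\sin(\Psi(z)+\Psi(y)-2\Psi(x))\,dy\,dz-\int_{\mathbb S}\int_{\mathbb S} W_r(z+y)\sin(\Psi(z)+\Psi(y))\,dy\,dz\Big]\\&+\mu\Big[\int_{\mathbb S}\int_{\mathbb S}\int_{\mathbb S} W_r(z-y+w-x)\sin(\Psi(z)-\Psi(y)+\Psi(w)-\Psi(x))\,dw\,dy\,dz\\&\qquad-\int_{\mathbb S}\int_{\mathbb S}\int_{\mathbb S} W_r(z-y+w)\sin(\Psi(z)-\Psi(y)+\Psi(w))\,dw\,dy\,dz\Big].\end{aligned}$$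 Let $F^q(v,p)=F(\Psi^q+v,p)$ with $\Psi^q(x)=2\pi qx$, for $v\in X=\{v\in H^1(\mathbb S,\mathbb R): v(0)=0\}$ with norm $(\|v\|_{L^2}^2+\|Dv\|_{L^2}^2)^{1/2}$. Put $u_k(x)=\sin(2\pi kx)$, $w_k(x)=1-\cos(2\pi kx)$, $\hat W_r(0)=4r$, $\hat W_r(k)=\frac{2\sin(2\pi kr)}{\pi k}$ for $k\in\mathbb Z\setminus\{0\}$, and $$c_1(q,k,p)=\tfrac14\big(\hat W_r(q-k)+\hat W_r(q+k)-2\hat W_r(q)-(4\lambda+2\mu)\hat W_r(q)\big).$$ **Assumptions.** Let $\delta>0$ and let $p:(-\delta,\delta)\to\operatorname{int}\mathcal P$ be a smooth curve, $p_0=p(0)$, such that: $c_1(q,\ell,p_0)=0$; there is $\epsilon>0$ with $c_1(q,k,p(s))\notin(-\epsilon,\epsilon)$ for all $s\in(-\delta,\delta)$ and all $k\ge1$, $k\ne\ell$; for every $s\in(-\delta,\delta)$ the sequence $(c_1(q,k,p(s)))_{k}$ does not accumulate at $c_1(q,\ell,p(s))$; and $\frac{d}{ds}c_1(q,\ell,p(s))\big|_{s=0}\ne0$.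 **Lyapunov–Schmidt reduction.** Let $N=\operatorname{span}\{u_\ell,w_\ell\}$, let $X_0=R$ be the closed span in $X$ of the $u_k,w_k$ with $k\ge1$, $k\neq\ell$, and let $Q$ be the projection onto $N$ along $R$. With $\langle z_1^*,f\rangle=2\int_{\mathbb S}\sin(2\pi\ell x)f(x)\,dx$ and $\langle z_2^*,f\rangle=-2\int_{\mathbb S}\cos(2\pi\ell x)f(x)\,dx$ one has $Qf=\langle z_1^*,f\rangle u_\ell+\langle z_2^*,f\rangle w_\ell$. A Lyapunov–Schmidt reduction at $(0,p_0)$ consists of neighbourhoods $U$ of $0$ in $N$, $V\subset\mathcal P$ of $p_0$, $Y$ of $0$ in $X_0$, and a continuous $\psi:U\times V\to Y$ with $\psi(0,p_0)=0$ such that, for $(v,p)\in U\times V$, $y=\psi(v,p)$ is the unique solution $y\in Y$ of $(I-Q)F^q(v+y,p)=0$. Put $\Phi(v,p)=QF^q(v+\psi(v,p),p)$, $$\hat\Phi\Big(\binom ab,s\Big)=\binom{\langle z_1^*,\Phi(au_\ell+bw_\ell,p(s))\rangle}{\langle z_2^*,\Phi(au_\ell+bw_\ell,p(s))\rangle},\qquad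 A_\phi=\begin{pmatrix}\cos(2\pi\ell\phi)&\sin(2\pi\ell\phi)\\-\sin(2\pi\ell\phi)&\cos(2\pi\ell\phi)\end{pmatrix}.$$ **Proposition.** A Lyapunov–Schmidt reduction at $(0,p_0)$ exists. For every such reduction there is $\varepsilon\in(0,\delta]$ such that, whenever $a^2+b^2<\varepsilon^2$ and $|s|<\varepsilon$, one has $au_\ell+bw_\ell\in U$ and $p(s)\in V$ (so $\hat\Phi$ is defined there) and $$\hat\Phi\Big(A_\phi\binom ab,s\Big)=A_\phi\,\hat\Phi\Big(\binom ab,s\Big)\qquad\text{for all }\phi.$$ -/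

import Mathlib

open Real Set Filter Topology MeasureTheory
open scoped ContDiff

noncomputable section

namespace TwistedStates

/-! ### Functions on the circle `𝕊 = [0,1]/(0 ∼ 1)` and the space `H¹₀(𝕊, ℝ)` -/

/-- `x ↦ sin (2πkx)` on the circle. -/
def sinMode (k : ℕ) : C(UnitAddCircle, ℝ) where
  toFun := Function.Periodic.lift (f := fun t : ℝ => Real.sin (2 * π * k * t)) (c := 1) (by
    intro t
    have h : 2 * π * k * (t + 1) = 2 * π * k * t + k * (2 * π) := by ring
    simp only [h, Real.sin_add_nat_mul_two_pi])
  continuous_toFun := continuous_coinduced_dom.mpr (by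
    change Continuous fun t : ℝ => Real.sin (2 * π * k * t)
    fun_prop)

/-- `x ↦ cos (2πkx)` on the circle. -/
def cosMode (k : ℕ) : C(UnitAddCircle, ℝ) where
  toFun := Function.Periodic.lift (f := fun t : ℝ => Real.cos (2 * π * k * t)) (c := 1) (by
    intro t
    have h : 2 * π * k * (t + 1) = 2 * π * k * t + k * (2 * π) := by ring
    simp only [h, Real.cos_add_nat_mul_two_pi])
  continuous_toFun := continuous_coinduced_dom.mpr (by
    change Continuous fun t : ℝ => Real.cos (2 * π * k * t)
    fun_prop)

@[simp] theorem sinMode_coe (k : ℕ) (t : ℝ) :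
    sinMode k (t : UnitAddCircle) = Real.sin (2 * π * k * t) := rfl

@[simp] theorem cosMode_coe (k : ℕ) (t : ℝ) :
    cosMode k (t : UnitAddCircle) = Real.cos (2 * π * k * t) := rfl

/-- `g` is the weak derivative of `f` on the circle; the test functions are the smooth
`1`-periodic functions. -/
def IsWeakDeriv (f g : UnitAddCircle → ℝ) : Prop :=
  ∀ η : ℝ → ℝ, ContDiff ℝ ∞ η → Function.Periodic η 1 →
    ∫ x in (0 : ℝ)..1, f (x : UnitAddCircle) * deriv η x =
      -∫ x in (0 : ℝ)..1, g (x : UnitAddCircle) * η x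

/-- Every function in `L²` of the circle is integrable over a period. -/
theorem intervalIntegrable_lp (g : Lp ℝ 2 (volume : Measure UnitAddCircle)) :
    IntervalIntegrable (fun x : ℝ => g (x : UnitAddCircle)) volume 0 1 := by
  rw [intervalIntegrable_iff, uIoc_of_le zero_le_one]
  have h1 : Integrable g (volume : Measure UnitAddCircle) :=
    (Lp.memLp g).integrable (by norm_num)
  have h2 := (UnitAddCircle.measurePreserving_mk 0).integrable_comp_of_integrable h1
  simpa [IntegrableOn, Function.comp_def] using h2

theorem intervalIntegrable_lp_mul (g : Lp ℝ 2 (volume : Measure UnitAddCircle)) {η : ℝ → ℝ}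
    (hη : Continuous η) :
    IntervalIntegrable (fun x : ℝ => g (x : UnitAddCircle) * η x) volume 0 1 :=
  (intervalIntegrable_lp g).mul_continuousOn hη.continuousOn

theorem ae_interval_of_ae {P : UnitAddCircle → Prop}
    (h : ∀ᵐ x ∂(volume : Measure UnitAddCircle), P x) :
    ∀ᵐ x : ℝ ∂volume, x ∈ uIoc (0 : ℝ) 1 → P (x : UnitAddCircle) := by
  have h2 := (UnitAddCircle.measurePreserving_mk 0).quasiMeasurePreserving.ae h
  rw [uIoc_of_le zero_le_one]
  rw [ae_restrict_iff' measurableSet_Ioc] at h2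
  simpa using h2

/-- The pairs `(f, Df)` with `f` continuous on the circle, `f 0 = 0` and `Df ∈ L²` the weak
derivative of `f`. Since `H¹ ⊆ C` in dimension one, these are exactly the graphs of the weak
derivative on the space of `H¹` functions that vanish at `0`. -/
def H10Sub : Submodule ℝ (C(UnitAddCircle, ℝ) × Lp ℝ 2 (volume : Measure UnitAddCircle)) where
  carrier := {v | v.1 0 = 0 ∧ IsWeakDeriv v.1 v.2}
  zero_mem' := by
    refine ⟨rfl, fun η _ _ => ?_⟩
    have h0 : ∫ x in (0 : ℝ)..1,
        (((0 : C(UnitAddCircle, ℝ) × Lp ℝ 2 (volume : Measure UnitAddCircle)).2 :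
          UnitAddCircle → ℝ) (x : UnitAddCircle)) * η x = ∫ x in (0 : ℝ)..1, (0 : ℝ) := by
      simp
    rw [h0]
    simp
  add_mem' := by
    rintro v w ⟨hv0, hv⟩ ⟨hw0, hw⟩
    refine ⟨by simp [hv0, hw0], fun η hη hp => ?_⟩
    have hd : Continuous (deriv η) := hη.continuous_deriv (by norm_num)
    have hc : ∀ f : C(UnitAddCircle, ℝ), IntervalIntegrable
        (fun x : ℝ => f (x : UnitAddCircle) * deriv η x) volume 0 1 := fun f =>
      Continuous.intervalIntegrable
        ((f.continuous.comp (AddCircle.continuous_mk' 1)).mul hd) _ _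
    have h1 : ∫ x in (0 : ℝ)..1, (v + w).2 (x : UnitAddCircle) * η x =
        ∫ x in (0 : ℝ)..1,
          (v.2 (x : UnitAddCircle) * η x + w.2 (x : UnitAddCircle) * η x) := by
      refine intervalIntegral.integral_congr_ae ?_
      filter_upwards [ae_interval_of_ae (Lp.coeFn_add v.2 w.2)] with x hx hm
      have := hx hm
      simp only [Prod.snd_add, this, Pi.add_apply, add_mul]
    rw [h1, intervalIntegral.integral_add (intervalIntegrable_lp_mul _ hη.continuous)
      (intervalIntegrable_lp_mul _ hη.continuous), neg_add, ← hv η hη hp, ← hw η hη hp,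
      ← intervalIntegral.integral_add (hc _) (hc _)]
    simp [add_mul]
  smul_mem' := by
    rintro c v ⟨hv0, hv⟩
    refine ⟨by simp [hv0], fun η hη hp => ?_⟩
    have h1 : ∫ x in (0 : ℝ)..1, (c • v).2 (x : UnitAddCircle) * η x =
        ∫ x in (0 : ℝ)..1, c * (v.2 (x : UnitAddCircle) * η x) := by
      refine intervalIntegral.integral_congr_ae ?_
      filter_upwards [ae_interval_of_ae (Lp.coeFn_smul c v.2)] with x hx hm
      have := hx hm
      simp only [Prod.smul_snd, this, Pi.smul_apply, smul_eq_mul, mul_assoc]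
    rw [h1, intervalIntegral.integral_const_mul, ← mul_neg, ← hv η hη hp,
      ← intervalIntegral.integral_const_mul]
    simp [mul_assoc]

/-- The space `X = H¹₀(𝕊, ℝ)`. -/
def H10 : Type := H10Sub

instance : AddCommGroup H10 := inferInstanceAs (AddCommGroup H10Sub)
instance : Module ℝ H10 := inferInstanceAs (Module ℝ H10Sub)

/-- The continuous function underlying an element of `H¹₀`. -/
def H10.toCont (v : H10) : C(UnitAddCircle, ℝ) := v.1.1

/-- The weak derivative of an element of `H¹₀`. -/
def H10.D (v : H10) : Lp ℝ 2 (volume : Measure UnitAddCircle) := v.1.2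

instance : CoeFun H10 (fun _ => UnitAddCircle → ℝ) := ⟨fun v => v.toCont⟩

/-- The embedding `v ↦ (v, Dv)` of `H¹₀` in the Hilbert sum `L² ⊕ L²`. -/
def H10.embed : H10 →ₗ[ℝ] WithLp 2 (Lp ℝ 2 (volume : Measure UnitAddCircle) ×
    Lp ℝ 2 (volume : Measure UnitAddCircle)) where
  toFun v := WithLp.toLp 2 (ContinuousMap.toLp 2 volume ℝ v.toCont, v.D)
  map_add' v w := by
    have h1 : (v + w).toCont = v.toCont + w.toCont := rfl
    have h2 : (v + w).D = v.D + w.D := rfl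
    rw [h1, h2, map_add, ← WithLp.toLp_add, Prod.mk_add_mk]
  map_smul' c v := by
    have h1 : (c • v).toCont = c • v.toCont := rfl
    have h2 : (c • v).D = c • v.D := rfl
    rw [h1, h2, map_smul, RingHom.id_apply, ← WithLp.toLp_smul, Prod.smul_mk]

theorem H10.embed_injective : Function.Injective H10.embed := by
  intro v w h
  have h' := congrArg WithLp.ofLp h
  have h1 := congrArg Prod.fst h'
  have h2 := congrArg Prod.snd h'
  exact Subtype.ext (Prod.ext (ContinuousMap.toLp_injective (𝕜 := ℝ) volume h1) h2)

/-- The norm of `H¹₀` comes from the scalar product `f · g = ∫ f g + ∫ Df Dg`. -/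
instance : NormedAddCommGroup H10 :=
  NormedAddCommGroup.induced H10 _ H10.embed H10.embed_injective

instance : InnerProductSpace ℝ H10 :=
  { InnerProductSpace.induced (𝕜 := ℝ) (G := H10) H10.embed with }

theorem H10.inner_eq (v w : H10) :
    inner ℝ v w = (∫ x : UnitAddCircle, v x * w x) + ∫ x : UnitAddCircle, v.D x * w.D x := by
  have h : inner ℝ v w = inner ℝ (ContinuousMap.toLp 2 volume ℝ v.toCont)
      (ContinuousMap.toLp 2 volume ℝ w.toCont) + inner ℝ v.D w.D := rfl
  rw [h, L2.inner_def, L2.inner_def]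
  congr 1
  · refine integral_congr_ae ?_
    filter_upwards [ContinuousMap.coeFn_toLp (p := 2) (𝕜 := ℝ) volume v.toCont,
      ContinuousMap.coeFn_toLp (p := 2) (𝕜 := ℝ) volume w.toCont] with x hx hy
    rw [hx, hy]
    simp [mul_comm]
  · simp [mul_comm]

/-- Integration by parts for a `C¹` function on the circle. -/
theorem isWeakDeriv_of_hasDerivAt (f : UnitAddCircle → ℝ) (g : C(UnitAddCircle, ℝ))
    (h : ∀ t : ℝ, HasDerivAt (fun s : ℝ => f (s : UnitAddCircle)) (g (t : UnitAddCircle)) t) :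
    IsWeakDeriv f (ContinuousMap.toLp 2 volume ℝ g) := by
  intro η hη hp
  have h1 : ∫ x in (0 : ℝ)..1,
      (ContinuousMap.toLp 2 volume ℝ g : Lp ℝ 2 (volume : Measure UnitAddCircle))
        (x : UnitAddCircle) * η x = ∫ x in (0 : ℝ)..1, g (x : UnitAddCircle) * η x := by
    refine intervalIntegral.integral_congr_ae ?_
    filter_upwards [ae_interval_of_ae
      (ContinuousMap.coeFn_toLp (p := 2) (𝕜 := ℝ) volume g)] with x hx hm
    rw [hx hm]
  have hd : Continuous (deriv η) := hη.continuous_deriv (by norm_num)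
  have hg : Continuous fun t : ℝ => g (t : UnitAddCircle) :=
    g.continuous.comp (AddCircle.continuous_mk' 1)
  have hη1 : ∀ x, HasDerivAt η (deriv η x) x := fun x =>
    (hη.differentiable (by norm_num) x).hasDerivAt
  rw [h1, intervalIntegral.integral_mul_deriv_eq_deriv_mul (fun x _ => h x) (fun x _ => hη1 x)
    (hg.intervalIntegrable _ _) (hd.intervalIntegrable _ _)]
  have e1 : ((1 : ℝ) : UnitAddCircle) = ((0 : ℝ) : UnitAddCircle) := by
    simp
  have e2 : η 1 = η 0 := by simpa using hp 0
  rw [e1, e2]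
  ring

/-- `u_k(x) = sin (2πkx)`. -/
def u (k : ℕ) : H10 :=
  ⟨(sinMode k, ContinuousMap.toLp 2 volume ℝ ((2 * π * k) • cosMode k)), by
    change _ ∧ _
    refine ⟨by simpa using sinMode_coe k 0, isWeakDeriv_of_hasDerivAt _ _ fun t => ?_⟩
    have := ((hasDerivAt_id t).const_mul (2 * π * k)).sin
    simpa [mul_comm] using this⟩

/-- `w_k(x) = 1 - cos (2πkx)`. -/
def w (k : ℕ) : H10 :=
  ⟨(1 - cosMode k, ContinuousMap.toLp 2 volume ℝ ((2 * π * k) • sinMode k)), by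
    change _ ∧ _
    refine ⟨by simpa [sub_eq_zero] using (cosMode_coe k 0).symm,
      isWeakDeriv_of_hasDerivAt _ _ fun t => ?_⟩
    have := (((hasDerivAt_id t).const_mul (2 * π * k)).cos).const_sub 1
    simpa [mul_comm] using this⟩

theorem u_apply (k : ℕ) (t : ℝ) : u k (t : UnitAddCircle) = Real.sin (2 * π * k * t) := rfl

theorem w_apply (k : ℕ) (t : ℝ) : w k (t : UnitAddCircle) = 1 - Real.cos (2 * π * k * t) := rfl

/-! ### The network equation in phase differences -/

/-- The parameters `p = (r, λ, μ)`. -/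
abbrev Param : Type := ℝ × ℝ × ℝ

/-- The parameter space `𝒫 = (0, 1/2] × ℝ × ℝ`. -/
def paramSpace : Set Param := {p | p.1 ∈ Ioc (0 : ℝ) (1 / 2)}

/-- The coupling function: `W_r(x) = 1` if `min(x, 1 - x) ≤ r` and `0` otherwise. The norm of
`UnitAddCircle` is the distance `min(x, 1 - x)` to `0`. -/
def W (r : ℝ) (x : UnitAddCircle) : ℝ := if ‖x‖ ≤ r then 1 else 0

/-- The right-hand side `F(Ψ, p)` of the equation for the phase differences, for a phase
configuration `Ψ : 𝕊 → ℝ / 2πℤ`. -/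
def F (Ψ : UnitAddCircle → Real.Angle) (p : Param) (x : UnitAddCircle) : ℝ :=
  ((∫ y : UnitAddCircle, W p.1 (x - y) * (Ψ y - Ψ x).sin)
    - ∫ y : UnitAddCircle, W p.1 y * (Ψ y).sin)
  + p.2.1 *
    ((∫ z : UnitAddCircle, ∫ y : UnitAddCircle,
        W p.1 (z + y - 2 • x) * (Ψ z + Ψ y - 2 • Ψ x).sin)
      - ∫ z : UnitAddCircle, ∫ y : UnitAddCircle, W p.1 (z + y) * (Ψ z + Ψ y).sin)
  + p.2.2 *
    ((∫ z : UnitAddCircle, ∫ y : UnitAddCircle, ∫ t : UnitAddCircle,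
        W p.1 (z - y + t - x) * (Ψ z - Ψ y + Ψ t - Ψ x).sin)
      - ∫ z : UnitAddCircle, ∫ y : UnitAddCircle, ∫ t : UnitAddCircle,
        W p.1 (z - y + t) * (Ψ z - Ψ y + Ψ t).sin)

/-- The `q`-twisted state `Ψ^q(x) = 2πqx`. -/
def twisted (q : ℕ) : UnitAddCircle → Real.Angle :=
  Function.Periodic.lift (f := fun t : ℝ => ((2 * π * q * t : ℝ) : Real.Angle)) (c := 1) (by
    intro t
    have h : 2 * π * q * (t + 1) = 2 * π * q * t + q • (2 * π) := by
      rw [nsmul_eq_mul]; ring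
    simp only [h, Real.Angle.coe_add, Real.Angle.coe_nsmul, Real.Angle.coe_two_pi, smul_zero,
      add_zero])

theorem twisted_coe (q : ℕ) (t : ℝ) :
    twisted q (t : UnitAddCircle) = ((2 * π * q * t : ℝ) : Real.Angle) := rfl

/-- `F^q(v, p) = F(Ψ^q + v, p)`. -/
def Fq (q : ℕ) (v : H10) (p : Param) : UnitAddCircle → ℝ :=
  F (fun x => twisted q x + ((v x : ℝ) : Real.Angle)) p

/-- The Fourier coefficients of the coupling function. -/
def What (r : ℝ) (k : ℤ) : ℝ := if k = 0 then 4 * r else 2 * Real.sin (2 * π * k * r) / (π * k)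

/-- The eigenvalues `c₁(q, k, p)` of the linearization at the `q`-twisted state. -/
def c1 (q k : ℕ) (p : Param) : ℝ :=
  1 / 4 * (What p.1 ((q : ℤ) - k) + What p.1 ((q : ℤ) + k) - 2 * What p.1 q
    - (4 * p.2.1 + 2 * p.2.2) * What p.1 q)

/-! ### Lyapunov–Schmidt reduction -/

/-- `N = span {u_ℓ, w_ℓ}`. -/
def N (ℓ : ℕ) : Submodule ℝ H10 := Submodule.span ℝ {u ℓ, w ℓ}

/-- `X₀ = R`, the closed span of the `u_k, w_k` with `k ≥ 1`, `k ≠ ℓ`. -/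
def X0 (ℓ : ℕ) : Submodule ℝ H10 :=
  (Submodule.span ℝ {v | ∃ k : ℕ, 1 ≤ k ∧ k ≠ ℓ ∧ (v = u k ∨ v = w k)}).topologicalClosure

/-- The functional `⟨z₁*, f⟩ = 2 ∫ sin (2πℓx) f(x) dx`. -/
def z1 (ℓ : ℕ) (f : UnitAddCircle → ℝ) : ℝ := 2 * ∫ x : UnitAddCircle, sinMode ℓ x * f x

/-- The functional `⟨z₂*, f⟩ = -2 ∫ cos (2πℓx) f(x) dx`. -/
def z2 (ℓ : ℕ) (f : UnitAddCircle → ℝ) : ℝ := -2 * ∫ x : UnitAddCircle, cosMode ℓ x * f x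

/-- The projection `Q` onto `N` along `R`, in coordinates: `(z₁*, z₂*)` is the basis dual to
`(u_ℓ, w_ℓ)` and both functionals vanish on `R` (see the lemmas below). -/
def Q (ℓ : ℕ) (f : UnitAddCircle → ℝ) : UnitAddCircle → ℝ :=
  fun x => z1 ℓ f * u ℓ x + z2 ℓ f * w ℓ x

theorem integral_cos_mode (n : ℤ) :
    ∫ x in (0 : ℝ)..1, Real.cos (2 * π * n * x) = if n = 0 then 1 else 0 := by
  split_ifs with h
  · simp [h]
  · have hn : (2 * π * n : ℝ) ≠ 0 := by positivity
    rw [intervalIntegral.integral_comp_mul_left _ hn, integral_cos]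
    have : 2 * π * (n : ℝ) * 1 = (2 * n : ℤ) * π := by push_cast; ring
    rw [this, Real.sin_int_mul_pi]
    simp

theorem integral_sin_mode (n : ℤ) : ∫ x in (0 : ℝ)..1, Real.sin (2 * π * n * x) = 0 := by
  by_cases h : n = 0
  · simp [h]
  · have hn : (2 * π * n : ℝ) ≠ 0 := by positivity
    rw [intervalIntegral.integral_comp_mul_left _ hn, integral_sin]
    have : 2 * π * (n : ℝ) * 1 = n * (2 * π) := by ring
    rw [this, Real.cos_int_mul_two_pi]
    simp

theorem z1_eq (ℓ : ℕ) (f : UnitAddCircle → ℝ) :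
    z1 ℓ f = 2 * ∫ x in (0 : ℝ)..1, Real.sin (2 * π * ℓ * x) * f (x : UnitAddCircle) := by
  rw [z1, ← UnitAddCircle.intervalIntegral_preimage 0]
  simp

theorem z2_eq (ℓ : ℕ) (f : UnitAddCircle → ℝ) :
    z2 ℓ f = -2 * ∫ x in (0 : ℝ)..1, Real.cos (2 * π * ℓ * x) * f (x : UnitAddCircle) := by
  rw [z2, ← UnitAddCircle.intervalIntegral_preimage 0]
  simp

theorem z1_u {ℓ k : ℕ} (hℓ : 1 ≤ ℓ) : z1 ℓ (u k) = if k = ℓ then 1 else 0 := by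
  rw [z1_eq]
  have h : ∀ x : ℝ, Real.sin (2 * π * ℓ * x) * u k (x : UnitAddCircle) =
      1 / 2 * (Real.cos (2 * π * ((ℓ : ℤ) - k : ℤ) * x)
        - Real.cos (2 * π * ((ℓ : ℤ) + k : ℤ) * x)) := by
    intro x
    have e1 : 2 * π * ((ℓ : ℤ) - k : ℤ) * x = 2 * π * ℓ * x - 2 * π * k * x := by
      push_cast; ring
    have e2 : 2 * π * ((ℓ : ℤ) + k : ℤ) * x = 2 * π * ℓ * x + 2 * π * k * x := by
      push_cast; ring
    rw [u_apply, e1, e2, Real.cos_sub, Real.cos_add]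
    ring
  simp only [h]
  rw [intervalIntegral.integral_const_mul, intervalIntegral.integral_sub
    ((by fun_prop : Continuous _).intervalIntegrable _ _)
    ((by fun_prop : Continuous _).intervalIntegrable _ _), integral_cos_mode, integral_cos_mode,
    if_neg (by omega : ¬ (ℓ : ℤ) + k = 0)]
  by_cases hk : k = ℓ
  · simp [hk]
  · rw [if_neg hk, if_neg (by omega)]
    simp

theorem z1_w {ℓ k : ℕ} : z1 ℓ (w k) = 0 := by
  rw [z1_eq]
  have h : ∀ x : ℝ, Real.sin (2 * π * ℓ * x) * w k (x : UnitAddCircle) =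
      Real.sin (2 * π * (ℓ : ℤ) * x) - (1 / 2 * Real.sin (2 * π * ((ℓ : ℤ) - k : ℤ) * x)
        + 1 / 2 * Real.sin (2 * π * ((ℓ : ℤ) + k : ℤ) * x)) := by
    intro x
    have e1 : 2 * π * ((ℓ : ℤ) - k : ℤ) * x = 2 * π * ℓ * x - 2 * π * k * x := by
      push_cast; ring
    have e2 : 2 * π * ((ℓ : ℤ) + k : ℤ) * x = 2 * π * ℓ * x + 2 * π * k * x := by
      push_cast; ring
    rw [w_apply, e1, e2, Real.sin_sub, Real.sin_add]
    push_cast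
    ring
  simp only [h]
  rw [intervalIntegral.integral_sub ((by fun_prop : Continuous _).intervalIntegrable _ _)
    ((by fun_prop : Continuous _).intervalIntegrable _ _),
    intervalIntegral.integral_add ((by fun_prop : Continuous _).intervalIntegrable _ _)
    ((by fun_prop : Continuous _).intervalIntegrable _ _),
    intervalIntegral.integral_const_mul, intervalIntegral.integral_const_mul, integral_sin_mode,
    integral_sin_mode, integral_sin_mode]
  simp

theorem z2_u {ℓ k : ℕ} : z2 ℓ (u k) = 0 := by
  rw [z2_eq]
  have h : ∀ x : ℝ, Real.cos (2 * π * ℓ * x) * u k (x : UnitAddCircle) =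
      1 / 2 * Real.sin (2 * π * ((ℓ : ℤ) + k : ℤ) * x)
        - 1 / 2 * Real.sin (2 * π * ((ℓ : ℤ) - k : ℤ) * x) := by
    intro x
    have e1 : 2 * π * ((ℓ : ℤ) - k : ℤ) * x = 2 * π * ℓ * x - 2 * π * k * x := by
      push_cast; ring
    have e2 : 2 * π * ((ℓ : ℤ) + k : ℤ) * x = 2 * π * ℓ * x + 2 * π * k * x := by
      push_cast; ring
    rw [u_apply, e1, e2, Real.sin_sub, Real.sin_add]
    ring
  simp only [h]
  rw [intervalIntegral.integral_sub ((by fun_prop : Continuous _).intervalIntegrable _ _)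
    ((by fun_prop : Continuous _).intervalIntegrable _ _),
    intervalIntegral.integral_const_mul, intervalIntegral.integral_const_mul, integral_sin_mode,
    integral_sin_mode]
  simp

theorem z2_w {ℓ k : ℕ} (hℓ : 1 ≤ ℓ) : z2 ℓ (w k) = if k = ℓ then 1 else 0 := by
  rw [z2_eq]
  have h : ∀ x : ℝ, Real.cos (2 * π * ℓ * x) * w k (x : UnitAddCircle) =
      Real.cos (2 * π * (ℓ : ℤ) * x) - (1 / 2 * Real.cos (2 * π * ((ℓ : ℤ) - k : ℤ) * x)
        + 1 / 2 * Real.cos (2 * π * ((ℓ : ℤ) + k : ℤ) * x)) := by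
    intro x
    have e1 : 2 * π * ((ℓ : ℤ) - k : ℤ) * x = 2 * π * ℓ * x - 2 * π * k * x := by
      push_cast; ring
    have e2 : 2 * π * ((ℓ : ℤ) + k : ℤ) * x = 2 * π * ℓ * x + 2 * π * k * x := by
      push_cast; ring
    rw [w_apply, e1, e2, Real.cos_sub, Real.cos_add]
    push_cast
    ring
  simp only [h]
  rw [intervalIntegral.integral_sub ((by fun_prop : Continuous _).intervalIntegrable _ _)
    ((by fun_prop : Continuous _).intervalIntegrable _ _),
    intervalIntegral.integral_add ((by fun_prop : Continuous _).intervalIntegrable _ _)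
    ((by fun_prop : Continuous _).intervalIntegrable _ _),
    intervalIntegral.integral_const_mul, intervalIntegral.integral_const_mul, integral_cos_mode,
    integral_cos_mode, integral_cos_mode, if_neg (by omega : ¬ (ℓ : ℤ) = 0),
    if_neg (by omega : ¬ (ℓ : ℤ) + k = 0)]
  by_cases hk : k = ℓ
  · simp [hk]
  · rw [if_neg hk, if_neg (by omega)]
    simp

/-- A Lyapunov–Schmidt reduction of `F^q(v, p) = 0` at `(0, p₀)`: a continuous implicit function
`ψ` with values in `X₀`, defined for `v` in a neighbourhood `U` of `0` in `N` and `p` in a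
neighbourhood `V` of `p₀` in `𝒫`, with `ψ(0, p₀) = 0` and such that `ψ(v, p)` is the unique
solution `y` of `(I - Q) F^q(v + y, p) = 0` in a neighbourhood `Y` of `0` in `X₀`. The values of
`ψ` outside `U × V` play no role. -/
structure LSReduction (q ℓ : ℕ) (p₀ : Param) where
  U : Set (N ℓ)
  V : Set Param
  Y : Set (X0 ℓ)
  U_mem : U ∈ 𝓝 (0 : N ℓ)
  V_mem : V ∈ 𝓝 p₀
  V_subset : V ⊆ paramSpace
  Y_mem : Y ∈ 𝓝 (0 : X0 ℓ)
  ψ : N ℓ → Param → X0 ℓ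
  ψ_zero : ψ 0 p₀ = 0
  ψ_cont : ContinuousOn (fun z : N ℓ × Param => ψ z.1 z.2) (U ×ˢ V)
  ψ_mem : ∀ v ∈ U, ∀ p ∈ V, ψ v p ∈ Y
  ψ_unique : ∀ v ∈ U, ∀ p ∈ V, ∀ y ∈ Y,
    Fq q ((v : H10) + (y : H10)) p - Q ℓ (Fq q ((v : H10) + (y : H10)) p) = 0 ↔ y = ψ v p

/-- The reduced map `Φ(v, p) = Q F^q(v + ψ(v, p), p)`. -/
def LSReduction.Phi {q ℓ : ℕ} {p₀ : Param} (L : LSReduction q ℓ p₀) (v : N ℓ) (p : Param) :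
    UnitAddCircle → ℝ :=
  Q ℓ (Fq q ((v : H10) + (L.ψ v p : H10)) p)

/-- The element `a u_ℓ + b w_ℓ` of `N`, where `x = (a, b)`. -/
def nvec (ℓ : ℕ) (x : Fin 2 → ℝ) : N ℓ :=
  ⟨x 0 • u ℓ + x 1 • w ℓ, Submodule.add_mem _
    (Submodule.smul_mem _ _ (Submodule.subset_span (by simp)))
    (Submodule.smul_mem _ _ (Submodule.subset_span (by simp)))⟩

/-- The coordinate representation `Φ̂((a, b), s)` of `Φ` along the parameter curve `p`. -/
def LSReduction.hatPhi {q ℓ : ℕ} {p₀ : Param} (L : LSReduction q ℓ p₀) (p : ℝ → Param)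
    (x : Fin 2 → ℝ) (s : ℝ) : Fin 2 → ℝ :=
  ![z1 ℓ (L.Phi (nvec ℓ x) (p s)), z2 ℓ (L.Phi (nvec ℓ x) (p s))]

/-- The rotation matrix `A_φ`. -/
def rot (ℓ : ℕ) (φ : ℝ) : Matrix (Fin 2) (Fin 2) ℝ :=
  !![Real.cos (2 * π * ℓ * φ), Real.sin (2 * π * ℓ * φ);
    -Real.sin (2 * π * ℓ * φ), Real.cos (2 * π * ℓ * φ)]

end TwistedStates

end

noncomputable section

namespace TwistedStates

/-! Equivariance comes from a circle action. The circle acts on `H10` by `v ↦ v(· + z) - v(z)`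
(`rotate`). Every integrand of `F` depends only on differences of positions and phases, and the
subtracted terms are the values at `x = 0`, so the right-hand side commutes with this action
(`field_rotate`). On `N` the action is the matrix `rot` (`rotate_nvec`). The functionals `z1`, `z2`
transform by the same matrix, and `X0` is their common kernel (`mem_X0_of_z_eq_zero`), so `X0` is
invariant. Rotating the solution `ψ(v, p)` gives a solution over the rotated `v`, and uniqueness in
`Y` identifies it with `ψ` there (`ψ_rotate`). The set `Y` need not be invariant; the bound
`norm_rotate_le`, uniform in the angle, keeps the rotated solution in `Y` for small data. The
reduced map then inherits the equivariance (`hatPhi_rotate`).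

Existence is the implicit function theorem at `(0, p₀)`. The obstacle is that `W r` is discontinuous
while the equation lives in `H¹`. Shifting the integration variables by `x` removes `x` from the
argument of `W r`: each coupling term becomes an average over a parameter `θ` of `W r (proj θ)`
times the sine of a phase difference that depends linearly on `v` (`PhaseFamily`). Sine is a
superposition operator on `H¹` with quadratic remainder at `0`, and `r` enters only through the `L¹`
distance of `W r` and `W r'`. Since the averages vanish at `v = 0` for every `r`, this gives a
strict derivative there (`hasStrictFDerivAt_average`, `hasStrictFDerivAt_field`).

The linearization is diagonal on the `u k`, `w k`, with eigenvalues `c1 q k p` (`linearization_u`,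
`linearization_w`). The modes are orthogonal for the scalar product of derivatives, so the spectral
gap bounds the linearization below on `X0`. Its range there is closed and contains every spanning
mode, hence it is invertible (`isInvertible_linearizationX0`).

For these estimates weak derivatives are replaced by primitives (`IsWeakDeriv.isPrimitive`), and
`H10` is compared with `H1`, normed by the maximum of `‖f‖_∞` and `‖Df‖₂`. -/

instance : IsProbabilityMeasure (volume : Measure UnitAddCircle) := ⟨UnitAddCircle.measure_univ⟩

/-- The real space `L²(𝕊)`. -/
abbrev L2S : Type := Lp ℝ 2 (volume : Measure UnitAddCircle)

/-! ### Primitives on the circle -/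

theorem intervalIntegrable_circle {g : UnitAddCircle → ℝ} (hg : Integrable g) {a b : ℝ}
    (hab : a ≤ b) (hb : b ≤ a + 1) :
    IntervalIntegrable (fun x : ℝ => g (x : UnitAddCircle)) volume a b := by
  rw [intervalIntegrable_iff, uIoc_of_le hab]
  have h2 := (UnitAddCircle.measurePreserving_mk a).integrable_comp_of_integrable hg
  exact IntegrableOn.mono_set (t := Ioc a (a + 1)) h2 (Ioc_subset_Ioc_right hb)

theorem integrable_L2S (g : L2S) : Integrable g := (Lp.memLp g).integrable (by norm_num)

theorem ae_uIoc_of_ae {P : UnitAddCircle → Prop} (h : ∀ᵐ x, P x) {a b : ℝ}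
    (hab : a ≤ b) (hb : b ≤ a + 1) :
    ∀ᵐ x : ℝ ∂volume, x ∈ uIoc a b → P (x : UnitAddCircle) := by
  have h2 := (UnitAddCircle.measurePreserving_mk a).quasiMeasurePreserving.ae h
  rw [ae_restrict_iff' measurableSet_Ioc] at h2
  filter_upwards [h2] with x hx hm
  rw [uIoc_of_le hab] at hm
  exact hx (Ioc_subset_Ioc_right hb hm)

theorem integral_norm_le_L2S (g : L2S) : ∫ x, ‖g x‖ ≤ ‖g‖ := by
  rw [integral_norm_eq_lintegral_enorm (Lp.aestronglyMeasurable g), Lp.norm_def,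
    -- On a probability space the `L¹` norm is at most the `L²` norm.
    ← eLpNorm_one_eq_lintegral_enorm]
  exact ENNReal.toReal_mono (Lp.eLpNorm_ne_top g)
    (eLpNorm_le_eLpNorm_of_exponent_le (by norm_num) (Lp.aestronglyMeasurable g))

theorem norm_integral_interval_le (g : L2S) {a b : ℝ} (hab : a ≤ b) (hb : b ≤ a + 1) :
    ‖∫ t in a..b, g (t : UnitAddCircle)‖ ≤ ‖g‖ := by
  refine le_trans ?_ (integral_norm_le_L2S g)
  rw [← UnitAddCircle.intervalIntegral_preimage a]
  refine (intervalIntegral.norm_integral_le_integral_norm hab).trans ?_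
  refine intervalIntegral.integral_mono_interval le_rfl hab hb
    (ae_of_all _ fun _ => norm_nonneg _) ?_
  exact intervalIntegrable_circle (integrable_L2S g).norm (by linarith) le_rfl

/-- Integration of a square integrable function over an arc. -/
def arcIntegral (a b : ℝ) (hab : a ≤ b) (hb : b ≤ a + 1) : L2S →L[ℝ] ℝ :=
  LinearMap.mkContinuous
    { toFun := fun g => ∫ t in a..b, g (t : UnitAddCircle)
      map_add' := fun g h => by
        rw [← intervalIntegral.integral_add (intervalIntegrable_circle (integrable_L2S g) hab hb)
          (intervalIntegrable_circle (integrable_L2S h) hab hb)]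
        refine intervalIntegral.integral_congr_ae ?_
        filter_upwards [ae_uIoc_of_ae (Lp.coeFn_add g h) hab hb] with x hx hm
        exact hx hm
      map_smul' := fun c g => by
        rw [RingHom.id_apply, smul_eq_mul, ← intervalIntegral.integral_const_mul]
        refine intervalIntegral.integral_congr_ae ?_
        filter_upwards [ae_uIoc_of_ae (Lp.coeFn_smul c g) hab hb] with x hx hm
        exact hx hm } 1
    (fun g => by rw [one_mul]; exact norm_integral_interval_le g hab hb)

theorem arcIntegral_apply {a b : ℝ} (hab : a ≤ b) (hb : b ≤ a + 1) (g : L2S) :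
    arcIntegral a b hab hb g = ∫ t in a..b, g (t : UnitAddCircle) := rfl

/-- `f` is a primitive of `g` on every arc of length at most one. -/
def IsPrimitive (f g : UnitAddCircle → ℝ) : Prop :=
  ∀ a b : ℝ, a ≤ b → b ≤ a + 1 →
    f (b : UnitAddCircle) - f (a : UnitAddCircle) = ∫ t in a..b, g (t : UnitAddCircle)

theorem isPrimitive_iff (f : C(UnitAddCircle, ℝ)) (g : L2S) :
    IsPrimitive f g ↔ ∀ a b : ℝ, ∀ hab : a ≤ b, ∀ hb : b ≤ a + 1,
      f (b : UnitAddCircle) - f (a : UnitAddCircle) - arcIntegral a b hab hb g = 0 := by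
  simp only [IsPrimitive, sub_eq_zero, arcIntegral_apply]

/-- The space `H¹(𝕊)`, as the space of pairs of a continuous function and its derivative. -/
def H1Sub : Submodule ℝ (C(UnitAddCircle, ℝ) × L2S) where
  carrier := {v | IsPrimitive v.1 v.2}
  zero_mem' := by
    simp only [mem_ofPred_eq, isPrimitive_iff]
    simp
  add_mem' := by
    intro v w hv hw
    simp only [mem_ofPred_eq, isPrimitive_iff] at *
    intro a b hab hb
    have h1 := hv a b hab hb
    have h2 := hw a b hab hb
    simp only [Prod.fst_add, Prod.snd_add, map_add, ContinuousMap.add_apply]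
    linarith
  smul_mem' := by
    intro c v hv
    simp only [mem_ofPred_eq, isPrimitive_iff] at *
    intro a b hab hb
    have h1 := hv a b hab hb
    simp only [Prod.smul_fst, Prod.smul_snd, map_smul, ContinuousMap.smul_apply, smul_eq_mul]
    linear_combination c * h1

theorem mem_H1Sub {v : C(UnitAddCircle, ℝ) × L2S} : v ∈ H1Sub ↔ IsPrimitive v.1 v.2 := Iff.rfl

/-- Being a primitive is a family of equations between continuous functionals of the pair, namely
point evaluations and `arcIntegral`. Closedness makes `H1` complete. -/
theorem isClosed_H1Sub : IsClosed (H1Sub : Set (C(UnitAddCircle, ℝ) × L2S)) := by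
  have h : (H1Sub : Set (C(UnitAddCircle, ℝ) × L2S)) =
      ⋂ (a : ℝ) (b : ℝ) (hab : a ≤ b) (hb : b ≤ a + 1), {v | v.1 (b : UnitAddCircle) -
        v.1 (a : UnitAddCircle) - arcIntegral a b hab hb v.2 = 0} := by
    ext v
    simp only [SetLike.mem_coe, mem_H1Sub, isPrimitive_iff, mem_iInter, mem_ofPred_eq]
  rw [h]
  refine isClosed_iInter fun a => isClosed_iInter fun b => isClosed_iInter fun hab =>
    isClosed_iInter fun hb => isClosed_eq ?_ continuous_const
  have e : ∀ x : UnitAddCircle, Continuous fun v : C(UnitAddCircle, ℝ) × L2S => v.1 x := fun x =>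
    (continuous_eval_const x).comp continuous_fst
  exact ((e _).sub (e _)).sub ((arcIntegral a b hab hb).continuous.comp continuous_snd)

/-- The space `H¹(𝕊)` with the norm `max ‖f‖_∞ ‖Df‖₂`. -/
def H1 : Type := H1Sub

instance : NormedAddCommGroup H1 := inferInstanceAs (NormedAddCommGroup H1Sub)

instance : NormedSpace ℝ H1 := inferInstanceAs (NormedSpace ℝ H1Sub)

instance : CompleteSpace H1 := isClosed_H1Sub.completeSpace_coe

theorem H1.norm_fst_le (f : H1) : ‖f.1.1‖ ≤ ‖f‖ := le_max_left _ _

theorem H1.norm_snd_le (f : H1) : ‖f.1.2‖ ≤ ‖f‖ := le_max_right _ _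

/-- Evaluation at a point of the circle. -/
def H1.eval (x : UnitAddCircle) : H1 →L[ℝ] ℝ :=
  LinearMap.mkContinuous
    { toFun := fun f => f.1.1 x
      map_add' := fun _ _ => rfl
      map_smul' := fun _ _ => rfl } 1
    (fun f => by
      rw [one_mul]
      exact (f.1.1.norm_coe_le_norm x).trans f.norm_fst_le)

theorem H1.eval_apply (x : UnitAddCircle) (f : H1) : H1.eval x f = f.1.1 x := rfl

/-! ### The chain rule and integration by parts -/

theorem _root_.AbsolutelyContinuousOnInterval.lipschitz_comp {f h : ℝ → ℝ} {a b : ℝ}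
    (hf : AbsolutelyContinuousOnInterval f a b) {K : NNReal} (hh : LipschitzWith K h) :
    AbsolutelyContinuousOnInterval (fun x => h (f x)) a b := by
  rw [absolutelyContinuousOnInterval_iff] at *
  intro ε hε
  -- `K + 1` rather than `K`, so that `K = 0` needs no separate treatment.
  obtain ⟨d, hd, H⟩ := hf (ε / (K + 1)) (by positivity)
  refine ⟨d, hd, fun E hE hs => ?_⟩
  have h1 := H E hE hs
  rw [lt_div_iff₀ (by positivity)] at h1
  refine lt_of_le_of_lt ?_ h1
  rw [Finset.sum_mul]
  refine Finset.sum_le_sum fun i _ => ?_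
  refine (hh.dist_le_mul _ _).trans ?_
  have : 0 ≤ dist (f (E.2 i).1) (f (E.2 i).2) := dist_nonneg
  nlinarith

theorem absolutelyContinuousOnInterval_const_add_integral {g : ℝ → ℝ} {a b : ℝ}
    (hg : IntervalIntegrable g volume a b) (c : ℝ) :
    AbsolutelyContinuousOnInterval (fun x => c + ∫ t in a..x, g t) a b :=
  AbsolutelyContinuousOnInterval.fun_add
    (LipschitzOnWith.absolutelyContinuousOnInterval (K := 0)
      ((LipschitzWith.const c).lipschitzOnWith))
    (hg.absolutelyContinuousOnInterval_intervalIntegral (by simp))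

theorem ae_hasDerivAt_const_add_integral {g : ℝ → ℝ} {a b : ℝ}
    (hg : IntervalIntegrable g volume a b) (c : ℝ) :
    ∀ᵐ x, x ∈ uIcc a b → HasDerivAt (fun x => c + ∫ t in a..x, g t) (g x) x := by
  filter_upwards [hg.ae_hasDerivAt_integral] with x hx hm
  exact (hx hm a (by simp)).const_add c

theorem IsPrimitive.eq_add_integral {f g : UnitAddCircle → ℝ} (h : IsPrimitive f g) {a t : ℝ}
    (h1 : a ≤ t) (h2 : t ≤ a + 1) :
    f (a : UnitAddCircle) + ∫ s in a..t, g (s : UnitAddCircle) = f (t : UnitAddCircle) := by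
  rw [← h a t h1 h2]; ring

/-- A primitive is absolutely continuous, and so is its composition with the Lipschitz `φ`. The
fundamental theorem for absolutely continuous functions then applies, with the chain rule holding
almost everywhere. -/
theorem IsPrimitive.comp {f g : UnitAddCircle → ℝ} (h : IsPrimitive f g) (hg : Integrable g)
    {φ φ' : ℝ → ℝ} (hφ : ∀ x, HasDerivAt φ (φ' x) x) {K : NNReal} (hL : LipschitzWith K φ) :
    IsPrimitive (fun x => φ (f x)) (fun x => φ' (f x) * g x) := by
  intro a b hab hb
  have hi := intervalIntegrable_circle hg hab hb
  -- `F` is the explicit primitive on the line; it is identified with `f` only on `[a, b]`, which is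
  -- all that the integral sees.
  set F : ℝ → ℝ := fun x => f (a : UnitAddCircle) + ∫ s in a..x, g (s : UnitAddCircle) with hF
  have hac : AbsolutelyContinuousOnInterval (fun x => φ (F x)) a b :=
    (absolutelyContinuousOnInterval_const_add_integral hi _).lipschitz_comp hL
  have e : ∀ t, a ≤ t → t ≤ b → F t = f (t : UnitAddCircle) := fun t h1 h2 =>
    h.eq_add_integral h1 (h2.trans hb)
  change φ (f (b : UnitAddCircle)) - φ (f (a : UnitAddCircle)) = _
  rw [← e b hab le_rfl, ← e a le_rfl hab, ← hac.integral_deriv_eq_sub]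
  refine intervalIntegral.integral_congr_ae ?_
  filter_upwards [ae_hasDerivAt_const_add_integral hi (f (a : UnitAddCircle))] with x hx hm
  have hm' := uIoc_subset_uIcc hm
  rw [uIcc_of_le hab] at hm'
  rw [← e x hm'.1 hm'.2]
  exact ((hφ (F x)).comp x (hx (uIoc_subset_uIcc hm))).deriv

theorem IsPrimitive.isWeakDeriv {f g : UnitAddCircle → ℝ} (h : IsPrimitive f g)
    (hg : Integrable g) : IsWeakDeriv f g := by
  intro η hη hp
  have hi := intervalIntegrable_circle (a := 0) (b := 1) hg zero_le_one (by norm_num)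
  set F : ℝ → ℝ := fun x => f ((0 : ℝ) : UnitAddCircle) + ∫ s in 0..x, g (s : UnitAddCircle)
    with hF
  have hac : AbsolutelyContinuousOnInterval F 0 1 :=
    absolutelyContinuousOnInterval_const_add_integral hi _
  have hηac : AbsolutelyContinuousOnInterval η 0 1 :=
    ContDiffOn.absolutelyContinuousOnInterval (hη.of_le (by norm_num)).contDiffOn
  have e : ∀ t, 0 ≤ t → t ≤ 1 → F t = f (t : UnitAddCircle) := fun t h1 h2 =>
    h.eq_add_integral h1 (by linarith)
  have h1 := hac.integral_mul_deriv_eq_deriv_mul hηac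
  have e1 : ((1 : ℝ) : UnitAddCircle) = ((0 : ℝ) : UnitAddCircle) := by simp
  have e2 : η 1 = η 0 := by simpa using hp 0
  rw [e 0 le_rfl zero_le_one, e 1 zero_le_one le_rfl, e1, e2, sub_self, zero_sub] at h1
  have h2 : ∫ x in (0:ℝ)..1, F x * deriv η x = ∫ x in (0:ℝ)..1, f (x : UnitAddCircle) * deriv η x := by
    refine intervalIntegral.integral_congr fun x hx => ?_
    rw [uIcc_of_le zero_le_one] at hx
    simp only [e x hx.1 hx.2]
  have h3 : ∫ x in (0:ℝ)..1, deriv F x * η x = ∫ x in (0:ℝ)..1, g (x : UnitAddCircle) * η x := by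
    refine intervalIntegral.integral_congr_ae ?_
    filter_upwards [ae_hasDerivAt_const_add_integral hi (f ((0 : ℝ) : UnitAddCircle))] with x hx hm
    rw [(hx (uIoc_subset_uIcc hm)).deriv]
  rw [← h2, h1, h3]

/-! ### Completeness of the trigonometric system -/

/-- Parseval for complex Fourier series: the `n`-th coefficient is a combination of the cosine and
sine integrals of frequency `|n|`, with the sign of `n` carried by the sine. -/
theorem L2S_eq_zero_of_trig (g : L2S) (hc : ∀ k : ℕ, ∫ x, cosMode k x * g x = 0)
    (hs : ∀ k : ℕ, ∫ x, sinMode k x * g x = 0) : g = 0 := by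
  have hvol : (AddCircle.haarAddCircle : Measure UnitAddCircle) = volume := by
    rw [AddCircle.volume_eq_smul_haarAddCircle]; simp
  have hm : MemLp (fun x => (g x : ℂ)) 2 (AddCircle.haarAddCircle : Measure UnitAddCircle) := by
    rw [hvol]; exact (Lp.memLp g).ofReal
  have hcoe := hm.coeFn_toLp
  have key : ∀ n : ℤ, fourierCoeff (hm.toLp) n = 0 := by
    intro n
    rw [fourierCoeff_congr_ae hcoe, fourierCoeff, hvol]
    have hci : Integrable fun x => cosMode n.natAbs x * g x :=
      (integrable_L2S g).bdd_mul (c := ‖cosMode n.natAbs‖)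
        (cosMode n.natAbs).continuous.aestronglyMeasurable
        (ae_of_all _ fun x => (cosMode n.natAbs).norm_coe_le_norm x)
    have hsi : Integrable fun x => sinMode n.natAbs x * g x :=
      (integrable_L2S g).bdd_mul (c := ‖sinMode n.natAbs‖)
        (sinMode n.natAbs).continuous.aestronglyMeasurable
        (ae_of_all _ fun x => (sinMode n.natAbs).norm_coe_le_norm x)
    have e : ∀ x : UnitAddCircle, fourier (-n) x • (g x : ℂ) =
        ((cosMode n.natAbs x * g x : ℝ) : ℂ) -
          (n.sign : ℂ) * Complex.I * ((sinMode n.natAbs x * g x : ℝ) : ℂ) := by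
      intro x
      induction x using QuotientAddGroup.induction_on with | H t => ?_
      have e1 : (2 * π * Complex.I * ((-n : ℤ) : ℂ) * t / ((1 : ℝ) : ℂ)) =
          ((-(2 * π * n * t) : ℝ) : ℂ) * Complex.I := by
        push_cast; ring
      have hn : (n : ℝ) = n.sign * (n.natAbs : ℝ) := by
        have := congrArg (Int.cast : ℤ → ℝ) (Int.sign_mul_natAbs n).symm
        rwa [Int.cast_mul, Int.cast_natCast] at this
      have h2 : Real.cos (2 * π * n * t) = Real.cos (2 * π * n.natAbs * t) := by
        rcases lt_trichotomy n 0 with h | h | h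
        · rw [hn, Int.sign_eq_neg_one_of_neg h, ← Real.cos_neg]; congr 1; push_cast; ring
        · simp [h]
        · rw [hn, Int.sign_eq_one_of_pos h]; simp
      have h3 : Real.sin (2 * π * n * t) = n.sign * Real.sin (2 * π * n.natAbs * t) := by
        rcases lt_trichotomy n 0 with h | h | h
        · rw [hn, Int.sign_eq_neg_one_of_neg h]; push_cast
          rw [neg_one_mul (Real.sin _), ← Real.sin_neg]
          congr 1; ring
        · simp [h]
        · rw [hn, Int.sign_eq_one_of_pos h]; simp
      change fourier (-n) (t : UnitAddCircle) • (g (t : UnitAddCircle) : ℂ) =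
        ((Real.cos (2 * π * n.natAbs * t) * g (t : UnitAddCircle) : ℝ) : ℂ) -
          (n.sign : ℂ) * Complex.I *
            ((Real.sin (2 * π * n.natAbs * t) * g (t : UnitAddCircle) : ℝ) : ℂ)
      rw [fourier_coe_apply, e1, Complex.exp_mul_I, ← Complex.ofReal_cos, ← Complex.ofReal_sin,
        Real.cos_neg, Real.sin_neg, h2, h3, smul_eq_mul]
      push_cast
      ring
    simp only [e]
    rw [integral_sub hci.ofReal (hsi.ofReal.const_mul _), integral_const_mul,
      integral_complex_ofReal, integral_complex_ofReal, hc, hs]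
    simp
  have h0 := hasSum_sq_fourierCoeff (hm.toLp)
  simp only [key, norm_zero, ne_eq, OfNat.ofNat_ne_zero, not_false_eq_true, zero_pow] at h0
  have h1 := h0.unique hasSum_zero
  have hint : Integrable (fun t => ‖(hm.toLp : UnitAddCircle → ℂ) t‖ ^ 2)
      (AddCircle.haarAddCircle : Measure UnitAddCircle) :=
    (Lp.memLp _).integrable_norm_pow (by norm_num)
  rw [integral_eq_zero_iff_of_nonneg (fun _ => by positivity) hint] at h1
  have h2 : {x | g x = 0} ∈ ae (AddCircle.haarAddCircle : Measure UnitAddCircle) := by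
    filter_upwards [h1, hcoe] with x hx hy
    rw [Pi.zero_apply, hy] at hx
    simpa using hx
  have hae : ae (AddCircle.haarAddCircle : Measure UnitAddCircle) = ae volume := by rw [hvol]
  rw [hae] at h2
  exact (Lp.eq_zero_iff_ae_eq_zero).mpr h2

/-! ### Weak derivatives are derivatives of primitives -/

theorem IsWeakDeriv.integral_eq_zero {f g : UnitAddCircle → ℝ} (h : IsWeakDeriv f g) :
    ∫ x in (0 : ℝ)..1, g (x : UnitAddCircle) = 0 := by
  have := h (fun _ => 1) contDiff_const (fun _ => rfl)
  simpa using this.symm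

theorem intervalIntegrable_circle_all {g : UnitAddCircle → ℝ} (hg : Integrable g) (a b : ℝ) :
    IntervalIntegrable (fun x : ℝ => g (x : UnitAddCircle)) volume a b := by
  have hp : Function.Periodic (fun x : ℝ => g (x : UnitAddCircle)) 1 := fun x => by
    simp
  exact hp.intervalIntegrable₀ one_ne_zero
    (intervalIntegrable_circle hg zero_le_one (by norm_num)) a b

/-- The zero mean of `g` is what makes its primitive on the line periodic, so that it descends to
the circle. -/
theorem exists_isPrimitive (g : L2S) (h0 : ∫ x in (0 : ℝ)..1, g (x : UnitAddCircle) = 0) :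
    ∃ P : C(UnitAddCircle, ℝ), IsPrimitive P g := by
  have hi := intervalIntegrable_circle_all (integrable_L2S g)
  have hcont : Continuous fun x : ℝ => ∫ t in (0 : ℝ)..x, g (t : UnitAddCircle) :=
    intervalIntegral.continuous_primitive hi 0
  have hp : Function.Periodic (fun x : ℝ => g (x : UnitAddCircle)) 1 := fun x => by
    simp
  have hper : Function.Periodic (fun x : ℝ => ∫ t in (0 : ℝ)..x, g (t : UnitAddCircle)) 1 := by
    intro x
    have h1 := hp.intervalIntegral_add_eq x 0
    rw [zero_add, h0] at h1
    change ∫ t in (0 : ℝ)..(x + 1), g (t : UnitAddCircle) = _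
    rw [← intervalIntegral.integral_add_adjacent_intervals (hi 0 x) (hi x (x + 1)), h1, add_zero]
  refine ⟨⟨hper.lift, continuous_coinduced_dom.mpr hcont⟩, fun a b _ _ => ?_⟩
  exact intervalIntegral.integral_interval_sub_left (hi 0 b) (hi 0 a)

/-- The definition of the weak derivative, tested against the sine and cosine modes. -/
theorem integral_trig_deriv_eq_zero {f g : UnitAddCircle → ℝ} (h : IsWeakDeriv f g) (k : ℕ) :
    (∫ x, cosMode k x * g x) = 2 * π * k * ∫ x, sinMode k x * f x ∧
    (∫ x, sinMode k x * g x) = -(2 * π * k * ∫ x, cosMode k x * f x) := by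
  simp only [← UnitAddCircle.intervalIntegral_preimage 0, zero_add]
  have hs : ∀ t : ℝ, HasDerivAt (fun s : ℝ => Real.sin (2 * π * k * s))
      (2 * π * k * Real.cos (2 * π * k * t)) t := fun t => by
    simpa [mul_comm] using ((hasDerivAt_id t).const_mul (2 * π * k)).sin
  have hc : ∀ t : ℝ, HasDerivAt (fun s : ℝ => Real.cos (2 * π * k * s))
      (-(2 * π * k * Real.sin (2 * π * k * t))) t := fun t => by
    simpa [mul_comm] using ((hasDerivAt_id t).const_mul (2 * π * k)).cos
  have ps : Function.Periodic (fun s : ℝ => Real.sin (2 * π * k * s)) 1 := fun t => by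
    have h : 2 * π * k * (t + 1) = 2 * π * k * t + k * (2 * π) := by ring
    simp only [h, Real.sin_add_nat_mul_two_pi]
  have pc : Function.Periodic (fun s : ℝ => Real.cos (2 * π * k * s)) 1 := fun t => by
    have h : 2 * π * k * (t + 1) = 2 * π * k * t + k * (2 * π) := by ring
    simp only [h, Real.cos_add_nat_mul_two_pi]
  have h1 := h _ (by fun_prop) ps
  have h2 := h _ (by fun_prop) pc
  simp only [(hs _).deriv] at h1
  simp only [(hc _).deriv] at h2
  constructor
  · rw [← intervalIntegral.integral_const_mul]
    have e : ∀ x : ℝ, cosMode k x * g x = g x * Real.cos (2 * π * k * x) := fun x => by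
      rw [cosMode_coe, mul_comm]
    simp only [e]
    rw [← neg_inj, ← h2, ← intervalIntegral.integral_neg]
    refine intervalIntegral.integral_congr fun x _ => ?_
    simp only [sinMode_coe]
    ring
  · rw [← intervalIntegral.integral_const_mul]
    have e : ∀ x : ℝ, sinMode k x * g x = g x * Real.sin (2 * π * k * x) := fun x => by
      rw [sinMode_coe, mul_comm]
    simp only [e]
    rw [← neg_inj, ← h1, neg_neg]
    refine intervalIntegral.integral_congr fun x _ => ?_
    simp only [cosMode_coe]
    ring

/-- A primitive `P` of `g` also has weak derivative `g`, so `f` and `P` share all Fourier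
coefficients of positive frequency. By completeness of the modes `f - P` is constant, equal to its
mean `c`. -/
theorem IsWeakDeriv.isPrimitive {f : C(UnitAddCircle, ℝ)} {g : L2S} (h : IsWeakDeriv f g) :
    IsPrimitive f g := by
  obtain ⟨P, hP⟩ := exists_isPrimitive g h.integral_eq_zero
  have hPw := hP.isWeakDeriv (integrable_L2S g)
  have hci : ∀ φ : C(UnitAddCircle, ℝ), Integrable φ := fun φ =>
    φ.continuous.integrable_of_hasCompactSupport (HasCompactSupport.of_compactSpace _)
  set c : ℝ := ∫ x, (f - P) x with hc
  have hzero : ContinuousMap.toLp 2 volume ℝ (f - P - ContinuousMap.const _ c) =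
      (0 : L2S) := by
    have hcoe := ContinuousMap.coeFn_toLp (p := 2) (𝕜 := ℝ) volume
      (f - P - ContinuousMap.const _ c)
    have hk : ∀ φ : C(UnitAddCircle, ℝ), ∫ x, φ x * (ContinuousMap.toLp 2 volume ℝ
        (f - P - ContinuousMap.const _ c) : L2S) x =
        (∫ x, φ x * f x) - (∫ x, φ x * P x) - c * ∫ x, φ x := by
      intro φ
      have hf : Integrable fun x => φ x * f x := hci (φ * f)
      have hP : Integrable fun x => φ x * P x := hci (φ * P)
      have hfP : Integrable fun x => φ x * f x - φ x * P x := hf.sub hP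
      rw [← integral_const_mul, ← integral_sub hf hP,
        ← integral_sub hfP ((hci φ).const_mul c)]
      refine integral_congr_ae ?_
      filter_upwards [hcoe] with x hx
      rw [hx]
      simp only [ContinuousMap.sub_apply, ContinuousMap.const_apply]
      ring
    have hic : ∀ k : ℕ, ∫ x, cosMode k x = if k = 0 then 1 else 0 := fun k => by
      rw [← UnitAddCircle.intervalIntegral_preimage 0]
      simpa using integral_cos_mode k
    have his : ∀ k : ℕ, ∫ x, sinMode k x = 0 := fun k => by
      rw [← UnitAddCircle.intervalIntegral_preimage 0]
      simpa using integral_sin_mode k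
    refine L2S_eq_zero_of_trig _ (fun k => ?_) fun k => ?_
    · rw [hk, hic]
      rcases Nat.eq_zero_or_pos k with rfl | hk0
      · have e : ∀ x, cosMode 0 x = 1 := fun x => by
          induction x using QuotientAddGroup.induction_on with | H t => ?_
          exact (cosMode_coe 0 t).trans (by simp)
        simp only [e, one_mul, if_true, mul_one]
        rw [hc, ← integral_sub (hci f) (hci P)]
        simp
      · have h1 := (integral_trig_deriv_eq_zero h k).2
        rw [(integral_trig_deriv_eq_zero hPw k).2] at h1
        have : (2 * π * k : ℝ) ≠ 0 := by positivity
        rw [neg_inj, mul_right_inj' this] at h1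
        rw [h1, if_neg hk0.ne']
        simp
    · rw [hk, his]
      rcases Nat.eq_zero_or_pos k with rfl | hk0
      · have e : ∀ x, sinMode 0 x = 0 := fun x => by
          induction x using QuotientAddGroup.induction_on with | H t => ?_
          exact (sinMode_coe 0 t).trans (by simp)
        simp [e]
      · have h1 := (integral_trig_deriv_eq_zero h k).1
        rw [(integral_trig_deriv_eq_zero hPw k).1] at h1
        have : (2 * π * k : ℝ) ≠ 0 := by positivity
        rw [mul_right_inj' this] at h1
        rw [h1]
        simp
  have h2 : f - P - ContinuousMap.const _ c = 0 :=
    ContinuousMap.toLp_injective (𝕜 := ℝ) (p := 2) (volume : Measure UnitAddCircle)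
      (by rw [hzero, map_zero])
  have h3 : ∀ x, f x = P x + c := fun x => by
    have := congrArg (fun φ : C(UnitAddCircle, ℝ) => φ x) h2
    simp only [ContinuousMap.sub_apply, ContinuousMap.const_apply, ContinuousMap.zero_apply] at this
    linarith
  intro a b hab hb
  rw [h3, h3, ← hP a b hab hb]
  ring

/-! ### Comparison of `H¹₀` and `H¹` -/

theorem H10.isPrimitive (v : H10) : IsPrimitive v v.D := IsWeakDeriv.isPrimitive v.2.2

theorem H10.apply_zero (v : H10) : v 0 = 0 := v.2.1

theorem H10.norm_sq_eq (v : H10) :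
    ‖v‖ ^ 2 = ‖ContinuousMap.toLp 2 (volume : Measure UnitAddCircle) ℝ v.toCont‖ ^ 2 +
      ‖v.D‖ ^ 2 :=
  WithLp.prod_norm_sq_eq_of_L2 (H10.embed v)

theorem H10.norm_D_le (v : H10) : ‖v.D‖ ≤ ‖v‖ := by
  refine abs_le_of_sq_le_sq' ?_ (norm_nonneg _) |>.2
  rw [H10.norm_sq_eq]
  nlinarith [sq_nonneg ‖ContinuousMap.toLp 2 (volume : Measure UnitAddCircle) ℝ v.toCont‖]

theorem norm_toLp_le (f : C(UnitAddCircle, ℝ)) :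
    ‖ContinuousMap.toLp 2 (volume : Measure UnitAddCircle) ℝ f‖ ≤ ‖f‖ := by
  refine (ContinuousLinearMap.le_opNorm _ _).trans ?_
  refine (mul_le_mul_of_nonneg_right (ContinuousMap.toLp_norm_le _) (norm_nonneg _)).trans ?_
  simp [measureUnivNNReal]

theorem H10.norm_le_add (v : H10) : ‖v‖ ≤ ‖v.toCont‖ + ‖v.D‖ := by
  refine abs_le_of_sq_le_sq' ?_ (by positivity) |>.2
  rw [H10.norm_sq_eq]
  have h := norm_toLp_le v.toCont
  have h0 := norm_nonneg (ContinuousMap.toLp 2 (volume : Measure UnitAddCircle) ℝ v.toCont)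
  nlinarith [norm_nonneg v.toCont, norm_nonneg v.D]

/-- Since `v 0 = 0`, each value of `v` is the integral of `v.D` over an arc. This Poincaré
inequality makes `‖v.D‖` an equivalent norm on `H10`. -/
theorem H10.norm_toCont_le (v : H10) : ‖v.toCont‖ ≤ ‖v.D‖ := by
  refine (ContinuousMap.norm_le _ (norm_nonneg _)).mpr fun x => ?_
  obtain ⟨t, ht, rfl⟩ : ∃ t ∈ Ico (0 : ℝ) (0 + 1), (t : UnitAddCircle) = x :=
    ⟨_, (AddCircle.equivIco 1 0 x).2, (AddCircle.equivIco 1 0).symm_apply_apply x⟩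
  have h := v.isPrimitive 0 t ht.1 ht.2.le
  have h0 : v ((0 : ℝ) : UnitAddCircle) = 0 := v.apply_zero
  rw [h0, sub_zero] at h
  rw [h]
  exact norm_integral_interval_le v.D ht.1 ht.2.le

theorem H10.norm_le_two_mul (v : H10) : ‖v‖ ≤ 2 * ‖v.D‖ := by
  linarith [v.norm_le_add, v.norm_toCont_le]

/-- The function determines its derivative: the weak derivative of `0` has vanishing Fourier
coefficients. Hence identities in `H10` can be checked pointwise. -/
theorem H10.ext {v w : H10} (h : ∀ x, v x = w x) : v = w := by
  have : v.toCont = w.toCont := ContinuousMap.ext h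
  refine sub_eq_zero.mp (norm_eq_zero.mp ?_)
  have hn := (v - w).norm_le_two_mul
  have hp := (v - w).isPrimitive
  have h0 : (v - w).D = 0 := by
    have hz : (v - w).toCont = 0 := by
      change v.toCont - w.toCont = 0
      rw [this, sub_self]
    have hw : IsWeakDeriv (v - w).toCont (v - w).D := (v - w).2.2
    rw [hz] at hw
    have ht := integral_trig_deriv_eq_zero hw
    simp only [ContinuousMap.zero_apply, mul_zero, integral_zero, neg_zero] at ht
    exact L2S_eq_zero_of_trig _ (fun k => (ht k).1) fun k => (ht k).2
  rw [h0, norm_zero, mul_zero] at hn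
  exact le_antisymm hn (norm_nonneg _)

/-- The weak derivative as a continuous linear map. -/
def H10.DL : H10 →L[ℝ] L2S :=
  LinearMap.mkContinuous
    { toFun := H10.D
      map_add' := fun _ _ => rfl
      map_smul' := fun _ _ => rfl } 1 (fun v => by rw [one_mul]; exact v.norm_D_le)

/-- The inclusion of `H¹₀` in `H¹`. -/
def H10.toH1 : H10 →L[ℝ] H1 :=
  LinearMap.mkContinuous
    { toFun := fun v => ⟨(v.toCont, v.D), v.isPrimitive⟩
      map_add' := fun _ _ => rfl
      map_smul' := fun _ _ => rfl } 1
    (fun v => by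
      rw [one_mul]
      exact max_le (v.norm_toCont_le.trans v.norm_D_le) v.norm_D_le)

theorem H10.toH1_fst (v : H10) (x : UnitAddCircle) : (H10.toH1 v).1.1 x = v x := rfl

theorem H10.norm_toH1_le (v : H10) : ‖H10.toH1 v‖ ≤ ‖v‖ :=
  max_le (v.norm_toCont_le.trans v.norm_D_le) v.norm_D_le

/-- The projection `f ↦ f - f(0)` of `H¹` onto `H¹₀`. -/
def H1.toH10 : H1 →L[ℝ] H10 :=
  LinearMap.mkContinuous
    { toFun := fun f => ⟨(f.1.1 - ContinuousMap.const _ (f.1.1 0), f.1.2), by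
        refine ⟨by simp, IsPrimitive.isWeakDeriv (fun a b hab hb => ?_) (integrable_L2S _)⟩
        rw [← f.2 a b hab hb]
        simp⟩
      map_add' := fun f g => by
        refine H10.ext fun x => ?_
        change f.1.1 x + g.1.1 x - (f.1.1 0 + g.1.1 0) = f.1.1 x - f.1.1 0 + (g.1.1 x - g.1.1 0)
        ring
      map_smul' := fun c f => by
        refine H10.ext fun x => ?_
        change c * f.1.1 x - c * f.1.1 0 = c * (f.1.1 x - f.1.1 0)
        ring } 3
    (fun f => by
      -- The constant 3: subtracting `f 0` at most doubles the supremum norm, and the derivative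
      -- contributes one more `‖f‖`.
      refine (H10.norm_le_add _).trans ?_
      have h1 : ‖f.1.1 - ContinuousMap.const _ (f.1.1 0)‖ ≤ ‖f.1.1‖ + ‖f.1.1‖ := by
        refine (norm_sub_le _ _).trans (add_le_add_right ?_ _)
        exact (ContinuousMap.norm_le _ (norm_nonneg _)).mpr fun x => f.1.1.norm_coe_le_norm 0
      have h2 := f.norm_fst_le
      have h3 := f.norm_snd_le
      change ‖f.1.1 - ContinuousMap.const _ (f.1.1 0)‖ + ‖f.1.2‖ ≤ 3 * ‖f‖
      linarith)

theorem H1.toH10_apply (f : H1) (x : UnitAddCircle) : H1.toH10 f x = f.1.1 x - f.1.1 0 := rfl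

theorem H1.norm_toH10_le (f : H1) : ‖H1.toH10 f‖ ≤ 3 * ‖f‖ := by
  have h : ‖H1.toH10‖ ≤ 3 := LinearMap.mkContinuous_norm_le _ (by norm_num) _
  exact H1.toH10.le_of_opNorm_le h f

/-- `H10` is a retract of `H1`, and so inherits completeness from it. -/
theorem H10.toH10_toH1 (v : H10) : H1.toH10 (H10.toH1 v) = v :=
  H10.ext fun x => by
    rw [H1.toH10_apply, H10.toH1_fst, H10.toH1_fst, v.apply_zero, sub_zero]

instance : CompleteSpace H10 := by
  refine Metric.complete_of_cauchySeq_tendsto fun s hs => ?_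
  obtain ⟨f, hf⟩ := cauchySeq_tendsto_of_complete
    (H10.toH1.uniformContinuous.comp_cauchySeq hs)
  refine ⟨H1.toH10 f, ?_⟩
  have := (H1.toH10.continuous.tendsto f).comp hf
  simpa only [Function.comp_def, H10.toH10_toH1] using this

/-! ### Superposition operators on `H¹` -/

/-- Multiplication of a square integrable function by a continuous one. -/
def mulC (φ : C(UnitAddCircle, ℝ)) (g : L2S) : L2S :=
  ((ContinuousMap.toLp ⊤ volume ℝ φ : Lp ℝ ⊤ (volume : Measure UnitAddCircle)) • g : L2S)

theorem coeFn_mulC (φ : C(UnitAddCircle, ℝ)) (g : L2S) : mulC φ g =ᵐ[volume] fun x => φ x * g x := by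
  filter_upwards [Lp.coeFn_lpSMul (r := 2)
    (ContinuousMap.toLp ⊤ volume ℝ φ : Lp ℝ ⊤ (volume : Measure UnitAddCircle)) g,
    ContinuousMap.coeFn_toLp (p := ⊤) (𝕜 := ℝ) (volume : Measure UnitAddCircle) φ] with x h1 h2
  rw [mulC, h1, Pi.smul_apply', h2, smul_eq_mul]

theorem norm_mulC_le (φ : C(UnitAddCircle, ℝ)) (g : L2S) : ‖mulC φ g‖ ≤ ‖φ‖ * ‖g‖ := by
  refine (Lp.norm_smul_le _ _).trans (mul_le_mul_of_nonneg_right ?_ (norm_nonneg _))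
  refine (ContinuousLinearMap.le_opNorm _ _).trans ?_
  refine (mul_le_mul_of_nonneg_right (ContinuousMap.toLp_norm_le _) (norm_nonneg _)).trans ?_
  simp [measureUnivNNReal]

theorem IsPrimitive.congr_ae {f g h : UnitAddCircle → ℝ} (hf : IsPrimitive f g)
    (hgh : h =ᵐ[volume] g) : IsPrimitive f h := by
  intro a b hab hb
  rw [hf a b hab hb]
  refine intervalIntegral.integral_congr_ae ?_
  filter_upwards [ae_uIoc_of_ae hgh hab hb] with x hx hm
  exact (hx hm).symm

/-- `x ↦ sin (f x)` for `f` in `H¹`. -/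
def H1.sin (f : H1) : H1 :=
  ⟨(⟨fun x => Real.sin (f.1.1 x), by fun_prop⟩,
    mulC ⟨fun x => Real.cos (f.1.1 x), by fun_prop⟩ f.1.2),
    (IsPrimitive.comp f.2 (integrable_L2S _) Real.hasDerivAt_sin
      Real.lipschitzWith_sin).congr_ae (coeFn_mulC _ _)⟩

theorem IsPrimitive.sub_const {f g : UnitAddCircle → ℝ} (hf : IsPrimitive f g) (c : ℝ) :
    IsPrimitive (fun x => f x - c) g := fun a b hab hb => by
  rw [← hf a b hab hb]; ring

/-- `x ↦ cos (f x) - 1` for `f` in `H¹`. -/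
def H1.cosSubOne (f : H1) : H1 :=
  ⟨(⟨fun x => Real.cos (f.1.1 x) - 1, by fun_prop⟩,
    mulC ⟨fun x => -Real.sin (f.1.1 x), by fun_prop⟩ f.1.2),
    ((IsPrimitive.comp f.2 (integrable_L2S _) Real.hasDerivAt_cos
      Real.lipschitzWith_cos).sub_const 1).congr_ae (coeFn_mulC _ _)⟩

theorem H1.sin_apply (f : H1) (x : UnitAddCircle) : (H1.sin f).1.1 x = Real.sin (f.1.1 x) := rfl

theorem H1.cosSubOne_apply (f : H1) (x : UnitAddCircle) :
    (H1.cosSubOne f).1.1 x = Real.cos (f.1.1 x) - 1 := rfl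

theorem abs_one_sub_cos_le (a : ℝ) : |Real.cos a - 1| ≤ |a| := by
  have := abs_cos_sub_cos_le a 0
  simpa using this

/-- The mean value inequality for `sin x - x`, whose derivative is at most `|x|` in absolute value.
-/
theorem abs_sin_sub_sin_sub_le (a b : ℝ) :
    |Real.sin a - Real.sin b - (a - b)| ≤ (|a| + |b|) * |a - b| := by
  have h := Convex.norm_image_sub_le_of_norm_hasDerivWithin_le
    (f := fun x => Real.sin x - x) (f' := fun x => Real.cos x - 1) (C := |a| + |b|)
    (s := uIcc b a) (x := b) (y := a)
    (fun x _ => ((Real.hasDerivAt_sin x).sub (hasDerivAt_id x)).hasDerivWithinAt)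
    (fun x hx => by
      refine (abs_one_sub_cos_le x).trans ?_
      rcases mem_uIcc.mp hx with h | h
      · exact (abs_le_max_abs_abs h.1 h.2).trans (max_le (by linarith [abs_nonneg a])
          (by linarith [abs_nonneg b]))
      · exact (abs_le_max_abs_abs h.1 h.2).trans (max_le (by linarith [abs_nonneg b])
          (by linarith [abs_nonneg a]))) (convex_uIcc b a) left_mem_uIcc right_mem_uIcc
  rw [Real.norm_eq_abs, Real.norm_eq_abs] at h
  have e : Real.sin a - Real.sin b - (a - b) = Real.sin a - a - (Real.sin b - b) := by ring
  rw [e]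
  exact h

theorem abs_cos_sub_cos_le_mul (a b : ℝ) :
    |Real.cos a - Real.cos b| ≤ (|a| + |b|) * |a - b| := by
  have h := Convex.norm_image_sub_le_of_norm_hasDerivWithin_le
    (f := Real.cos) (f' := fun x => -Real.sin x) (C := |a| + |b|)
    (s := uIcc b a) (x := b) (y := a)
    (fun x _ => (Real.hasDerivAt_cos x).hasDerivWithinAt)
    (fun x hx => by
      rw [norm_neg, Real.norm_eq_abs]
      refine (abs_sin_le_abs).trans ?_
      rcases mem_uIcc.mp hx with h | h
      · exact (abs_le_max_abs_abs h.1 h.2).trans (max_le (by linarith [abs_nonneg a])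
          (by linarith [abs_nonneg b]))
      · exact (abs_le_max_abs_abs h.1 h.2).trans (max_le (by linarith [abs_nonneg b])
          (by linarith [abs_nonneg a]))) (convex_uIcc b a) left_mem_uIcc right_mem_uIcc
  exact h

/-- The bound for the derivative components in the estimates of the superposition operators. -/
theorem norm_le_of_ae_eq_mul_add_mul {d g g' : L2S} {φ ψ : C(UnitAddCircle, ℝ)}
    (h : d =ᵐ[volume] fun x => φ x * (g x - g' x) + ψ x * g' x) :
    ‖d‖ ≤ ‖φ‖ * ‖g - g'‖ + ‖ψ‖ * ‖g'‖ := by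
  have e : d = mulC φ (g - g') + mulC ψ g' := by
    refine Lp.ext ?_
    filter_upwards [h, Lp.coeFn_add (mulC φ (g - g')) (mulC ψ g'), coeFn_mulC φ (g - g'),
      coeFn_mulC ψ g', Lp.coeFn_sub g g'] with x h1 h2 h3 h4 h5
    rw [h1, h2, Pi.add_apply, h3, h4, h5, Pi.sub_apply]
  rw [e]
  exact (norm_add_le _ _).trans (add_le_add (norm_mulC_le _ _) (norm_mulC_le _ _))

theorem H1.abs_apply_le (f : H1) (x : UnitAddCircle) : |f.1.1 x| ≤ ‖f‖ :=
  (f.1.1.norm_coe_le_norm x).trans f.norm_fst_le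

theorem H1.norm_le_of {f : H1} {C : ℝ} (hC : 0 ≤ C) (h1 : ∀ x, |f.1.1 x| ≤ C) (h2 : ‖f.1.2‖ ≤ C) :
    ‖f‖ ≤ C :=
  max_le ((ContinuousMap.norm_le _ hC).mpr h1) h2

theorem H1.sub_fst_apply (f g : H1) (x : UnitAddCircle) :
    (f - g).1.1 x = f.1.1 x - g.1.1 x := rfl

theorem H1.sub_snd (f g : H1) : (f - g).1.2 = f.1.2 - g.1.2 := rfl

theorem H1.sin_snd (f : H1) :
    (H1.sin f).1.2 = mulC ⟨fun x => Real.cos (f.1.1 x), by fun_prop⟩ f.1.2 := rfl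

theorem H1.cosSubOne_snd (f : H1) :
    (H1.cosSubOne f).1.2 = mulC ⟨fun x => -Real.sin (f.1.1 x), by fun_prop⟩ f.1.2 := rfl

/-- This is strict differentiability of the superposition operator at `0` with derivative the
identity, in quantitative form. The derivative component splits as `(cos f - 1)(Df - Df') + (cos f -
cos f') Df'`, and each product has one small factor bounded in the supremum norm. -/
theorem H1.norm_sin_sub_le (f f' : H1) :
    ‖H1.sin f - H1.sin f' - (f - f')‖ ≤ (‖f‖ + ‖f'‖) * ‖f - f'‖ := by
  have hd : ∀ x, |f.1.1 x - f'.1.1 x| ≤ ‖f - f'‖ := fun x => by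
    rw [← H1.sub_fst_apply]
    exact H1.abs_apply_le (f - f') x
  refine H1.norm_le_of (by positivity) (fun x => ?_) ?_
  · rw [H1.sub_fst_apply, H1.sub_fst_apply, H1.sub_fst_apply, H1.sin_apply, H1.sin_apply]
    refine (abs_sin_sub_sin_sub_le (f.1.1 x) (f'.1.1 x)).trans ?_
    gcongr
    · exact f.abs_apply_le x
    · exact f'.abs_apply_le x
    · exact hd x
  · have e : (H1.sin f - H1.sin f' - (f - f')).1.2 =ᵐ[volume] fun x =>
        (⟨fun x => Real.cos (f.1.1 x) - 1, by fun_prop⟩ : C(UnitAddCircle, ℝ)) x *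
          (f.1.2 x - f'.1.2 x) +
        (⟨fun x => Real.cos (f.1.1 x) - Real.cos (f'.1.1 x), by fun_prop⟩ :
          C(UnitAddCircle, ℝ)) x * f'.1.2 x := by
      rw [H1.sub_snd, H1.sub_snd, H1.sub_snd]
      filter_upwards [Lp.coeFn_sub ((H1.sin f).1.2 - (H1.sin f').1.2) (f.1.2 - f'.1.2),
        Lp.coeFn_sub (H1.sin f).1.2 (H1.sin f').1.2, Lp.coeFn_sub f.1.2 f'.1.2,
        coeFn_mulC ⟨fun x => Real.cos (f.1.1 x), by fun_prop⟩ f.1.2,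
        coeFn_mulC ⟨fun x => Real.cos (f'.1.1 x), by fun_prop⟩ f'.1.2] with x h1 h2 h3 h4 h5
      rw [h1, Pi.sub_apply, h2, h3, Pi.sub_apply, Pi.sub_apply]
      rw [H1.sin_snd, H1.sin_snd, h4, h5]
      simp only [ContinuousMap.coe_mk]
      ring
    refine (norm_le_of_ae_eq_mul_add_mul e).trans ?_
    rw [add_mul, mul_comm ‖f'‖]
    refine add_le_add ?_ ?_
    · refine mul_le_mul ?_ (H1.sub_snd f f' ▸ (f - f').norm_snd_le) (norm_nonneg _) (norm_nonneg _)
      exact (ContinuousMap.norm_le _ (norm_nonneg _)).mpr fun x =>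
        (abs_one_sub_cos_le _).trans (f.abs_apply_le x)
    · refine mul_le_mul ?_ f'.norm_snd_le (norm_nonneg _) (norm_nonneg _)
      exact (ContinuousMap.norm_le _ (norm_nonneg _)).mpr fun x =>
        (abs_cos_sub_cos_le _ _).trans (hd x)

/-- The companion of `H1.norm_sin_sub_le`; here the derivative at `0` vanishes, so nothing is
subtracted. -/
theorem H1.norm_cosSubOne_sub_le (f f' : H1) :
    ‖H1.cosSubOne f - H1.cosSubOne f'‖ ≤ (‖f‖ + ‖f'‖) * ‖f - f'‖ := by
  have hd : ∀ x, |f.1.1 x - f'.1.1 x| ≤ ‖f - f'‖ := fun x => by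
    rw [← H1.sub_fst_apply]
    exact H1.abs_apply_le (f - f') x
  refine H1.norm_le_of (by positivity) (fun x => ?_) ?_
  · have e : (H1.cosSubOne f - H1.cosSubOne f').1.1 x =
        Real.cos (f.1.1 x) - Real.cos (f'.1.1 x) := by
      rw [H1.sub_fst_apply, H1.cosSubOne_apply, H1.cosSubOne_apply]
      ring
    rw [e]
    refine (abs_cos_sub_cos_le_mul (f.1.1 x) (f'.1.1 x)).trans ?_
    gcongr
    · exact f.abs_apply_le x
    · exact f'.abs_apply_le x
    · exact hd x
  · have e : (H1.cosSubOne f - H1.cosSubOne f').1.2 =ᵐ[volume] fun x =>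
        (⟨fun x => -Real.sin (f.1.1 x), by fun_prop⟩ : C(UnitAddCircle, ℝ)) x *
          (f.1.2 x - f'.1.2 x) +
        (⟨fun x => -(Real.sin (f.1.1 x) - Real.sin (f'.1.1 x)), by fun_prop⟩ :
          C(UnitAddCircle, ℝ)) x * f'.1.2 x := by
      rw [H1.sub_snd]
      filter_upwards [Lp.coeFn_sub (H1.cosSubOne f).1.2 (H1.cosSubOne f').1.2,
        coeFn_mulC ⟨fun x => -Real.sin (f.1.1 x), by fun_prop⟩ f.1.2,
        coeFn_mulC ⟨fun x => -Real.sin (f'.1.1 x), by fun_prop⟩ f'.1.2] with x h2 h4 h5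
      rw [h2, Pi.sub_apply]
      rw [H1.cosSubOne_snd, H1.cosSubOne_snd, h4, h5]
      simp only [ContinuousMap.coe_mk]
      ring
    refine (norm_le_of_ae_eq_mul_add_mul e).trans ?_
    rw [add_mul, mul_comm ‖f'‖]
    refine add_le_add ?_ ?_
    · refine mul_le_mul ?_ (H1.sub_snd f f' ▸ (f - f').norm_snd_le) (norm_nonneg _) (norm_nonneg _)
      refine (ContinuousMap.norm_le _ (norm_nonneg _)).mpr fun x => ?_
      rw [ContinuousMap.coe_mk, norm_neg]
      exact abs_sin_le_abs.trans (f.abs_apply_le x)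
    · refine mul_le_mul ?_ f'.norm_snd_le (norm_nonneg _) (norm_nonneg _)
      refine (ContinuousMap.norm_le _ (norm_nonneg _)).mpr fun x => ?_
      rw [ContinuousMap.coe_mk, norm_neg]
      exact (abs_sin_sub_sin_le _ _).trans (hd x)

theorem H1.zero_fst : (0 : H1).1.1 = 0 := rfl

theorem H1.zero_snd : (0 : H1).1.2 = 0 := rfl

theorem H1.sin_zero : H1.sin 0 = 0 := by
  refine norm_le_zero_iff.mp (H1.norm_le_of le_rfl (fun x => ?_) ?_)
  · rw [H1.sin_apply, H1.zero_fst, ContinuousMap.zero_apply, Real.sin_zero, abs_zero]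
  · refine (norm_mulC_le _ _).trans ?_
    rw [H1.zero_snd, norm_zero, mul_zero]

theorem H1.cosSubOne_zero : H1.cosSubOne 0 = 0 := by
  refine norm_le_zero_iff.mp (H1.norm_le_of le_rfl (fun x => ?_) ?_)
  · rw [H1.cosSubOne_apply, H1.zero_fst, ContinuousMap.zero_apply, Real.cos_zero, sub_self,
      abs_zero]
  · refine (norm_mulC_le _ _).trans ?_
    rw [H1.zero_snd, norm_zero, mul_zero]

theorem continuous_of_norm_sub_le {E F : Type*} [SeminormedAddCommGroup E]
    [SeminormedAddCommGroup F] {φ : E → F} {C : ℝ}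
    (h : ∀ f f', ‖φ f - φ f'‖ ≤ (C + ‖f‖ + ‖f'‖) * ‖f - f'‖) : Continuous φ := by
  refine continuous_iff_continuousAt.mpr fun f' => ?_
  rw [ContinuousAt, tendsto_iff_norm_sub_tendsto_zero]
  refine squeeze_zero (fun _ => norm_nonneg _) (fun f => h f f') ?_
  have hc : Continuous fun f => (C + ‖f‖ + ‖f'‖) * ‖f - f'‖ := by fun_prop
  simpa using hc.tendsto f'

theorem H1.continuous_sin : Continuous H1.sin := by
  refine continuous_of_norm_sub_le (C := 1) fun f f' => ?_
  have h := H1.norm_sin_sub_le f f'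
  have h2 := norm_le_norm_sub_add (H1.sin f - H1.sin f') (f - f')
  linarith

theorem H1.continuous_cosSubOne : Continuous H1.cosSubOne :=
  continuous_of_norm_sub_le (C := 0) fun f f' => by
    simpa using H1.norm_cosSubOne_sub_le f f'

/-! ### Translations -/

theorem measurePreserving_translate (z : UnitAddCircle) :
    MeasurePreserving (fun x : UnitAddCircle => x + z) volume volume :=
  measurePreserving_add_right volume z

/-- The translation `x ↦ x + z` as a continuous map. -/
def shift (z : UnitAddCircle) : C(UnitAddCircle, UnitAddCircle) := ⟨fun x => x + z, by fun_prop⟩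

theorem IsPrimitive.translate {f g : UnitAddCircle → ℝ} (h : IsPrimitive f g) (z : UnitAddCircle) :
    IsPrimitive (fun x => f (x + z)) (fun x => g (x + z)) := by
  induction z using QuotientAddGroup.induction_on with | H c => ?_
  intro a b hab hb
  have := h (a + c) (b + c) (by linarith) (by linarith)
  rw [← intervalIntegral.integral_comp_add_right] at this
  simpa using this

/-- Translation of functions in `L²`. -/
def translateL2 (z : UnitAddCircle) : L2S →ₗᵢ[ℝ] L2S :=
  Lp.compMeasurePreservingₗᵢ ℝ (shift z) (measurePreserving_translate z)

theorem coeFn_translateL2 (z : UnitAddCircle) (g : L2S) :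
    translateL2 z g =ᵐ[volume] fun x => g (x + z) :=
  Lp.coeFn_compMeasurePreserving g (measurePreserving_translate z)

/-- Translation of pairs of a continuous and a square integrable function. -/
def translatePair (z : UnitAddCircle) :
    C(UnitAddCircle, ℝ) × L2S →ₗ[ℝ] C(UnitAddCircle, ℝ) × L2S where
  toFun v := (v.1.comp (shift z), translateL2 z v.2)
  map_add' v w := Prod.ext rfl ((translateL2 z).map_add v.2 w.2)
  map_smul' c v := Prod.ext rfl ((translateL2 z).map_smul c v.2)

theorem translatePair_mem {z : UnitAddCircle} {v : C(UnitAddCircle, ℝ) × L2S} (hv : v ∈ H1Sub) :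
    translatePair z v ∈ H1Sub :=
  (IsPrimitive.translate hv z).congr_ae (coeFn_translateL2 z v.2)

theorem norm_translatePair_le (z : UnitAddCircle) (v : C(UnitAddCircle, ℝ) × L2S) :
    ‖translatePair z v‖ ≤ ‖v‖ := by
  refine max_le ?_ ?_
  · refine (ContinuousMap.norm_le _ (norm_nonneg _)).mpr fun x => ?_
    exact (v.1.norm_coe_le_norm (x + z)).trans (norm_fst_le v)
  · exact ((translateL2 z).norm_map v.2).trans_le (norm_snd_le v)

/-- Translation of functions in `H¹`. -/
def H1.translate (z : UnitAddCircle) : H1 →L[ℝ] H1 :=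
  LinearMap.mkContinuous
    ((translatePair z).restrict (p := H1Sub) (q := H1Sub) fun _ => translatePair_mem :
      H1Sub →ₗ[ℝ] H1Sub) 1
    (fun f => by
      rw [one_mul]
      exact norm_translatePair_le z f.1)

theorem H1.norm_translate_le (z : UnitAddCircle) (f : H1) : ‖H1.translate z f‖ ≤ ‖f‖ := by
  have h : ‖H1.translate z‖ ≤ 1 := LinearMap.mkContinuous_norm_le _ zero_le_one _
  simpa using (H1.translate z).le_of_opNorm_le h f

theorem continuous_shift : Continuous shift :=
  (ContinuousMap.curry ⟨fun p : UnitAddCircle × UnitAddCircle => p.2 + p.1, by fun_prop⟩).continuous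

/-- Strong continuity of translations. For fixed `v` it makes the integrands of the averages
continuous in the parameter, hence Bochner integrable. -/
theorem H1.continuous_translate (f : H1) : Continuous fun z => H1.translate z f := by
  refine Continuous.subtype_mk (Continuous.prodMk ?_ ?_) _
  · exact (ContinuousMap.continuous_postcomp f.1.1).comp continuous_shift
  · exact continuous_const.compMeasurePreservingLp continuous_shift
      measurePreserving_translate (by norm_num)

/-! ### The coupling function -/

theorem W_eq_indicator (r : ℝ) : W r = (Metric.closedBall (0 : UnitAddCircle) r).indicator 1 := by
  ext x
  by_cases h : ‖x‖ ≤ r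
  · rw [W, if_pos h, indicator_of_mem (mem_closedBall_zero_iff.mpr h), Pi.one_apply]
  · rw [W, if_neg h, indicator_of_notMem (mt mem_closedBall_zero_iff.mp h)]

theorem measurable_W (r : ℝ) : Measurable (W r) := by
  rw [W_eq_indicator]
  exact measurable_one.indicator Metric.isClosed_closedBall.measurableSet

theorem abs_W_le (r : ℝ) (x : UnitAddCircle) : |W r x| ≤ 1 := by
  rw [W]; split_ifs <;> simp

theorem W_mono {r r' : ℝ} (h : r ≤ r') (x : UnitAddCircle) : W r x ≤ W r' x := by
  rw [W, W]
  split_ifs with h1 h2 h2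
  · exact le_rfl
  · exact absurd (h1.trans h) h2
  · exact zero_le_one
  · exact le_rfl

theorem W_neg (r : ℝ) (x : UnitAddCircle) : W r (-x) = W r x := by
  rw [W, W, norm_neg]

theorem integrable_W (r : ℝ) : Integrable (W r) :=
  Integrable.of_bound (measurable_W r).aestronglyMeasurable 1 (ae_of_all _ (abs_W_le r))

theorem integral_W (r : ℝ) : ∫ x, W r x = max (min 1 (2 * r)) 0 := by
  rw [W_eq_indicator, integral_indicator_one Metric.isClosed_closedBall.measurableSet,
    Measure.real, AddCircle.volume_closedBall, ENNReal.toReal_ofReal']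

/-- `W r` increases with `r`, so its `L¹` distance to `W r'` is a difference of integrals. This
Lipschitz bound is the only regularity in `r` that the implicit function theorem requires. -/
theorem integral_abs_W_sub_le (r r' : ℝ) : ∫ x, |W r x - W r' x| ≤ 2 * |r - r'| := by
  wlog h : r' ≤ r generalizing r r'
  · have := this r' r (not_le.mp h).le
    simpa only [abs_sub_comm] using this
  have e : ∀ x, |W r x - W r' x| = W r x - W r' x := fun x =>
    abs_of_nonneg (sub_nonneg.mpr (W_mono h x))
  simp only [e]
  rw [integral_sub (integrable_W r) (integrable_W r'), integral_W, integral_W,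
    abs_of_nonneg (sub_nonneg.mpr h)]
  rcases max_cases (min 1 (2 * r)) 0 with h1 | h1 <;> rcases max_cases (min 1 (2 * r')) 0 with h2 | h2 <;>
  rcases min_cases 1 (2 * r) with h3 | h3 <;> rcases min_cases 1 (2 * r') with h4 | h4 <;>
  linarith

theorem sin_twisted (q : ℕ) (x : UnitAddCircle) : (twisted q x).sin = sinMode q x := by
  induction x using QuotientAddGroup.induction_on with | H t => ?_
  exact Real.Angle.sin_coe _

theorem cos_twisted (q : ℕ) (x : UnitAddCircle) : (twisted q x).cos = cosMode q x := by
  induction x using QuotientAddGroup.induction_on with | H t => ?_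
  exact Real.Angle.cos_coe _

theorem sin_twisted_add (q : ℕ) (x : UnitAddCircle) (a : ℝ) : (twisted q x + (a : ℝ)).sin =
    sinMode q x * Real.cos a + cosMode q x * Real.sin a := by
  rw [Real.Angle.sin_add, Real.Angle.sin_coe, Real.Angle.cos_coe, sin_twisted, cos_twisted]

theorem abs_sinMode_le (q : ℕ) (x : UnitAddCircle) : |sinMode q x| ≤ 1 := by
  induction x using QuotientAddGroup.induction_on with | H t => ?_
  exact Real.abs_sin_le_one _

theorem abs_cosMode_le (q : ℕ) (x : UnitAddCircle) : |cosMode q x| ≤ 1 := by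
  induction x using QuotientAddGroup.induction_on with | H t => ?_
  exact Real.abs_cos_le_one _

/-! ### Averages of superposition operators -/

/-- A family of phase differences `M θ v` with `θ` in a probability space, together with the
argument `proj θ` of the coupling function. -/
structure PhaseFamily (Ω : Type) [TopologicalSpace Ω] [MeasurableSpace Ω] where
  μ : Measure Ω
  prob : IsProbabilityMeasure μ
  proj : Ω → UnitAddCircle
  continuous_proj : Continuous proj
  proj_preserving : MeasurePreserving proj μ volume
  M : Ω → H10 →L[ℝ] H1
  continuous_M : ∀ v, Continuous fun θ => M θ v
  norm_M_le : ∀ θ v, ‖M θ v‖ ≤ 4 * ‖v‖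

namespace PhaseFamily

variable {Ω : Type} [TopologicalSpace Ω] [MeasurableSpace Ω] (P : PhaseFamily Ω)

instance : IsProbabilityMeasure P.μ := P.prob

/-- The superposition of the phase differences with `y ↦ sin (2πq proj θ + y) - sin (2πq proj θ)`. -/
def superpose (q : ℕ) (θ : Ω) (v : H10) : H1 :=
  sinMode q (P.proj θ) • H1.cosSubOne (P.M θ v) + cosMode q (P.proj θ) • H1.sin (P.M θ v)

theorem continuous_superpose (q : ℕ) (v : H10) : Continuous fun θ => P.superpose q θ v :=
  (((sinMode q).continuous.comp P.continuous_proj).smul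
    (H1.continuous_cosSubOne.comp (P.continuous_M v))).add
  (((cosMode q).continuous.comp P.continuous_proj).smul
    (H1.continuous_sin.comp (P.continuous_M v)))

theorem superpose_zero (q : ℕ) (θ : Ω) : P.superpose q θ 0 = 0 := by
  simp [superpose, H1.sin_zero, H1.cosSubOne_zero]

/-- By the addition formula only `sin` contributes to the linear part, with coefficient `cosMode q
(proj θ)`. The bound `4` on `M θ` enters twice, and the sine and cosine terms double the result to
`32`. -/
theorem norm_superpose_sub_le (q : ℕ) (θ : Ω) (v v' : H10) :
    ‖P.superpose q θ v - P.superpose q θ v' - cosMode q (P.proj θ) • P.M θ (v - v')‖ ≤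
      32 * (‖v‖ + ‖v'‖) * ‖v - v'‖ := by
  have e : P.superpose q θ v - P.superpose q θ v' - cosMode q (P.proj θ) • P.M θ (v - v') =
      sinMode q (P.proj θ) • (H1.cosSubOne (P.M θ v) - H1.cosSubOne (P.M θ v')) +
      cosMode q (P.proj θ) •
        (H1.sin (P.M θ v) - H1.sin (P.M θ v') - (P.M θ v - P.M θ v')) := by
    rw [superpose, superpose, map_sub]
    module
  have hb : (‖P.M θ v‖ + ‖P.M θ v'‖) * ‖P.M θ v - P.M θ v'‖ ≤
      16 * (‖v‖ + ‖v'‖) * ‖v - v'‖ := by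
    have h1 := P.norm_M_le θ v
    have h2 := P.norm_M_le θ v'
    have h3 := P.norm_M_le θ (v - v')
    rw [map_sub] at h3
    calc _ ≤ (4 * ‖v‖ + 4 * ‖v'‖) * (4 * ‖v - v'‖) := by gcongr
      _ = _ := by ring
  rw [e]
  refine (norm_add_le _ _).trans ?_
  rw [norm_smul, norm_smul]
  have h1 := (H1.norm_cosSubOne_sub_le (P.M θ v) (P.M θ v')).trans hb
  have h2 := (H1.norm_sin_sub_le (P.M θ v) (P.M θ v')).trans hb
  have h3 : ‖sinMode q (P.proj θ)‖ ≤ 1 := abs_sinMode_le _ _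
  have h4 : ‖cosMode q (P.proj θ)‖ ≤ 1 := abs_cosMode_le _ _
  have h5 := mul_le_of_le_one_left (norm_nonneg
    (H1.cosSubOne (P.M θ v) - H1.cosSubOne (P.M θ v'))) h3
  have h6 := mul_le_of_le_one_left (norm_nonneg
    (H1.sin (P.M θ v) - H1.sin (P.M θ v') - (P.M θ v - P.M θ v'))) h4
  linarith

theorem norm_cosMode_smul_M_le (q : ℕ) (θ : Ω) (v : H10) :
    ‖cosMode q (P.proj θ) • P.M θ v‖ ≤ 4 * ‖v‖ := by
  rw [norm_smul]
  exact (mul_le_of_le_one_left (norm_nonneg _) (abs_cosMode_le _ _)).trans (P.norm_M_le θ v)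

theorem norm_superpose_le (q : ℕ) (θ : Ω) (v : H10) :
    ‖P.superpose q θ v‖ ≤ 32 * ‖v‖ * ‖v‖ + 4 * ‖v‖ := by
  have h := P.norm_superpose_sub_le q θ v 0
  rw [P.superpose_zero, sub_zero, sub_zero, norm_zero, add_zero] at h
  have h2 := P.norm_cosMode_smul_M_le q θ v
  have h3 := norm_le_norm_sub_add (P.superpose q θ v) (cosMode q (P.proj θ) • P.M θ v)
  linarith

/-- The average of the superposition operators against the coupling function. -/
def average (q : ℕ) (r : ℝ) (v : H10) : H1 :=
  ∫ θ, W r (P.proj θ) • P.superpose q θ v ∂P.μ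

theorem continuous_M_apply (v : H10) (x : UnitAddCircle) : Continuous fun θ => (P.M θ v).1.1 x :=
  (H1.eval x).continuous.comp (P.continuous_M v)

/-- `proj` pushes `μ` forward to the measure of the circle, which reduces the estimate to
`integral_abs_W_sub_le`. -/
theorem integral_proj_abs_W_sub_le (r r' : ℝ) :
    ∫ θ, |W r (P.proj θ) - W r' (P.proj θ)| ∂P.μ ≤ 2 * |r - r'| := by
  have h := integral_map (μ := P.μ) P.proj_preserving.measurable.aemeasurable
    (f := fun x => |W r x - W r' x|)
    (((measurable_W r).sub (measurable_W r')).abs.aestronglyMeasurable)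
  rw [P.proj_preserving.map_eq] at h
  rw [← h]
  exact integral_abs_W_sub_le r r'

theorem integrable_proj_abs_W_sub (r r' : ℝ) :
    Integrable (fun θ => |W r (P.proj θ) - W r' (P.proj θ)|) P.μ :=
  (P.proj_preserving.integrable_comp_of_integrable
    ((integrable_W r).sub (integrable_W r'))).abs

theorem average_zero (q : ℕ) (r : ℝ) : P.average q r 0 = 0 := by
  simp [average, superpose_zero]

variable [CompactSpace Ω] [BorelSpace Ω]

theorem integrable_smul_real {φ : UnitAddCircle → ℝ} (hφ : Measurable φ) {C : ℝ}
    (hC : ∀ x, |φ x| ≤ C) {f : Ω → ℝ} (hf : Continuous f) :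
    Integrable (fun θ => φ (P.proj θ) * f θ) P.μ := by
  obtain ⟨B, hB⟩ := isCompact_univ.exists_bound_of_continuousOn hf.continuousOn
  refine Integrable.of_bound ((hφ.comp P.continuous_proj.measurable).aestronglyMeasurable.mul
    hf.aestronglyMeasurable) (C * B) (ae_of_all _ fun θ => ?_)
  rw [norm_mul]
  exact mul_le_mul (hC _) (hB θ (mem_univ _)) (norm_nonneg _) ((abs_nonneg _).trans (hC 0))

theorem integrable_coupling (q : ℕ) (r : ℝ) (v : H10) (x : UnitAddCircle) :
    Integrable (fun θ => W r (P.proj θ) *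
      (twisted q (P.proj θ) + ((P.M θ v).1.1 x : ℝ)).sin) P.μ := by
  have c1 := (sinMode q).continuous.comp P.continuous_proj
  have c2 := (cosMode q).continuous.comp P.continuous_proj
  have c3 := P.continuous_M_apply v x
  simp only [sin_twisted_add]
  exact P.integrable_smul_real (measurable_W r) (abs_W_le r)
    ((c1.mul (Real.continuous_cos.comp c3)).add (c2.mul (Real.continuous_sin.comp c3)))

variable [SecondCountableTopology Ω]

theorem integrable_smul {φ : UnitAddCircle → ℝ} (hφ : Measurable φ) {C : ℝ}
    (hC : ∀ x, |φ x| ≤ C) {f : Ω → H1} (hf : Continuous f) :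
    Integrable (fun θ => φ (P.proj θ) • f θ) P.μ := by
  obtain ⟨B, hB⟩ := isCompact_univ.exists_bound_of_continuousOn hf.continuousOn
  refine Integrable.of_bound ((hφ.comp P.continuous_proj.measurable).aestronglyMeasurable.smul
    hf.aestronglyMeasurable) (C * B) (ae_of_all _ fun θ => ?_)
  rw [norm_smul]
  exact mul_le_mul (hC _) (hB θ (mem_univ _)) (norm_nonneg _) ((abs_nonneg _).trans (hC 0))

/-- The linearization of `average` at `0`. -/
def linear (q : ℕ) (r : ℝ) : H10 →L[ℝ] H1 :=
  LinearMap.mkContinuous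
    { toFun := fun v => ∫ θ, W r (P.proj θ) • cosMode q (P.proj θ) • P.M θ v ∂P.μ
      map_add' := fun v w => by
        have hi : ∀ v, Integrable (fun θ => W r (P.proj θ) • cosMode q (P.proj θ) • P.M θ v) P.μ :=
          fun v => P.integrable_smul (measurable_W r) (abs_W_le r)
            (((cosMode q).continuous.comp P.continuous_proj).smul (P.continuous_M v))
        rw [← integral_add (hi v) (hi w)]
        simp only [map_add, smul_add]
      map_smul' := fun c v => by
        rw [RingHom.id_apply, ← integral_smul]
        refine integral_congr_ae (ae_of_all _ fun θ => ?_)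
        simp only [map_smul]
        module } 4
    (fun v => by
      refine (norm_integral_le_of_norm_le_const (C := 4 * ‖v‖) (ae_of_all _ fun θ => ?_)).trans_eq
        (by simp)
      rw [norm_smul]
      exact (mul_le_of_le_one_left (norm_nonneg _) (abs_W_le r _)).trans
        (P.norm_cosMode_smul_M_le q θ v))

theorem linear_apply (q : ℕ) (r : ℝ) (v : H10) : P.linear q r v =
    ∫ θ, W r (P.proj θ) • cosMode q (P.proj θ) • P.M θ v ∂P.μ := rfl

/-- The difference is split into the quadratic remainder at fixed `r`, the change from `r` to `r'`
acting on `superpose q θ v'`, and the change from `r` to `r₀` in the linear part. -/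
theorem norm_average_sub_le (q : ℕ) (r₀ r r' : ℝ) (v v' : H10) :
    ‖P.average q r v - P.average q r' v' - P.linear q r₀ (v - v')‖ ≤
      32 * (‖v‖ + ‖v'‖) * ‖v - v'‖ + 2 * |r - r'| * (32 * ‖v'‖ * ‖v'‖ + 4 * ‖v'‖) +
        2 * |r - r₀| * (4 * ‖v - v'‖) := by
  have hi : ∀ r v, Integrable (fun θ => W r (P.proj θ) • P.superpose q θ v) P.μ := fun r v =>
    P.integrable_smul (measurable_W r) (abs_W_le r) (P.continuous_superpose q v)
  have hl : Integrable (fun θ => W r₀ (P.proj θ) • cosMode q (P.proj θ) • P.M θ (v - v')) P.μ :=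
    P.integrable_smul (measurable_W r₀) (abs_W_le r₀)
      (((cosMode q).continuous.comp P.continuous_proj).smul (P.continuous_M _))
  have hd : Integrable (fun θ => W r (P.proj θ) • P.superpose q θ v -
      W r' (P.proj θ) • P.superpose q θ v') P.μ := (hi r v).sub (hi r' v')
  rw [average, average, linear_apply, ← integral_sub (hi r v) (hi r' v'),
    ← integral_sub hd hl]
  have hg1 := (P.integrable_proj_abs_W_sub r r').mul_const (32 * ‖v'‖ * ‖v'‖ + 4 * ‖v'‖)
  have hg2 := (P.integrable_proj_abs_W_sub r r₀).mul_const (4 * ‖v - v'‖)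
  refine (norm_integral_le_of_norm_le
    (g := fun θ => 32 * (‖v‖ + ‖v'‖) * ‖v - v'‖ +
      |W r (P.proj θ) - W r' (P.proj θ)| * (32 * ‖v'‖ * ‖v'‖ + 4 * ‖v'‖) +
      |W r (P.proj θ) - W r₀ (P.proj θ)| * (4 * ‖v - v'‖))
    (((integrable_const _).add hg1).add hg2) (ae_of_all _ fun θ => ?_)).trans ?_
  · have e : W r (P.proj θ) • P.superpose q θ v - W r' (P.proj θ) • P.superpose q θ v' -
        W r₀ (P.proj θ) • cosMode q (P.proj θ) • P.M θ (v - v') =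
        W r (P.proj θ) • (P.superpose q θ v - P.superpose q θ v' -
          cosMode q (P.proj θ) • P.M θ (v - v')) +
        (W r (P.proj θ) - W r' (P.proj θ)) • P.superpose q θ v' +
        (W r (P.proj θ) - W r₀ (P.proj θ)) • cosMode q (P.proj θ) • P.M θ (v - v') := by
      module
    rw [e]
    refine (norm_add₃_le).trans ?_
    rw [norm_smul, norm_smul, norm_smul (W r (P.proj θ) - W r₀ (P.proj θ)), Real.norm_eq_abs,
      Real.norm_eq_abs, Real.norm_eq_abs]
    exact add_le_add (add_le_add
      ((mul_le_of_le_one_left (norm_nonneg _) (abs_W_le r _)).trans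
        (P.norm_superpose_sub_le q θ v v'))
      (mul_le_mul_of_nonneg_left (P.norm_superpose_le q θ v') (abs_nonneg _)))
      (mul_le_mul_of_nonneg_left (P.norm_cosMode_smul_M_le q θ _) (abs_nonneg _))
  · have hg : Integrable (fun θ => 32 * (‖v‖ + ‖v'‖) * ‖v - v'‖ +
        |W r (P.proj θ) - W r' (P.proj θ)| * (32 * ‖v'‖ * ‖v'‖ + 4 * ‖v'‖)) P.μ :=
      (integrable_const _).add hg1
    rw [integral_add hg hg2, integral_add (integrable_const _) hg1,
      integral_const, probReal_univ, one_smul, integral_mul_const, integral_mul_const]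
    have h1 := mul_le_mul_of_nonneg_right (P.integral_proj_abs_W_sub_le r r')
      (by positivity : 0 ≤ 32 * ‖v'‖ * ‖v'‖ + 4 * ‖v'‖)
    have h2 := mul_le_mul_of_nonneg_right (P.integral_proj_abs_W_sub_le r r₀)
      (by positivity : 0 ≤ 4 * ‖v - v'‖)
    exact add_le_add (add_le_add le_rfl h1) h2

/-- There is no component in the direction of `r`, because the average vanishes at `v = 0` for every
`r`. -/
theorem hasStrictFDerivAt_average (q : ℕ) (r₀ : ℝ) :
    HasStrictFDerivAt (fun p : H10 × ℝ => P.average q p.2 p.1)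
      (P.linear q r₀ ∘L ContinuousLinearMap.fst ℝ H10 ℝ) (0, r₀) := by
  refine HasStrictFDerivAt.of_isLittleO ?_
  refine Asymptotics.isLittleO_iff.mpr fun c hc => ?_
  -- The factor multiplying `‖p.1 - p.2‖` in the final estimate; it is continuous and vanishes at
  -- the base point.
  have hcont : Continuous fun p : (H10 × ℝ) × (H10 × ℝ) =>
      32 * (‖p.1.1‖ + ‖p.2.1‖) + 2 * (32 * ‖p.2.1‖ * ‖p.2.1‖ + 4 * ‖p.2.1‖) +
        2 * |p.1.2 - r₀| * 4 := by fun_prop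
  have h0 := hcont.tendsto (((0, r₀), (0, r₀)) : (H10 × ℝ) × (H10 × ℝ))
  simp only [norm_zero, add_zero, mul_zero, sub_self, abs_zero, zero_mul] at h0
  filter_upwards [h0.eventually_lt_const hc] with p hp
  have h := P.norm_average_sub_le q r₀ p.1.2 p.2.2 p.1.1 p.2.1
  refine h.trans (le_trans ?_ (mul_le_mul_of_nonneg_right hp.le (norm_nonneg _)))
  have h1 : ‖p.1.1 - p.2.1‖ ≤ ‖p.1 - p.2‖ := norm_fst_le (p.1 - p.2)
  have h2 : |p.1.2 - p.2.2| ≤ ‖p.1 - p.2‖ := norm_snd_le (p.1 - p.2)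
  calc _ ≤ 32 * (‖p.1.1‖ + ‖p.2.1‖) * ‖p.1 - p.2‖ +
        2 * ‖p.1 - p.2‖ * (32 * ‖p.2.1‖ * ‖p.2.1‖ + 4 * ‖p.2.1‖) +
        2 * |p.1.2 - r₀| * (4 * ‖p.1 - p.2‖) := by gcongr
    _ = _ := by ring

/-- The average of `sin` of the perturbed phase differences against the coupling function. -/
def coupling (q : ℕ) (r : ℝ) (v : H10) (x : UnitAddCircle) : ℝ :=
  ∫ θ, W r (P.proj θ) * (twisted q (P.proj θ) + ((P.M θ v).1.1 x : ℝ)).sin ∂P.μ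

/-- Evaluation at a point commutes with the Bochner integral. The subtracted integral does not
depend on `x`, so it disappears under `H1.toH10`. -/
theorem average_apply (q : ℕ) (r : ℝ) (v : H10) (x : UnitAddCircle) :
    (P.average q r v).1.1 x =
      P.coupling q r v x - ∫ θ, W r (P.proj θ) * sinMode q (P.proj θ) ∂P.μ := by
  have c1 := (sinMode q).continuous.comp P.continuous_proj
  have i1 := P.integrable_coupling q r v x
  simp only [sin_twisted_add] at i1
  have i2 : Integrable (fun θ => W r (P.proj θ) * sinMode q (P.proj θ)) P.μ :=
    P.integrable_smul_real (measurable_W r) (abs_W_le r) c1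
  simp only [coupling, sin_twisted_add]
  rw [← integral_sub i1 i2, ← H1.eval_apply, average,
    ← ContinuousLinearMap.integral_comp_comm _
      (P.integrable_smul (measurable_W r) (abs_W_le r) (P.continuous_superpose q v))]
  refine integral_congr_ae (ae_of_all _ fun θ => ?_)
  simp only [superpose, map_smul, map_add, H1.eval_apply, H1.sin_apply, H1.cosSubOne_apply,
    smul_eq_mul]
  ring

theorem linear_apply_apply (q : ℕ) (r : ℝ) (v : H10) (x : UnitAddCircle) :
    (P.linear q r v).1.1 x =
      ∫ θ, W r (P.proj θ) * (cosMode q (P.proj θ) * (P.M θ v).1.1 x) ∂P.μ := by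
  have hi : Integrable (fun θ => W r (P.proj θ) • cosMode q (P.proj θ) • P.M θ v) P.μ :=
    P.integrable_smul (measurable_W r) (abs_W_le r)
      (((cosMode q).continuous.comp P.continuous_proj).smul (P.continuous_M v))
  rw [← H1.eval_apply, linear_apply, ← ContinuousLinearMap.integral_comp_comm _ hi]
  refine integral_congr_ae (ae_of_all _ fun θ => ?_)
  simp only [map_smul, H1.eval_apply, smul_eq_mul]

end PhaseFamily

/-! ### The three families of phase differences -/

theorem norm_translate_toH1_le (z : UnitAddCircle) (v : H10) :
    ‖H1.translate z (H10.toH1 v)‖ ≤ ‖v‖ :=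
  (H1.norm_translate_le _ _).trans v.norm_toH1_le

theorem measurePreserving_add_circle :
    MeasurePreserving (fun p : UnitAddCircle × UnitAddCircle => p.1 + p.2)
      (volume.prod volume) volume :=
  measurePreserving_snd.comp (measurePreserving_prod_add volume volume)

theorem measurePreserving_neg_add_circle :
    MeasurePreserving (fun p : UnitAddCircle × UnitAddCircle => -p.1 + p.2)
      (volume.prod volume) volume :=
  measurePreserving_snd.comp (measurePreserving_prod_neg_add volume volume)

/-- The difference `-y + t` is uniformly distributed and independent of `z`, and the shear `(z, s) ↦
(z, z + s)` preserves the product measure. -/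
theorem measurePreserving_fst_triple :
    MeasurePreserving (fun p : UnitAddCircle × UnitAddCircle × UnitAddCircle =>
      (p.1, p.1 + (-p.2.1 + p.2.2))) (volume.prod (volume.prod volume)) (volume.prod volume) :=
  (measurePreserving_prod_add volume volume).comp
    ((MeasurePreserving.id volume).prod measurePreserving_neg_add_circle)

/-- For fixed `(y, t)` the last component is a translate of `z`, hence uniform whatever the value of
`f (y, t)`. This is independence in the form of a skew product. -/
theorem measurePreserving_of_snd_triple {f : UnitAddCircle × UnitAddCircle → UnitAddCircle}
    (hf : MeasurePreserving f (volume.prod volume) volume) :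
    MeasurePreserving (fun p : UnitAddCircle × UnitAddCircle × UnitAddCircle =>
      (f p.2, p.1 + (-p.2.1 + p.2.2))) (volume.prod (volume.prod volume)) (volume.prod volume) := by
  have h : MeasurePreserving (fun p : (UnitAddCircle × UnitAddCircle) × UnitAddCircle =>
      (f p.1, p.2 + (-p.1.1 + p.1.2))) ((volume.prod volume).prod volume)
      (volume.prod volume) :=
    hf.skew_product (g := fun p z => z + (-p.1 + p.2))
      (by fun_prop)
      (ae_of_all _ fun p => (measurePreserving_translate (-p.1 + p.2)).map_eq)
  exact h.comp Measure.measurePreserving_swap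

/-- The phase differences `v(x + z) - v(x)` of the pairwise coupling. -/
def singleFamily : PhaseFamily UnitAddCircle where
  μ := volume
  prob := inferInstance
  proj := id
  continuous_proj := continuous_id
  proj_preserving := MeasurePreserving.id _
  M z := H1.translate z ∘L H10.toH1 - H10.toH1
  continuous_M v := (H1.continuous_translate _).sub continuous_const
  norm_M_le z v := by
    have h1 := norm_translate_toH1_le z v
    have h2 := v.norm_toH1_le
    have h3 := norm_nonneg v
    exact (norm_sub_le _ _).trans ((add_le_add h1 h2).trans (by linarith))

/-- The phase differences `v(x + z) + v(x + y) - 2 v(x)` of the first triplet coupling. -/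
def pairFamily : PhaseFamily (UnitAddCircle × UnitAddCircle) where
  μ := volume.prod volume
  prob := inferInstance
  proj p := p.1 + p.2
  continuous_proj := by fun_prop
  proj_preserving := measurePreserving_add_circle
  M p := H1.translate p.1 ∘L H10.toH1 + H1.translate p.2 ∘L H10.toH1 - (H10.toH1 + H10.toH1)
  continuous_M v := (((H1.continuous_translate _).comp continuous_fst).add
    ((H1.continuous_translate _).comp continuous_snd)).sub continuous_const
  norm_M_le p v := by
    have h1 := norm_translate_toH1_le p.1 v
    have h2 := norm_translate_toH1_le p.2 v
    have h3 := v.norm_toH1_le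
    exact (norm_sub_le _ _).trans ((add_le_add (norm_add_le _ _) (norm_add_le _ _)).trans
      ((add_le_add (add_le_add h1 h2) (add_le_add h3 h3)).trans (by linarith)))

/-- The phase differences `v(x + z) - v(x + y) + v(x + t) - v(x)` of the quadruplet coupling. -/
def tripleFamily : PhaseFamily (UnitAddCircle × UnitAddCircle × UnitAddCircle) where
  μ := volume.prod (volume.prod volume)
  prob := inferInstance
  proj p := p.1 + (-p.2.1 + p.2.2)
  continuous_proj := by fun_prop
  proj_preserving := measurePreserving_snd.comp measurePreserving_fst_triple
  M p := H1.translate p.1 ∘L H10.toH1 - H1.translate p.2.1 ∘L H10.toH1 +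
    (H1.translate p.2.2 ∘L H10.toH1 - H10.toH1)
  continuous_M v := (((H1.continuous_translate _).comp continuous_fst).sub
    ((H1.continuous_translate _).comp (continuous_fst.comp continuous_snd))).add
    (((H1.continuous_translate _).comp (continuous_snd.comp continuous_snd)).sub continuous_const)
  norm_M_le p v := by
    have h1 := norm_translate_toH1_le p.1 v
    have h2 := norm_translate_toH1_le p.2.1 v
    have h3 := norm_translate_toH1_le p.2.2 v
    have h4 := v.norm_toH1_le
    exact (norm_add_le _ _).trans ((add_le_add (norm_sub_le _ _) (norm_sub_le _ _)).trans
      ((add_le_add (add_le_add h1 h2) (add_le_add h3 h4)).trans (by linarith)))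

theorem singleFamily_M_apply (z : UnitAddCircle) (v : H10) (x : UnitAddCircle) :
    (singleFamily.M z v).1.1 x = v (x + z) - v x := rfl

theorem pairFamily_M_apply (p : UnitAddCircle × UnitAddCircle) (v : H10) (x : UnitAddCircle) :
    (pairFamily.M p v).1.1 x = v (x + p.1) + v (x + p.2) - (v x + v x) := rfl

theorem tripleFamily_M_apply (p : UnitAddCircle × UnitAddCircle × UnitAddCircle) (v : H10)
    (x : UnitAddCircle) : (tripleFamily.M p v).1.1 x =
      v (x + p.1) - v (x + p.2.1) + (v (x + p.2.2) - v x) := rfl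

/-! ### The right-hand side in terms of averages -/

theorem twisted_add (q : ℕ) (x y : UnitAddCircle) :
    twisted q (x + y) = twisted q x + twisted q y := by
  induction x using QuotientAddGroup.induction_on with | H s => ?_
  induction y using QuotientAddGroup.induction_on with | H t => ?_
  change ((2 * π * q * (s + t) : ℝ) : Real.Angle) =
    ((2 * π * q * s : ℝ) : Real.Angle) + ((2 * π * q * t : ℝ) : Real.Angle)
  rw [← Real.Angle.coe_add, mul_add]

theorem twisted_neg (q : ℕ) (x : UnitAddCircle) : twisted q (-x) = -twisted q x := by
  induction x using QuotientAddGroup.induction_on with | H s => ?_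
  change ((2 * π * q * (-s) : ℝ) : Real.Angle) = -((2 * π * q * s : ℝ) : Real.Angle)
  rw [← Real.Angle.coe_neg, mul_neg]

theorem twisted_zero (q : ℕ) : twisted q 0 = 0 := by
  change ((2 * π * q * 0 : ℝ) : Real.Angle) = 0
  simp

/-- The substitution `y = x + z` and the evenness of `W r` move the discontinuity into the variable
`z`, away from `x`. The two analogues below work the same way. -/
theorem integral_pairwise_eq (q : ℕ) (r : ℝ) (v : H10) (x : UnitAddCircle) :
    ∫ y : UnitAddCircle, W r (x - y) * (twisted q y + ((v y : ℝ) : Real.Angle) -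
      (twisted q x + ((v x : ℝ) : Real.Angle))).sin = singleFamily.coupling q r v x := by
  rw [← integral_add_left_eq_self _ x]
  refine integral_congr_ae (ae_of_all _ fun z => ?_)
  have e1 : x - (x + z) = -z := by abel
  have e2 : twisted q (x + z) + ((v (x + z) : ℝ) : Real.Angle) -
      (twisted q x + ((v x : ℝ) : Real.Angle)) =
      twisted q z + ((v (x + z) - v x : ℝ) : Real.Angle) := by
    rw [twisted_add, Real.Angle.coe_sub]; abel
  simp only [e1, W_neg, e2]
  rfl

theorem integral_triplet_eq (q : ℕ) (r : ℝ) (v : H10) (x : UnitAddCircle) :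
    ∫ z : UnitAddCircle, ∫ y : UnitAddCircle, W r (z + y - 2 • x) *
      (twisted q z + ((v z : ℝ) : Real.Angle) + (twisted q y + ((v y : ℝ) : Real.Angle)) -
        2 • (twisted q x + ((v x : ℝ) : Real.Angle))).sin = pairFamily.coupling q r v x := by
  have hi := pairFamily.integrable_coupling q r v x
  rw [PhaseFamily.coupling]
  refine Eq.trans ?_ (integral_prod _ hi).symm
  rw [← integral_add_left_eq_self _ x]
  refine integral_congr_ae (ae_of_all _ fun z => ?_)
  simp only
  rw [← integral_add_left_eq_self _ x]
  refine integral_congr_ae (ae_of_all _ fun y => ?_)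
  have e1 : x + z + (x + y) - 2 • x = z + y := by abel
  have e2 : twisted q (x + z) + ((v (x + z) : ℝ) : Real.Angle) +
      (twisted q (x + y) + ((v (x + y) : ℝ) : Real.Angle)) -
        2 • (twisted q x + ((v x : ℝ) : Real.Angle)) =
      twisted q (z + y) + ((v (x + z) + v (x + y) - (v x + v x) : ℝ) : Real.Angle) := by
    simp only [twisted_add, Real.Angle.coe_sub, Real.Angle.coe_add]; abel
  simp only [e1, e2]
  rfl

theorem integral_quadruplet_eq (q : ℕ) (r : ℝ) (v : H10) (x : UnitAddCircle) :
    ∫ z : UnitAddCircle, ∫ y : UnitAddCircle, ∫ t : UnitAddCircle, W r (z - y + t - x) *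
      (twisted q z + ((v z : ℝ) : Real.Angle) - (twisted q y + ((v y : ℝ) : Real.Angle)) +
        (twisted q t + ((v t : ℝ) : Real.Angle)) -
        (twisted q x + ((v x : ℝ) : Real.Angle))).sin = tripleFamily.coupling q r v x := by
  have hi := tripleFamily.integrable_coupling q r v x
  rw [PhaseFamily.coupling]
  refine Eq.trans ?_ (integral_prod _ hi).symm
  rw [← integral_add_left_eq_self _ x]
  refine integral_congr_ae ?_
  -- The second application of Fubini uses integrability of the section, which is available for
  -- almost every `z`.
  filter_upwards [hi.prod_right_ae] with z hz
  refine Eq.trans ?_ (integral_prod _ hz).symm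
  rw [← integral_add_left_eq_self _ x]
  refine integral_congr_ae (ae_of_all _ fun y => ?_)
  simp only
  rw [← integral_add_left_eq_self _ x]
  refine integral_congr_ae (ae_of_all _ fun t => ?_)
  have e1 : x + z - (x + y) + (x + t) - x = z + (-y + t) := by abel
  have e2 : twisted q (x + z) + ((v (x + z) : ℝ) : Real.Angle) -
      (twisted q (x + y) + ((v (x + y) : ℝ) : Real.Angle)) +
      (twisted q (x + t) + ((v (x + t) : ℝ) : Real.Angle)) -
        (twisted q x + ((v x : ℝ) : Real.Angle)) =
      twisted q (z + (-y + t)) +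
        ((v (x + z) - v (x + y) + (v (x + t) - v x) : ℝ) : Real.Angle) := by
    simp only [twisted_add, twisted_neg, Real.Angle.coe_sub, Real.Angle.coe_add]; abel
  simp only [e1, e2]
  rfl

/-- The perturbed state has phase `0` at `x = 0`, so the subtracted integrals in `F` are the
coupling terms at `0`. -/
theorem Fq_eq (q : ℕ) (v : H10) (p : Param) (x : UnitAddCircle) :
    Fq q v p x =
      singleFamily.coupling q p.1 v x - singleFamily.coupling q p.1 v 0 +
      p.2.1 * (pairFamily.coupling q p.1 v x - pairFamily.coupling q p.1 v 0) +
      p.2.2 * (tripleFamily.coupling q p.1 v x - tripleFamily.coupling q p.1 v 0) := by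
  have h0 : twisted q 0 + ((v 0 : ℝ) : Real.Angle) = 0 := by
    rw [twisted_zero, v.apply_zero, Real.Angle.coe_zero, add_zero]
  have h1 := integral_pairwise_eq q p.1 v 0
  have h2 := integral_triplet_eq q p.1 v 0
  have h3 := integral_quadruplet_eq q p.1 v 0
  rw [h0] at h1 h2 h3
  simp only [zero_sub, W_neg, sub_zero, smul_zero] at h1 h2 h3
  rw [Fq, F, integral_pairwise_eq, integral_triplet_eq, integral_quadruplet_eq, h1, h2, h3]

/-- The right-hand side as a map from `H¹₀` to itself. -/
def field (q : ℕ) (v : H10) (p : Param) : H10 :=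
  H1.toH10 (singleFamily.average q p.1 v + p.2.1 • pairFamily.average q p.1 v +
    p.2.2 • tripleFamily.average q p.1 v)

theorem field_apply (q : ℕ) (v : H10) (p : Param) (x : UnitAddCircle) :
    field q v p x = Fq q v p x := by
  rw [Fq_eq, field, map_add, map_add, map_smul, map_smul]
  change (H1.toH10 (singleFamily.average q p.1 v)) x +
    p.2.1 * (H1.toH10 (pairFamily.average q p.1 v)) x +
    p.2.2 * (H1.toH10 (tripleFamily.average q p.1 v)) x = _
  simp only [H1.toH10_apply, PhaseFamily.average_apply]
  ring

theorem field_zero (q : ℕ) (p : Param) : field q 0 p = 0 := by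
  simp [field, PhaseFamily.average_zero]

/-! ### Translation equivariance -/

/-- The action `v ↦ v(· + z) - v(z)` of the circle on `H¹₀`. -/
def rotate (z : UnitAddCircle) : H10 →L[ℝ] H10 := H1.toH10 ∘L H1.translate z ∘L H10.toH1

theorem rotate_apply (z : UnitAddCircle) (v : H10) (x : UnitAddCircle) :
    rotate z v x = v (x + z) - v z := by
  change v (x + z) - v (0 + z) = _
  rw [zero_add]

theorem norm_rotate_le (z : UnitAddCircle) (v : H10) : ‖rotate z v‖ ≤ 3 * ‖v‖ :=
  (H1.norm_toH10_le _).trans (mul_le_mul_of_nonneg_left (norm_translate_toH1_le z v) (by norm_num))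

theorem coupling_rotate {Ω : Type} [TopologicalSpace Ω] [MeasurableSpace Ω] {P : PhaseFamily Ω}
    {z x : UnitAddCircle} {v : H10}
    (h : ∀ θ, (P.M θ (rotate z v)).1.1 x = (P.M θ v).1.1 (x + z)) (q : ℕ) (r : ℝ) :
    P.coupling q r (rotate z v) x = P.coupling q r v (x + z) := by
  rw [PhaseFamily.coupling, PhaseFamily.coupling]
  simp only [h]

/-- Every family of phase differences has total coefficient zero, so the constant `v z` in `rotate z
v` cancels and only the translation remains. -/
theorem Fq_rotate (q : ℕ) (z : UnitAddCircle) (v : H10) (p : Param) (x : UnitAddCircle) :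
    Fq q (rotate z v) p x = Fq q v p (x + z) - Fq q v p z := by
  have h1 : ∀ x, singleFamily.coupling q p.1 (rotate z v) x =
      singleFamily.coupling q p.1 v (x + z) := fun x => coupling_rotate (fun θ => by
    rw [singleFamily_M_apply, singleFamily_M_apply, rotate_apply, rotate_apply,
      add_right_comm x θ z]
    ring) q p.1
  have h2 : ∀ x, pairFamily.coupling q p.1 (rotate z v) x =
      pairFamily.coupling q p.1 v (x + z) := fun x => coupling_rotate (fun θ => by
    rw [pairFamily_M_apply, pairFamily_M_apply, rotate_apply, rotate_apply, rotate_apply,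
      add_right_comm x θ.1 z, add_right_comm x θ.2 z]
    ring) q p.1
  have h3 : ∀ x, tripleFamily.coupling q p.1 (rotate z v) x =
      tripleFamily.coupling q p.1 v (x + z) := fun x => coupling_rotate (fun θ => by
    rw [tripleFamily_M_apply, tripleFamily_M_apply, rotate_apply, rotate_apply, rotate_apply,
      rotate_apply, add_right_comm x θ.1 z, add_right_comm x θ.2.1 z, add_right_comm x θ.2.2 z]
    ring) q p.1
  simp only [Fq_eq, h1, h2, h3, zero_add]
  ring

theorem field_rotate (q : ℕ) (z : UnitAddCircle) (v : H10) (p : Param) :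
    field q (rotate z v) p = rotate z (field q v p) :=
  H10.ext fun x => by
    rw [field_apply, Fq_rotate, rotate_apply, field_apply, field_apply]

/-! ### Fourier coefficients of the coupling function -/

theorem sinMode_add (k : ℕ) (x y : UnitAddCircle) :
    sinMode k (x + y) = sinMode k x * cosMode k y + cosMode k x * sinMode k y := by
  induction x using QuotientAddGroup.induction_on with | H s => ?_
  induction y using QuotientAddGroup.induction_on with | H t => ?_
  change Real.sin (2 * π * k * (s + t)) = Real.sin (2 * π * k * s) * Real.cos (2 * π * k * t) +
    Real.cos (2 * π * k * s) * Real.sin (2 * π * k * t)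
  rw [mul_add, Real.sin_add]

theorem cosMode_add (k : ℕ) (x y : UnitAddCircle) :
    cosMode k (x + y) = cosMode k x * cosMode k y - sinMode k x * sinMode k y := by
  induction x using QuotientAddGroup.induction_on with | H s => ?_
  induction y using QuotientAddGroup.induction_on with | H t => ?_
  change Real.cos (2 * π * k * (s + t)) = Real.cos (2 * π * k * s) * Real.cos (2 * π * k * t) -
    Real.sin (2 * π * k * s) * Real.sin (2 * π * k * t)
  rw [mul_add, Real.cos_add]

theorem sinMode_neg (k : ℕ) (x : UnitAddCircle) : sinMode k (-x) = -sinMode k x := by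
  induction x using QuotientAddGroup.induction_on with | H s => ?_
  change Real.sin (2 * π * k * (-s)) = -Real.sin (2 * π * k * s)
  rw [mul_neg, Real.sin_neg]

theorem cosMode_neg (k : ℕ) (x : UnitAddCircle) : cosMode k (-x) = cosMode k x := by
  induction x using QuotientAddGroup.induction_on with | H s => ?_
  change Real.cos (2 * π * k * (-s)) = Real.cos (2 * π * k * s)
  rw [mul_neg, Real.cos_neg]

theorem u_apply_circle (k : ℕ) (x : UnitAddCircle) : u k x = sinMode k x := rfl

theorem w_apply_circle (k : ℕ) (x : UnitAddCircle) : w k x = 1 - cosMode k x := rfl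

/-- For `r < 1/2` the closed arc `[-r, r]` lies inside the fundamental domain `(-1/2, 1/2]`, where
the norm on the circle is the absolute value. -/
theorem integral_W_mul {r : ℝ} (hr : 0 < r) (hr2 : r < 1 / 2) (f : UnitAddCircle → ℝ) :
    ∫ x, W r x * f x = ∫ t in (-r)..r, f (t : UnitAddCircle) := by
  rw [← UnitAddCircle.intervalIntegral_preimage (-(1 / 2)),
    intervalIntegral.integral_of_le (by norm_num), intervalIntegral.integral_of_le (by linarith),
    ← integral_Icc_eq_integral_Ioc (x := -r)]
  have hsub : Icc (-r) r ⊆ Ioc (-(1 / 2)) (-(1 / 2) + 1) := fun t ht =>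
    ⟨by linarith [ht.1], by linarith [ht.2]⟩
  rw [← inter_eq_right.mpr hsub, ← setIntegral_indicator measurableSet_Icc]
  refine setIntegral_congr_fun measurableSet_Ioc fun t ht => ?_
  have hn : ‖(t : UnitAddCircle)‖ = |t| := by
    refine (AddCircle.norm_coe_eq_abs_iff 1 one_ne_zero).mpr (abs_le.mpr ?_)
    rw [abs_one]
    exact ⟨by linarith [ht.1], by linarith [ht.2]⟩
  simp only [W, hn, abs_le]
  by_cases h : -r ≤ t ∧ t ≤ r
  · rw [if_pos h, one_mul, indicator_of_mem (by exact h)]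
  · rw [if_neg h, zero_mul, indicator_of_notMem (by exact h)]

theorem integral_cos_eq_What {r : ℝ} (n : ℤ) :
    ∫ t in (-r)..r, Real.cos (2 * π * n * t) = What r n / 2 := by
  rw [What]
  split_ifs with h
  · simp [h]; ring
  · have hn : (n : ℝ) ≠ 0 := by exact_mod_cast h
    have hn2 : (2 * π * n : ℝ) ≠ 0 := by positivity
    rw [intervalIntegral.integral_comp_mul_left _ hn2, integral_cos, mul_neg, Real.sin_neg,
      smul_eq_mul]
    field_simp
    ring

theorem integral_W_cosMode {r : ℝ} (hr : 0 < r) (hr2 : r < 1 / 2) (q : ℕ) :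
    ∫ x, W r x * cosMode q x = What r q / 2 := by
  rw [integral_W_mul hr hr2]
  exact_mod_cast integral_cos_eq_What (r := r) q

theorem integral_W_cosMode_cosMode {r : ℝ} (hr : 0 < r) (hr2 : r < 1 / 2) (q k : ℕ) :
    ∫ x, W r x * (cosMode q x * cosMode k x) =
      (What r ((q : ℤ) - k) + What r ((q : ℤ) + k)) / 4 := by
  rw [integral_W_mul hr hr2]
  have h : ∀ t : ℝ, cosMode q (t : UnitAddCircle) * cosMode k (t : UnitAddCircle) =
      1 / 2 * (Real.cos (2 * π * ((q : ℤ) - k : ℤ) * t) +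
        Real.cos (2 * π * ((q : ℤ) + k : ℤ) * t)) := fun t => by
    have e1 : 2 * π * ((q : ℤ) - k : ℤ) * t = 2 * π * q * t - 2 * π * k * t := by
      push_cast; ring
    have e2 : 2 * π * ((q : ℤ) + k : ℤ) * t = 2 * π * q * t + 2 * π * k * t := by
      push_cast; ring
    rw [cosMode_coe, cosMode_coe, e1, e2, Real.cos_sub, Real.cos_add]
    ring
  simp only [h]
  rw [intervalIntegral.integral_const_mul, intervalIntegral.integral_add
    ((by fun_prop : Continuous _).intervalIntegrable _ _)
    ((by fun_prop : Continuous _).intervalIntegrable _ _), integral_cos_eq_What,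
    integral_cos_eq_What]
  ring

/-- The integrand is odd. -/
theorem integral_W_cosMode_sinMode (r : ℝ) (q k : ℕ) :
    ∫ x, W r x * (cosMode q x * sinMode k x) = 0 := by
  have h := integral_neg_eq_self (fun x => W r x * (cosMode q x * sinMode k x))
    (volume : Measure UnitAddCircle)
  simp only [W_neg, cosMode_neg, sinMode_neg, mul_neg, integral_neg] at h
  linarith

/-! ### The linearization at the twisted state -/

/-- The hypothesis says that `c` and `proj` are independent and uniform, so the integral of the
product factorizes. -/
theorem PhaseFamily.integral_mul_of_preserving {Ω : Type} [TopologicalSpace Ω]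
    [MeasurableSpace Ω] (P : PhaseFamily Ω) {c : Ω → UnitAddCircle}
    (h : MeasurePreserving (fun θ => (c θ, P.proj θ)) P.μ (volume.prod volume))
    {κ g : UnitAddCircle → ℝ} (hκ : Measurable κ) (hg : Measurable g) :
    ∫ θ, κ (P.proj θ) * g (c θ) ∂P.μ = (∫ x, κ x) * ∫ x, g x := by
  have h1 := integral_map (μ := P.μ) h.measurable.aemeasurable
    (f := fun p : UnitAddCircle × UnitAddCircle => g p.1 * κ p.2)
    (((hg.comp measurable_fst).mul (hκ.comp measurable_snd)).aestronglyMeasurable)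
  rw [h.map_eq, integral_prod_mul] at h1
  rw [mul_comm, h1]
  simp only [mul_comm]

theorem PhaseFamily.integral_proj {Ω : Type} [TopologicalSpace Ω]
    [MeasurableSpace Ω] (P : PhaseFamily Ω) {κ : UnitAddCircle → ℝ} (hκ : Measurable κ) :
    ∫ θ, κ (P.proj θ) ∂P.μ = ∫ x, κ x := by
  rw [← P.proj_preserving.map_eq, integral_map P.proj_preserving.measurable.aemeasurable
    hκ.aestronglyMeasurable]

/-- The kernel `W_r(z) cos (2πqz)` of the linearization. -/
def kernel (q : ℕ) (r : ℝ) (x : UnitAddCircle) : ℝ := W r x * cosMode q x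

theorem measurable_kernel (q : ℕ) (r : ℝ) : Measurable (kernel q r) :=
  (measurable_W r).mul (cosMode q).continuous.measurable

theorem abs_kernel_le (q : ℕ) (r : ℝ) (x : UnitAddCircle) : |kernel q r x| ≤ 1 := by
  rw [kernel, abs_mul]
  exact mul_le_one₀ (abs_W_le r x) (abs_nonneg _) (abs_cosMode_le q x)

theorem integrable_kernel_mul (q : ℕ) (r : ℝ) {f : UnitAddCircle → ℝ} (hf : Continuous f) :
    Integrable fun x => kernel q r x * f x :=
  singleFamily.integrable_smul_real (measurable_kernel q r) (abs_kernel_le q r) hf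

theorem PhaseFamily.linear_apply_kernel {Ω : Type} [TopologicalSpace Ω] [CompactSpace Ω]
    [SecondCountableTopology Ω] [MeasurableSpace Ω] [BorelSpace Ω] (P : PhaseFamily Ω)
    (q : ℕ) (r : ℝ) (v : H10) (x : UnitAddCircle) :
    (P.linear q r v).1.1 x = ∫ θ, kernel q r (P.proj θ) * (P.M θ v).1.1 x ∂P.μ := by
  rw [P.linear_apply_apply]
  simp only [kernel, mul_assoc]

theorem H10.continuous_shift (v : H10) (x : UnitAddCircle) : Continuous fun z => v (x + z) :=
  v.toCont.continuous.comp (by fun_prop)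

theorem integral_H10_shift (v : H10) (x : UnitAddCircle) : ∫ z, v (x + z) = ∫ z, v z :=
  integral_add_left_eq_self (fun z => v z) x

theorem single_linear_apply (q : ℕ) (r : ℝ) (v : H10) (x : UnitAddCircle) :
    (singleFamily.linear q r v).1.1 x =
      (∫ z, kernel q r z * v (x + z)) - (∫ z, kernel q r z) * v x := by
  rw [PhaseFamily.linear_apply_kernel, ← integral_mul_const,
    ← integral_sub (integrable_kernel_mul q r (v.continuous_shift x))
      (integrable_kernel_mul q r continuous_const)]
  refine integral_congr_ae (ae_of_all _ fun z => ?_)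
  simp only [singleFamily_M_apply]
  exact mul_sub _ _ _

/-- The sum `z + y` is independent of `z` alone and of `y` alone, so the shifted terms average to a
constant in `x`. Only the multiple of `v x` survives after subtracting the value at `0`, and the
triple family behaves alike. This is why the higher-order couplings shift all eigenvalues equally.
-/
theorem pair_linear_apply (q : ℕ) (r : ℝ) (v : H10) (x : UnitAddCircle) :
    (pairFamily.linear q r v).1.1 x =
      2 * (∫ z, kernel q r z) * (∫ z, v z) - 2 * (∫ z, kernel q r z) * v x := by
  have hm := measurable_kernel q r
  have hi : ∀ f : UnitAddCircle × UnitAddCircle → ℝ, Continuous f →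
      Integrable (fun θ => kernel q r (pairFamily.proj θ) * f θ) pairFamily.μ := fun f hf =>
    pairFamily.integrable_smul_real hm (abs_kernel_le q r) hf
  have i1 := hi _ ((v.continuous_shift x).comp continuous_fst)
  have i2 := hi _ ((v.continuous_shift x).comp continuous_snd)
  have i3 := hi _ (continuous_const (y := v x + v x))
  have h1 := pairFamily.integral_mul_of_preserving (c := Prod.fst)
    (measurePreserving_prod_add volume volume) hm (v.continuous_shift x).measurable
  -- The independence of `y` and `z + y`, from that of `z` and `z + y` by exchanging the variables.
  have hswap : MeasurePreserving (fun p : UnitAddCircle × UnitAddCircle => (p.2, p.1 + p.2))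
      (volume.prod volume) (volume.prod volume) := by
    have := (measurePreserving_prod_add (volume : Measure UnitAddCircle) volume).comp
      (Measure.measurePreserving_swap (μ := volume) (ν := (volume : Measure UnitAddCircle)))
    simpa only [Function.comp_def, Prod.fst_swap, Prod.snd_swap, add_comm] using this
  have h2 := pairFamily.integral_mul_of_preserving (c := Prod.snd) hswap hm
    (v.continuous_shift x).measurable
  rw [integral_H10_shift] at h1 h2
  have h3 := pairFamily.integral_proj hm
  have e : ∀ θ, kernel q r (pairFamily.proj θ) * (pairFamily.M θ v).1.1 x =
      kernel q r (pairFamily.proj θ) * v (x + θ.1) + kernel q r (pairFamily.proj θ) * v (x + θ.2) -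
        kernel q r (pairFamily.proj θ) * (v x + v x) := fun θ => by
    rw [pairFamily_M_apply]; ring
  rw [PhaseFamily.linear_apply_kernel]
  simp only [e]
  simp only [Function.comp_apply] at i1 i2
  have i12 : Integrable (fun θ => kernel q r (pairFamily.proj θ) * v (x + θ.1) +
      kernel q r (pairFamily.proj θ) * v (x + θ.2)) pairFamily.μ := i1.add i2
  rw [integral_sub i12 i3, integral_add i1 i2, integral_mul_const, h3]
  rw [h1, h2]
  ring

theorem triple_linear_apply (q : ℕ) (r : ℝ) (v : H10) (x : UnitAddCircle) :
    (tripleFamily.linear q r v).1.1 x =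
      (∫ z, kernel q r z) * (∫ z, v z) - (∫ z, kernel q r z) * v x := by
  have hm := measurable_kernel q r
  have hi : ∀ f : UnitAddCircle × UnitAddCircle × UnitAddCircle → ℝ, Continuous f →
      Integrable (fun θ => kernel q r (tripleFamily.proj θ) * f θ) tripleFamily.μ := fun f hf =>
    tripleFamily.integrable_smul_real hm (abs_kernel_le q r) hf
  have i1 := hi _ ((v.continuous_shift x).comp continuous_fst)
  have i2 := hi _ ((v.continuous_shift x).comp (continuous_fst.comp continuous_snd))
  have i3 := hi _ ((v.continuous_shift x).comp (continuous_snd.comp continuous_snd))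
  have i4 := hi _ (continuous_const (y := v x))
  have hv := (v.continuous_shift x).measurable
  have h1 := tripleFamily.integral_mul_of_preserving (c := Prod.fst)
    measurePreserving_fst_triple hm hv
  have h2 := tripleFamily.integral_mul_of_preserving (c := fun p => p.2.1)
    (measurePreserving_of_snd_triple measurePreserving_fst) hm hv
  have h3 := tripleFamily.integral_mul_of_preserving (c := fun p => p.2.2)
    (measurePreserving_of_snd_triple measurePreserving_snd) hm hv
  rw [integral_H10_shift] at h1 h2 h3
  have h4 := tripleFamily.integral_proj hm
  have e : ∀ θ, kernel q r (tripleFamily.proj θ) * (tripleFamily.M θ v).1.1 x =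
      kernel q r (tripleFamily.proj θ) * v (x + θ.1) -
        kernel q r (tripleFamily.proj θ) * v (x + θ.2.1) +
      (kernel q r (tripleFamily.proj θ) * v (x + θ.2.2) -
        kernel q r (tripleFamily.proj θ) * v x) := fun θ => by
    rw [tripleFamily_M_apply]; ring
  rw [PhaseFamily.linear_apply_kernel]
  simp only [e]
  have i12 : Integrable (fun θ => kernel q r (tripleFamily.proj θ) * v (x + θ.1) -
      kernel q r (tripleFamily.proj θ) * v (x + θ.2.1)) tripleFamily.μ := i1.sub i2
  have i34 : Integrable (fun θ => kernel q r (tripleFamily.proj θ) * v (x + θ.2.2) -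
      kernel q r (tripleFamily.proj θ) * v x) tripleFamily.μ := i3.sub i4
  rw [integral_add i12 i34]
  simp only [Function.comp_apply] at i1 i2 i3 i4
  rw [integral_sub i1 i2, integral_sub i3 i4, integral_mul_const, h4, h1, h2, h3]
  ring

/-- The linearization of the right-hand side at the twisted state. -/
def linearization (q : ℕ) (p : Param) : H10 →L[ℝ] H10 :=
  H1.toH10 ∘L (singleFamily.linear q p.1 + p.2.1 • pairFamily.linear q p.1 +
    p.2.2 • tripleFamily.linear q p.1)

theorem linearization_apply (q : ℕ) (p : Param) (v : H10) (x : UnitAddCircle) :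
    linearization q p v x = (∫ z, kernel q p.1 z * v (x + z)) - (∫ z, kernel q p.1 z * v z) -
      (1 + 2 * p.2.1 + p.2.2) * (∫ z, kernel q p.1 z) * v x := by
  change (singleFamily.linear q p.1 v).1.1 x + p.2.1 * (pairFamily.linear q p.1 v).1.1 x +
    p.2.2 * (tripleFamily.linear q p.1 v).1.1 x - ((singleFamily.linear q p.1 v).1.1 0 +
    p.2.1 * (pairFamily.linear q p.1 v).1.1 0 + p.2.2 * (tripleFamily.linear q p.1 v).1.1 0) = _
  simp only [single_linear_apply, pair_linear_apply, triple_linear_apply, v.apply_zero, zero_add]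
  ring

theorem linearization_u {p : Param} (hr : 0 < p.1) (hr2 : p.1 < 1 / 2) (q k : ℕ) :
    linearization q p (u k) = c1 q k p • u k := by
  refine H10.ext fun x => ?_
  change linearization q p (u k) x = c1 q k p * u k x
  have hc := integral_W_cosMode_cosMode hr hr2 q k
  have hs := integral_W_cosMode_sinMode p.1 q k
  have h0 := integral_W_cosMode hr hr2 q
  have e : ∀ z, kernel q p.1 z * u k (x + z) =
      sinMode k x * (W p.1 z * (cosMode q z * cosMode k z)) +
        cosMode k x * (W p.1 z * (cosMode q z * sinMode k z)) := fun z => by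
    rw [u_apply_circle, sinMode_add, kernel]; ring
  have e2 : ∀ z, kernel q p.1 z * u k z = W p.1 z * (cosMode q z * sinMode k z) := fun z => by
    rw [u_apply_circle, kernel]; ring
  have ic : Integrable fun z => W p.1 z * (cosMode q z * cosMode k z) :=
    (integrable_kernel_mul q p.1 (cosMode k).continuous).congr
      (ae_of_all _ fun z => by simp only [kernel, mul_assoc])
  have is : Integrable fun z => W p.1 z * (cosMode q z * sinMode k z) :=
    (integrable_kernel_mul q p.1 (sinMode k).continuous).congr
      (ae_of_all _ fun z => by simp only [kernel, mul_assoc])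
  rw [linearization_apply]
  simp only [e, e2]
  rw [integral_add (ic.const_mul _) (is.const_mul _), integral_const_mul, integral_const_mul,
    hc, hs, u_apply_circle, c1]
  simp only [kernel]
  rw [h0]
  ring

/-- The constant in `w k` is harmless: the difference of the two kernel integrals and the condition
`w k 0 = 0` reproduce `1 - cos` exactly. -/
theorem linearization_w {p : Param} (hr : 0 < p.1) (hr2 : p.1 < 1 / 2) (q k : ℕ) :
    linearization q p (w k) = c1 q k p • w k := by
  refine H10.ext fun x => ?_
  change linearization q p (w k) x = c1 q k p * w k x
  have hc := integral_W_cosMode_cosMode hr hr2 q k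
  have hs := integral_W_cosMode_sinMode p.1 q k
  have h0 := integral_W_cosMode hr hr2 q
  have e : ∀ z, kernel q p.1 z * w k (x + z) = W p.1 z * cosMode q z -
      (cosMode k x * (W p.1 z * (cosMode q z * cosMode k z)) -
        sinMode k x * (W p.1 z * (cosMode q z * sinMode k z))) := fun z => by
    rw [w_apply_circle, cosMode_add, kernel]; ring
  have e2 : ∀ z, kernel q p.1 z * w k z = W p.1 z * cosMode q z -
      W p.1 z * (cosMode q z * cosMode k z) := fun z => by
    rw [w_apply_circle, kernel]; ring
  have ic : Integrable fun z => W p.1 z * (cosMode q z * cosMode k z) :=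
    (integrable_kernel_mul q p.1 (cosMode k).continuous).congr
      (ae_of_all _ fun z => by simp only [kernel, mul_assoc])
  have is : Integrable fun z => W p.1 z * (cosMode q z * sinMode k z) :=
    (integrable_kernel_mul q p.1 (sinMode k).continuous).congr
      (ae_of_all _ fun z => by simp only [kernel, mul_assoc])
  have i0 : Integrable fun z => W p.1 z * cosMode q z :=
    (integrable_kernel_mul q p.1 (continuous_const (y := (1 : ℝ)))).congr
      (ae_of_all _ fun z => by simp only [kernel, mul_one])
  have icc : Integrable fun z => cosMode k x * (W p.1 z * (cosMode q z * cosMode k z)) -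
      sinMode k x * (W p.1 z * (cosMode q z * sinMode k z)) :=
    (ic.const_mul _).sub (is.const_mul _)
  rw [linearization_apply]
  simp only [e, e2]
  rw [integral_sub i0 icc, integral_sub (ic.const_mul _) (is.const_mul _), integral_const_mul,
    integral_const_mul, integral_sub i0 ic, hc, hs, w_apply_circle, c1]
  simp only [kernel]
  rw [h0]
  ring

/-! ### Strict derivative of the right-hand side at the twisted state -/

theorem HasStrictFDerivAt.smul_of_eq_zero {E G : Type*} [NormedAddCommGroup E] [NormedSpace ℝ E]
    [NormedAddCommGroup G] [NormedSpace ℝ G] {c : E → ℝ} {c' : E →L[ℝ] ℝ} {f : E → G}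
    {f' : E →L[ℝ] G} {x : E} (hc : HasStrictFDerivAt c c' x) (hf : HasStrictFDerivAt f f' x)
    (h0 : f x = 0) : HasStrictFDerivAt (fun y => c y • f y) (c x • f') x := by
  refine (hc.fun_smul hf).congr_fderiv ?_
  ext y
  simp [h0]

/-- No derivative in the parameters appears: the averages vanish at `v = 0`, so the product rule
loses the terms that differentiate `λ` and `μ`. -/
theorem hasStrictFDerivAt_field (q : ℕ) (p₀ : Param) :
    HasStrictFDerivAt (fun z : H10 × Param => field q z.1 z.2)
      (linearization q p₀ ∘L ContinuousLinearMap.fst ℝ H10 Param) (0, p₀) := by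
  have hA : ∀ {Ω : Type} [TopologicalSpace Ω] [CompactSpace Ω] [SecondCountableTopology Ω]
      [MeasurableSpace Ω] [BorelSpace Ω] (P : PhaseFamily Ω),
      HasStrictFDerivAt (fun z : H10 × Param => P.average q z.2.1 z.1)
        (P.linear q p₀.1 ∘L ContinuousLinearMap.fst ℝ H10 Param) (0, p₀) := by
    intro Ω _ _ _ _ _ P
    exact (P.hasStrictFDerivAt_average q p₀.1).comp ((0 : H10), p₀)
      ((ContinuousLinearMap.fst ℝ H10 Param).prod (ContinuousLinearMap.fst ℝ ℝ (ℝ × ℝ) ∘L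
        ContinuousLinearMap.snd ℝ H10 Param)).hasStrictFDerivAt
  have hl : HasStrictFDerivAt (fun z : H10 × Param => z.2.2.1) _ ((0 : H10), p₀) :=
    (ContinuousLinearMap.fst ℝ ℝ ℝ ∘L ContinuousLinearMap.snd ℝ ℝ (ℝ × ℝ) ∘L
        ContinuousLinearMap.snd ℝ H10 Param).hasStrictFDerivAt
  have hm : HasStrictFDerivAt (fun z : H10 × Param => z.2.2.2) _ ((0 : H10), p₀) :=
    (ContinuousLinearMap.snd ℝ ℝ ℝ ∘L ContinuousLinearMap.snd ℝ ℝ (ℝ × ℝ) ∘L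
        ContinuousLinearMap.snd ℝ H10 Param).hasStrictFDerivAt
  have h := ((hA singleFamily).add (HasStrictFDerivAt.smul_of_eq_zero hl (hA pairFamily)
    (PhaseFamily.average_zero _ _ _))).add (HasStrictFDerivAt.smul_of_eq_zero hm (hA tripleFamily)
    (PhaseFamily.average_zero _ _ _))
  exact (H1.toH10.hasStrictFDerivAt.comp ((0 : H10), p₀) h).congr_fderiv rfl

/-! ### The dual functionals on `H¹₀` -/

theorem H10.integrable_mul (φ : C(UnitAddCircle, ℝ)) (v : H10) : Integrable fun x => φ x * v x :=
  (φ * v.toCont).continuous.integrable_of_hasCompactSupport (HasCompactSupport.of_compactSpace _)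

theorem abs_integral_mode_mul_le {φ : C(UnitAddCircle, ℝ)} (hφ : ∀ x, |φ x| ≤ 1) (v : H10) :
    |∫ x, φ x * v x| ≤ ‖v‖ := by
  have h : ∀ x, ‖φ x * v x‖ ≤ ‖v‖ := fun x => by
    rw [norm_mul]
    refine (mul_le_of_le_one_left (norm_nonneg _) (hφ x)).trans ?_
    exact (v.toCont.norm_coe_le_norm x).trans (v.norm_toCont_le.trans v.norm_D_le)
  have h' := norm_integral_le_of_norm_le_const (μ := (volume : Measure UnitAddCircle))
    (ae_of_all _ h)
  rwa [probReal_univ, mul_one] at h'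

/-- The functional `z₁*` on `H¹₀`. -/
def z1L (ℓ : ℕ) : H10 →L[ℝ] ℝ :=
  LinearMap.mkContinuous
    { toFun := fun v => z1 ℓ v
      map_add' := fun v w => by
        rw [z1, z1, z1, ← mul_add, ← integral_add (H10.integrable_mul _ v) (H10.integrable_mul _ w)]
        simp only [← mul_add]
        rfl
      map_smul' := fun c v => by
        rw [z1, z1, RingHom.id_apply, smul_eq_mul, mul_left_comm, ← integral_const_mul c]
        exact congrArg _ (integral_congr_ae (ae_of_all _ fun x => mul_left_comm (sinMode ℓ x) c (v x))) } 2
    (fun v => by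
      change |z1 ℓ v| ≤ _
      rw [z1, abs_mul, abs_two]
      exact mul_le_mul_of_nonneg_left (abs_integral_mode_mul_le (abs_sinMode_le ℓ) v) zero_le_two)

/-- The functional `z₂*` on `H¹₀`. -/
def z2L (ℓ : ℕ) : H10 →L[ℝ] ℝ :=
  LinearMap.mkContinuous
    { toFun := fun v => z2 ℓ v
      map_add' := fun v w => by
        rw [z2, z2, z2, ← mul_add, ← integral_add (H10.integrable_mul _ v) (H10.integrable_mul _ w)]
        simp only [← mul_add]
        rfl
      map_smul' := fun c v => by
        rw [z2, z2, RingHom.id_apply, smul_eq_mul, mul_left_comm, ← integral_const_mul c]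
        exact congrArg _ (integral_congr_ae (ae_of_all _ fun x => mul_left_comm (cosMode ℓ x) c (v x))) } 2
    (fun v => by
      change |z2 ℓ v| ≤ _
      rw [z2, abs_mul, abs_neg, abs_two]
      exact mul_le_mul_of_nonneg_left (abs_integral_mode_mul_le (abs_cosMode_le ℓ) v) zero_le_two)

theorem z1L_apply (ℓ : ℕ) (v : H10) : z1L ℓ v = z1 ℓ v := rfl

theorem z2L_apply (ℓ : ℕ) (v : H10) : z2L ℓ v = z2 ℓ v := rfl

theorem inner_toLp (φ : C(UnitAddCircle, ℝ)) (g : L2S) :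
    inner ℝ (ContinuousMap.toLp 2 volume ℝ φ : L2S) g = ∫ x, φ x * g x := by
  rw [L2.inner_def]
  refine integral_congr_ae ?_
  filter_upwards [ContinuousMap.coeFn_toLp (p := 2) (𝕜 := ℝ) volume φ] with x hx
  rw [hx, real_inner_eq_re_inner, mul_comm]
  rfl

theorem inner_D_u (k : ℕ) (g : L2S) :
    inner ℝ (u k).D g = 2 * π * k * ∫ x, cosMode k x * g x := by
  have h : (u k).D = ContinuousMap.toLp 2 volume ℝ ((2 * π * k) • cosMode k) := rfl
  rw [h, inner_toLp, ← integral_const_mul]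
  simp only [ContinuousMap.smul_apply, smul_eq_mul, mul_assoc]

theorem inner_D_w (k : ℕ) (g : L2S) :
    inner ℝ (w k).D g = 2 * π * k * ∫ x, sinMode k x * g x := by
  have h : (w k).D = ContinuousMap.toLp 2 volume ℝ ((2 * π * k) • sinMode k) := rfl
  rw [h, inner_toLp, ← integral_const_mul]
  simp only [ContinuousMap.smul_apply, smul_eq_mul, mul_assoc]

/-- Integration by parts turns the scalar product of derivatives into the dual functional. It yields
the orthogonality of the modes in `pairwise_inner_D_mode`. -/
theorem inner_D_u_D (k : ℕ) (v : H10) : inner ℝ (u k).D v.D = 2 * (π * k) ^ 2 * z1 k v := by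
  rw [inner_D_u, (integral_trig_deriv_eq_zero (v.isPrimitive.isWeakDeriv (integrable_L2S _)) k).1,
    z1]
  ring

theorem inner_D_w_D (k : ℕ) (v : H10) : inner ℝ (w k).D v.D = 2 * (π * k) ^ 2 * z2 k v := by
  rw [inner_D_w, (integral_trig_deriv_eq_zero (v.isPrimitive.isWeakDeriv (integrable_L2S _)) k).2,
    z2]
  ring

/-! ### The complement `X₀` -/

/-- The indices of the modes that span `X₀`. -/
abbrev ModeIndex (ℓ : ℕ) : Type := {k : ℕ // 1 ≤ k ∧ k ≠ ℓ} × Bool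

/-- The modes that span `X₀`. -/
def mode {ℓ : ℕ} (i : ModeIndex ℓ) : H10 := if i.2 then u i.1 else w i.1

theorem X0_eq (ℓ : ℕ) :
    X0 ℓ = (Submodule.span ℝ (range (mode (ℓ := ℓ)))).topologicalClosure := by
  rw [X0]
  congr 2
  ext v
  constructor
  · rintro ⟨k, h1, h2, rfl | rfl⟩
    · exact ⟨(⟨k, h1, h2⟩, true), rfl⟩
    · exact ⟨(⟨k, h1, h2⟩, false), rfl⟩
  · rintro ⟨⟨⟨k, h1, h2⟩, b⟩, rfl⟩
    cases b
    · exact ⟨k, h1, h2, Or.inr rfl⟩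
    · exact ⟨k, h1, h2, Or.inl rfl⟩

theorem mode_mem_X0 {ℓ : ℕ} (i : ModeIndex ℓ) : mode i ∈ X0 ℓ := by
  rw [X0_eq]
  exact Submodule.le_topologicalClosure _ (Submodule.subset_span (mem_range_self i))

theorem X0_le_of_isClosed {ℓ : ℕ} {K : Submodule ℝ H10} (hK : IsClosed (K : Set H10))
    (h : ∀ i : ModeIndex ℓ, mode i ∈ K) : X0 ℓ ≤ K := by
  rw [X0_eq]
  refine Submodule.topologicalClosure_minimal _ (Submodule.span_le.mpr ?_) hK
  rintro _ ⟨i, rfl⟩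
  exact h i

theorem isClosed_X0 (ℓ : ℕ) : IsClosed (X0 ℓ : Set H10) := by
  rw [X0]; exact Submodule.isClosed_topologicalClosure _

instance (ℓ : ℕ) : CompleteSpace (X0 ℓ) := (isClosed_X0 ℓ).completeSpace_coe

theorem z_eq_zero_of_mem_X0 {ℓ : ℕ} (hℓ : 1 ≤ ℓ) {v : H10} (hv : v ∈ X0 ℓ) :
    z1 ℓ v = 0 ∧ z2 ℓ v = 0 := by
  have h1 : X0 ℓ ≤ (z1L ℓ).ker := X0_le_of_isClosed (z1L ℓ).isClosed_ker fun i => by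
    rcases i with ⟨⟨k, h1, h2⟩, b⟩
    change z1 ℓ (mode _) = 0
    cases b
    · exact z1_w
    · exact (z1_u hℓ).trans (if_neg h2)
  have h2 : X0 ℓ ≤ (z2L ℓ).ker := X0_le_of_isClosed (z2L ℓ).isClosed_ker fun i => by
    rcases i with ⟨⟨k, h1, h2⟩, b⟩
    change z2 ℓ (mode _) = 0
    cases b
    · exact (z2_w hℓ).trans (if_neg h2)
    · exact z2_u
  exact ⟨h1 hv, h2 hv⟩

theorem antilipschitz_D : AntilipschitzWith 2 H10.DL :=
  AddMonoidHomClass.antilipschitz_of_bound _ fun v => v.norm_le_two_mul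

/-- Closedness lets the image equal its double orthogonal complement in `L²`. -/
theorem isClosed_map_D_X0 (ℓ : ℕ) :
    IsClosed ((X0 ℓ).map (H10.DL : H10 →ₗ[ℝ] L2S) : Set L2S) := by
  have : CompleteSpace (X0 ℓ : Set H10) := (isClosed_X0 ℓ).completeSpace_coe
  have h := (antilipschitz_D.comp (AntilipschitzWith.subtype_coe (X0 ℓ : Set H10))).isClosed_range
    (H10.DL.uniformContinuous.comp uniformContinuous_subtype_val)
  convert h using 1
  ext g
  simp only [Submodule.map_coe, mem_image, mem_range, Function.comp_apply, Subtype.exists,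
    SetLike.mem_coe, exists_prop]
  rfl

theorem integral_cosMode (k : ℕ) : ∫ x, cosMode k x = if k = 0 then 1 else 0 := by
  rw [← UnitAddCircle.intervalIntegral_preimage 0]
  simpa using integral_cos_mode k

theorem integral_sinMode (k : ℕ) : ∫ x, sinMode k x = 0 := by
  rw [← UnitAddCircle.intervalIntegral_preimage 0]
  simpa using integral_sin_mode k

theorem cosMode_zero (x : UnitAddCircle) : cosMode 0 x = 1 := by
  induction x using QuotientAddGroup.induction_on with | H t => ?_
  exact (cosMode_coe 0 t).trans (by simp)

theorem sinMode_zero (x : UnitAddCircle) : sinMode 0 x = 0 := by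
  induction x using QuotientAddGroup.induction_on with | H t => ?_
  exact (sinMode_coe 0 t).trans (by simp)

theorem integrable_C (φ : C(UnitAddCircle, ℝ)) : Integrable φ :=
  φ.continuous.integrable_of_hasCompactSupport (HasCompactSupport.of_compactSpace _)

theorem integral_cosMode_cosMode {k ℓ : ℕ} (hk : 1 ≤ k) :
    ∫ x, cosMode k x * cosMode ℓ x = if ℓ = k then 1 / 2 else 0 := by
  have h := z2_w (ℓ := k) (k := ℓ) hk
  have e : ∀ x, cosMode k x * w ℓ x = cosMode k x - cosMode k x * cosMode ℓ x := fun x => by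
    rw [w_apply_circle]; ring
  rw [z2] at h
  simp only [e] at h
  have i : Integrable fun x => cosMode k x * cosMode ℓ x := integrable_C (cosMode k * cosMode ℓ)
  rw [integral_sub (integrable_C _) i, integral_cosMode, if_neg (by omega)] at h
  split_ifs at h ⊢ <;> linarith

theorem integral_sinMode_sinMode {k ℓ : ℕ} (hk : 1 ≤ k) :
    ∫ x, sinMode k x * sinMode ℓ x = if ℓ = k then 1 / 2 else 0 := by
  have h := z1_u (ℓ := k) (k := ℓ) hk
  rw [z1] at h
  simp only [u_apply_circle] at h
  split_ifs at h ⊢ <;> linarith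

theorem integral_cosMode_sinMode (k ℓ : ℕ) : ∫ x, cosMode k x * sinMode ℓ x = 0 := by
  have h := z2_u (ℓ := k) (k := ℓ)
  rw [z2] at h
  simp only [u_apply_circle] at h
  linarith

/-- A square integrable function that is orthogonal to all the modes except those of frequency
`0` and `ℓ` is a linear combination of the latter. -/
theorem L2S_eq_of_orthogonal {ℓ : ℕ} (hℓ : 1 ≤ ℓ) (g : L2S)
    (hc : ∀ k : ℕ, 1 ≤ k → k ≠ ℓ → ∫ x, cosMode k x * g x = 0)
    (hs : ∀ k : ℕ, 1 ≤ k → k ≠ ℓ → ∫ x, sinMode k x * g x = 0) :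
    ∃ a b c : ℝ, g = ContinuousMap.toLp 2 volume ℝ
      (a • cosMode 0 + b • cosMode ℓ + c • sinMode ℓ) := by
  set a := ∫ x, cosMode 0 x * g x with ha
  set b := 2 * ∫ x, cosMode ℓ x * g x with hb
  set c := 2 * ∫ x, sinMode ℓ x * g x with hc'
  refine ⟨a, b, c, sub_eq_zero.mp ?_⟩
  set h : C(UnitAddCircle, ℝ) := a • cosMode 0 + b • cosMode ℓ + c • sinMode ℓ with hh
  have hint : ∀ φ : C(UnitAddCircle, ℝ), ∫ x, φ x * (g - ContinuousMap.toLp 2 volume ℝ h : L2S) x =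
      (∫ x, φ x * g x) - (a * (∫ x, φ x * cosMode 0 x) + b * (∫ x, φ x * cosMode ℓ x) +
        c * ∫ x, φ x * sinMode ℓ x) := by
    intro φ
    have i0 : Integrable fun x => φ x * cosMode 0 x := integrable_C (φ * cosMode 0)
    have i1 : Integrable fun x => φ x * cosMode ℓ x := integrable_C (φ * cosMode ℓ)
    have i2 : Integrable fun x => φ x * sinMode ℓ x := integrable_C (φ * sinMode ℓ)
    have ig : Integrable fun x => φ x * g x :=
      (integrable_L2S g).bdd_mul (c := ‖φ‖) φ.continuous.aestronglyMeasurable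
        (ae_of_all _ fun x => φ.norm_coe_le_norm x)
    have i01 : Integrable fun x => a * (φ x * cosMode 0 x) + b * (φ x * cosMode ℓ x) :=
      (i0.const_mul a).add (i1.const_mul b)
    have i012 : Integrable fun x => a * (φ x * cosMode 0 x) + b * (φ x * cosMode ℓ x) +
        c * (φ x * sinMode ℓ x) := i01.add (i2.const_mul c)
    rw [← integral_const_mul, ← integral_const_mul, ← integral_const_mul,
      ← integral_add (i0.const_mul a) (i1.const_mul b), ← integral_add i01 (i2.const_mul c),
      ← integral_sub ig i012]
    refine integral_congr_ae ?_
    filter_upwards [Lp.coeFn_sub g (ContinuousMap.toLp 2 volume ℝ h),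
      ContinuousMap.coeFn_toLp (p := 2) (𝕜 := ℝ) volume h] with x h1 h2
    rw [h1, Pi.sub_apply, h2, hh]
    simp only [ContinuousMap.add_apply, ContinuousMap.smul_apply, smul_eq_mul]
    ring
  refine L2S_eq_zero_of_trig _ (fun k => ?_) fun k => ?_
  · rw [hint, integral_cosMode_sinMode]
    rcases Nat.eq_zero_or_pos k with rfl | hk
    · simp only [cosMode_zero, one_mul, integral_cosMode, if_neg (by omega : ¬ ℓ = 0)]
      simp only [ha, cosMode_zero, one_mul]
      simp
    · simp only [cosMode_zero, mul_one, integral_cosMode, if_neg (by omega : ¬ k = 0),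
        integral_cosMode_cosMode hk]
      by_cases hkl : ℓ = k
      · subst hkl
        rw [if_pos rfl, hb]; ring
      · rw [if_neg hkl, hc k hk (Ne.symm hkl)]; ring
  · have e : ∀ m, ∫ x, sinMode k x * cosMode m x = 0 := fun m => by
      simpa only [mul_comm] using integral_cosMode_sinMode m k
    rw [hint, e, e]
    rcases Nat.eq_zero_or_pos k with rfl | hk
    · simp [sinMode_zero]
    · rw [integral_sinMode_sinMode hk]
      by_cases hkl : ℓ = k
      · subst hkl
        rw [if_pos rfl, hc']; ring
      · rw [if_neg hkl, hs k hk (Ne.symm hkl)]; ring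

/-- The argument takes place in `L²`, after differentiation. A function orthogonal to the
derivatives of all modes of `X0` is a combination of `1` and the two modes of frequency `ℓ`. The
derivative of `v` is orthogonal to these three, so it lies in the double orthogonal complement of
the image of `X0`, and `D` is injective. -/
theorem mem_X0_of_z_eq_zero {ℓ : ℕ} (hℓ : 1 ≤ ℓ) {v : H10} (h1 : z1 ℓ v = 0) (h2 : z2 ℓ v = 0) :
    v ∈ X0 ℓ := by
  set K := (X0 ℓ).map (H10.DL : H10 →ₗ[ℝ] L2S) with hK
  have : CompleteSpace K := (isClosed_map_D_X0 ℓ).completeSpace_coe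
  have hmem : v.D ∈ K := by
    rw [← K.orthogonal_orthogonal, Submodule.mem_orthogonal]
    intro g hg
    rw [Submodule.mem_orthogonal] at hg
    have hm : ∀ i : ModeIndex ℓ, inner ℝ (mode i).D g = 0 := fun i =>
      hg _ (Submodule.mem_map_of_mem (mode_mem_X0 i))
    obtain ⟨a, b, c, hg'⟩ := L2S_eq_of_orthogonal hℓ g
      (fun k hk hkl => by
        have h : inner ℝ (u k).D g = 0 := hm (⟨k, hk, hkl⟩, true)
        rw [inner_D_u] at h
        exact (mul_eq_zero.mp h).resolve_left (by positivity))
      (fun k hk hkl => by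
        have h : inner ℝ (w k).D g = 0 := hm (⟨k, hk, hkl⟩, false)
        rw [inner_D_w] at h
        exact (mul_eq_zero.mp h).resolve_left (by positivity))
    have hw := integral_trig_deriv_eq_zero (v.isPrimitive.isWeakDeriv (integrable_L2S _))
    have z1' : ∫ x, cosMode ℓ x * v.D x = 0 := by
      rw [(hw ℓ).1]; rw [z1] at h1; rw [show ∫ x, sinMode ℓ x * v x = 0 by linarith, mul_zero]
    have z2' : ∫ x, sinMode ℓ x * v.D x = 0 := by
      rw [(hw ℓ).2]; rw [z2] at h2
      rw [show ∫ x, cosMode ℓ x * v x = 0 by linarith, mul_zero, neg_zero]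
    have z0' : ∫ x, cosMode 0 x * v.D x = 0 := by rw [(hw 0).1]; simp
    rw [hg', map_add, map_add, map_smul, map_smul, map_smul, inner_add_left, inner_add_left,
      real_inner_smul_left, real_inner_smul_left, real_inner_smul_left, inner_toLp, inner_toLp,
      inner_toLp, z1', z2', z0']
    ring
  obtain ⟨y, hy, hyv⟩ := hmem
  have : y = v := antilipschitz_D.injective hyv
  exact this ▸ hy

/-! ### Invertibility of the linearization on `X₀` -/

theorem norm_sum_sq_of_orthogonal {E ι : Type*} [NormedAddCommGroup E] [InnerProductSpace ℝ E]
    {e : ι → E} (he : Pairwise fun i j => inner ℝ (e i) (e j) = 0) (s : Finset ι) (l : ι → ℝ) :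
    ‖∑ i ∈ s, l i • e i‖ ^ 2 = ∑ i ∈ s, l i ^ 2 * ‖e i‖ ^ 2 := by
  rw [← real_inner_self_eq_norm_sq, sum_inner]
  refine Finset.sum_congr rfl fun i hi => ?_
  rw [inner_sum, Finset.sum_eq_single i, real_inner_smul_left, real_inner_smul_right,
    real_inner_self_eq_norm_sq]
  · ring
  · intro j _ hji
    rw [real_inner_smul_left, real_inner_smul_right, he hji.symm, mul_zero, mul_zero]
  · exact fun h => absurd hi h

/-- Pythagoras on both sides, compared term by term. -/
theorem mul_norm_sum_le_of_orthogonal {E ι : Type*} [NormedAddCommGroup E]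
    [InnerProductSpace ℝ E] {e : ι → E} (he : Pairwise fun i j => inner ℝ (e i) (e j) = 0)
    {c : ι → ℝ} {ε : ℝ} (hε : 0 ≤ ε) (hc : ∀ i, ε ≤ |c i|) (s : Finset ι) (l : ι → ℝ) :
    ε * ‖∑ i ∈ s, l i • e i‖ ≤ ‖∑ i ∈ s, (l i * c i) • e i‖ := by
  refine le_of_sq_le_sq ?_ (norm_nonneg _)
  rw [mul_pow, norm_sum_sq_of_orthogonal he, norm_sum_sq_of_orthogonal he s fun i => l i * c i,
    Finset.mul_sum]
  refine Finset.sum_le_sum fun i _ => ?_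
  have h : ε ^ 2 ≤ c i ^ 2 := by
    rw [← sq_abs (c i)]; exact pow_le_pow_left₀ hε (hc i) 2
  calc ε ^ 2 * (l i ^ 2 * ‖e i‖ ^ 2) ≤ c i ^ 2 * (l i ^ 2 * ‖e i‖ ^ 2) :=
        mul_le_mul_of_nonneg_right h (by positivity)
    _ = (l i * c i) ^ 2 * ‖e i‖ ^ 2 := by ring

theorem pairwise_inner_D_mode (ℓ : ℕ) :
    Pairwise fun i j : ModeIndex ℓ => inner ℝ (mode i).D (mode j).D = 0 := by
  rintro ⟨⟨k, hk, hkl⟩, b⟩ ⟨⟨m, hm, hml⟩, b'⟩ h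
  have hkm : b = b' → m ≠ k := by
    rintro rfl rfl; exact h rfl
  cases b <;> cases b'
  · exact (inner_D_w_D k (w m)).trans (by rw [z2_w hk, if_neg (hkm rfl), mul_zero])
  · exact (inner_D_w_D k (u m)).trans (by rw [z2_u, mul_zero])
  · exact (inner_D_u_D k (w m)).trans (by rw [z1_w, mul_zero])
  · exact (inner_D_u_D k (u m)).trans (by rw [z1_u hk, if_neg (hkm rfl), mul_zero])

theorem linearization_mode {ℓ : ℕ} {p : Param} (hr : 0 < p.1) (hr2 : p.1 < 1 / 2) (q : ℕ)
    (i : ModeIndex ℓ) : linearization q p (mode i) = c1 q i.1 p • mode i := by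
  rcases i with ⟨k, b⟩
  cases b
  · exact linearization_w hr hr2 q k
  · exact linearization_u hr hr2 q k

theorem linearization_mem_X0 {ℓ : ℕ} {p : Param} (hr : 0 < p.1) (hr2 : p.1 < 1 / 2) (q : ℕ)
    {v : H10} (hv : v ∈ X0 ℓ) : linearization q p v ∈ X0 ℓ := by
  have h : X0 ℓ ≤ (X0 ℓ).comap (linearization q p : H10 →ₗ[ℝ] H10) :=
    X0_le_of_isClosed ((isClosed_X0 ℓ).preimage (linearization q p).continuous) fun i => by
      change linearization q p (mode i) ∈ X0 ℓ
      rw [linearization_mode hr hr2]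
      exact Submodule.smul_mem _ _ (mode_mem_X0 i)
  exact h hv

/-- The norm of derivatives is used because the `w k` are not orthogonal in `H10`: their constant
parts interact in `L²`. The bound holds on finite combinations of modes and passes to the closure.
-/
theorem mul_norm_D_le_norm_D_linearization {ℓ : ℕ} {p : Param} (hr : 0 < p.1) (hr2 : p.1 < 1 / 2)
    {q : ℕ} {ε : ℝ} (hε : 0 ≤ ε) (hc : ∀ k : ℕ, 1 ≤ k → k ≠ ℓ → ε ≤ |c1 q k p|) {v : H10}
    (hv : v ∈ X0 ℓ) : ε * ‖v.D‖ ≤ ‖(linearization q p v).D‖ := by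
  have hcl : IsClosed {v : H10 | ε * ‖H10.DL v‖ ≤ ‖H10.DL (linearization q p v)‖} :=
    isClosed_le (by fun_prop) (by fun_prop)
  rw [X0_eq, ← SetLike.mem_coe, Submodule.topologicalClosure_coe] at hv
  refine closure_minimal ?_ hcl hv
  intro x hx
  obtain ⟨l, rfl⟩ := (Finsupp.mem_span_range_iff_exists_finsupp).mp hx
  rw [Set.mem_ofPred_eq, Finsupp.sum, map_sum, map_sum, map_sum]
  simp only [map_smul, linearization_mode hr hr2, smul_smul]
  exact mul_norm_sum_le_of_orthogonal (e := fun i : ModeIndex ℓ => (mode i).D)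
    (pairwise_inner_D_mode ℓ) (c := fun i => c1 q i.1 p) hε (fun i => hc _ i.1.2.1 i.1.2.2)
    l.support l

/-- The linearization on `X₀`. -/
def linearizationX0 {p : Param} (hr : 0 < p.1) (hr2 : p.1 < 1 / 2) (q ℓ : ℕ) :
    X0 ℓ →L[ℝ] X0 ℓ :=
  (linearization q p).restrict fun _ hv => linearization_mem_X0 hr hr2 q hv

theorem coe_linearizationX0 {p : Param} (hr : 0 < p.1) (hr2 : p.1 < 1 / 2) (q ℓ : ℕ) (v : X0 ℓ) :
    (linearizationX0 hr hr2 q ℓ v : H10) = linearization q p v := rfl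

/-- Bounded below gives injectivity and closed range. The range contains each mode, since its
eigenvalue is nonzero, hence it is all of the closed span. -/
theorem isInvertible_linearizationX0 {ℓ : ℕ} {p : Param} (hr : 0 < p.1) (hr2 : p.1 < 1 / 2) {q : ℕ}
    {ε : ℝ} (hε : 0 < ε) (hc : ∀ k : ℕ, 1 ≤ k → k ≠ ℓ → ε ≤ |c1 q k p|) :
    (linearizationX0 hr hr2 q ℓ).IsInvertible := by
  set T := linearizationX0 hr hr2 q ℓ with hT
  -- The `2` in `2 / ε` is the price of passing between `‖v‖` and `‖v.D‖`.
  have hanti : AntilipschitzWith (Real.toNNReal (2 / ε)) T := by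
    refine AddMonoidHomClass.antilipschitz_of_bound _ fun v => ?_
    rw [Real.coe_toNNReal _ (by positivity), div_mul_eq_mul_div, le_div_iff₀ hε]
    have h1 := mul_norm_D_le_norm_D_linearization hr hr2 hε.le hc v.2
    have h2 := (v : H10).norm_le_two_mul
    have h3 := (linearization q p v).norm_D_le
    calc ‖v‖ * ε ≤ 2 * ‖(v : H10).D‖ * ε := mul_le_mul_of_nonneg_right h2 hε.le
      _ = 2 * (ε * ‖(v : H10).D‖) := by ring
      _ ≤ 2 * ‖T v‖ := mul_le_mul_of_nonneg_left (h1.trans h3) zero_le_two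
  have hrange : IsClosed (T.range : Set (X0 ℓ)) := hanti.isClosed_range T.uniformContinuous
  have hsurj : ∀ v ∈ X0 ℓ, ∃ y : X0 ℓ, linearization q p y = v := by
    have hK : IsClosed ((T.range.map (X0 ℓ).subtype : Submodule ℝ H10) : Set H10) :=
      (isClosed_X0 ℓ).isClosedEmbedding_subtypeVal.isClosedMap _ hrange
    have hle := X0_le_of_isClosed (ℓ := ℓ) hK fun i => by
      have hci : c1 q i.1 p ≠ 0 := fun h => by
        have := hc _ i.1.2.1 i.1.2.2
        rw [h, abs_zero] at this
        exact absurd this (not_le.mpr hε)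
      refine Submodule.mem_map.mpr
        ⟨_, ⟨⟨(c1 q i.1 p)⁻¹ • mode i, Submodule.smul_mem _ _ (mode_mem_X0 i)⟩, rfl⟩, ?_⟩
      change linearization q p ((c1 q i.1 p)⁻¹ • mode i) = mode i
      rw [map_smul, linearization_mode hr hr2, smul_smul, inv_mul_cancel₀ hci, one_smul]
    intro v hv
    obtain ⟨_, ⟨y, rfl⟩, h⟩ := Submodule.mem_map.mp (hle hv)
    exact ⟨y, h⟩
  refine ⟨ContinuousLinearEquiv.ofBijective T (LinearMap.ker_eq_bot.mpr hanti.injective)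
    (LinearMap.range_eq_top.mpr fun v => ?_), ContinuousLinearEquiv.coe_ofBijective _ _ _⟩
  obtain ⟨y, hy⟩ := hsurj v v.2
  exact ⟨y, Subtype.ext hy⟩

/-- The projection `I - Q` of `H¹₀` onto `X₀`. -/
def proj0 {ℓ : ℕ} (hℓ : 1 ≤ ℓ) : H10 →L[ℝ] X0 ℓ :=
  (ContinuousLinearMap.id ℝ H10 - (z1L ℓ).smulRight (u ℓ) - (z2L ℓ).smulRight (w ℓ)).codRestrict
    (X0 ℓ) fun v => by
      refine mem_X0_of_z_eq_zero hℓ ?_ ?_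
      · change z1L ℓ (v - z1L ℓ v • u ℓ - z2L ℓ v • w ℓ) = 0
        rw [map_sub, map_sub, map_smul, map_smul, z1L_apply ℓ (u ℓ), z1L_apply ℓ (w ℓ), z1_u hℓ,
          z1_w, if_pos rfl]
        simp
      · change z2L ℓ (v - z1L ℓ v • u ℓ - z2L ℓ v • w ℓ) = 0
        rw [map_sub, map_sub, map_smul, map_smul, z2L_apply ℓ (u ℓ), z2L_apply ℓ (w ℓ), z2_w hℓ,
          z2_u, if_pos rfl]
        simp

theorem coe_proj0 {ℓ : ℕ} (hℓ : 1 ≤ ℓ) (v : H10) :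
    (proj0 hℓ v : H10) = v - z1 ℓ v • u ℓ - z2 ℓ v • w ℓ := rfl

theorem proj0_of_mem {ℓ : ℕ} (hℓ : 1 ≤ ℓ) (v : X0 ℓ) : proj0 hℓ (v : H10) = v := by
  refine Subtype.ext ?_
  rw [coe_proj0, (z_eq_zero_of_mem_X0 hℓ v.2).1, (z_eq_zero_of_mem_X0 hℓ v.2).2, zero_smul,
    zero_smul, sub_zero, sub_zero]

/-- This turns an equation between functions into an equation in the Banach space `X0`, where the
implicit function theorem applies. -/
theorem proj0_field_eq_zero_iff {ℓ : ℕ} (hℓ : 1 ≤ ℓ) (q : ℕ) (v : H10) (p : Param) :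
    Fq q v p - Q ℓ (Fq q v p) = 0 ↔ proj0 hℓ (field q v p) = 0 := by
  have hf : (field q v p : UnitAddCircle → ℝ) = Fq q v p := funext (field_apply q v p)
  have key : ∀ x, (proj0 hℓ (field q v p) : H10) x = (Fq q v p - Q ℓ (Fq q v p)) x := fun x => by
    rw [coe_proj0, hf, Pi.sub_apply, Q, ← sub_sub, ← field_apply]
    rfl
  constructor
  · intro h
    refine Subtype.ext (H10.ext fun x => ?_)
    rw [key, h]; rfl
  · intro h
    funext x
    rw [← key, h]; rfl

/-! ### Existence of a Lyapunov–Schmidt reduction -/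

instance (ℓ : ℕ) : FiniteDimensional ℝ (N ℓ) :=
  FiniteDimensional.span_of_finite ℝ (by simp : ({u ℓ, w ℓ} : Set H10).Finite)

instance (ℓ : ℕ) : CompleteSpace (N ℓ) := FiniteDimensional.complete ℝ _

theorem mem_interior_paramSpace {p : Param} (hp : p ∈ interior paramSpace) :
    0 < p.1 ∧ p.1 < 1 / 2 := by
  have h : paramSpace = Ioc (0 : ℝ) (1 / 2) ×ˢ (univ : Set (ℝ × ℝ)) := by
    ext x; simp [paramSpace]
  rw [h, interior_prod_eq, interior_Ioc] at hp
  exact hp.1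

/-- The linear map `((v, p), y) ↦ (v + y, p)`. -/
def assemble (ℓ : ℕ) : (N ℓ × Param) × X0 ℓ →L[ℝ] H10 × Param :=
  ((N ℓ).subtypeL ∘L ContinuousLinearMap.fst ℝ _ _ ∘L ContinuousLinearMap.fst ℝ _ _ +
    (X0 ℓ).subtypeL ∘L ContinuousLinearMap.snd ℝ _ _).prod
    (ContinuousLinearMap.snd ℝ _ _ ∘L ContinuousLinearMap.fst ℝ _ _)

theorem assemble_apply {ℓ : ℕ} (z : (N ℓ × Param) × X0 ℓ) :
    assemble ℓ z = ((z.1.1 : H10) + (z.2 : H10), z.1.2) := rfl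

theorem nonempty_lsReduction {q ℓ : ℕ} (hℓ : 1 ≤ ℓ) {p₀ : Param} (hp : p₀ ∈ interior paramSpace)
    {ε : ℝ} (hε : 0 < ε) (hc : ∀ k : ℕ, 1 ≤ k → k ≠ ℓ → ε ≤ |c1 q k p₀|) :
    Nonempty (LSReduction q ℓ p₀) := by
  obtain ⟨hr, hr2⟩ := mem_interior_paramSpace hp
  set G : (N ℓ × Param) × X0 ℓ → X0 ℓ := fun z =>
    proj0 hℓ (field q ((z.1.1 : H10) + (z.2 : H10)) z.1.2) with hG
  set z₀ : (N ℓ × Param) × X0 ℓ := ((0, p₀), 0) with hz₀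
  have hGz : G z₀ = 0 := by
    change proj0 hℓ (field q ((0 : H10) + 0) p₀) = 0
    rw [add_zero, field_zero, map_zero]
  have hA : assemble ℓ z₀ = (0, p₀) := by
    rw [assemble_apply]
    exact Prod.ext (add_zero (0 : H10)) rfl
  have hd : HasStrictFDerivAt G (proj0 hℓ ∘L (linearization q p₀ ∘L
      ContinuousLinearMap.fst ℝ H10 Param) ∘L assemble ℓ) z₀ := by
    have h1 := hasStrictFDerivAt_field q p₀
    rw [← hA] at h1
    exact (proj0 hℓ).hasStrictFDerivAt.comp z₀ (h1.comp z₀ (assemble ℓ).hasStrictFDerivAt)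
  have hinv : ((proj0 hℓ ∘L (linearization q p₀ ∘L ContinuousLinearMap.fst ℝ H10 Param) ∘L
      assemble ℓ) ∘L .inr ℝ (N ℓ × Param) (X0 ℓ)).IsInvertible := by
    -- The partial derivative in `y` is the linearization on `X0` followed by `proj0`, which is the
    -- identity there.
    convert isInvertible_linearizationX0 (q := q) hr hr2 hε hc using 1
    refine ContinuousLinearMap.ext fun y => ?_
    change proj0 hℓ (linearization q p₀ ((0 : H10) + y)) = _
    rw [zero_add, ← coe_linearizationX0 hr hr2 q ℓ y, proj0_of_mem]
  set ψ := hd.implicitFunctionOfProdDomain hinv with hψ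
  have hiff : ∀ᶠ z in 𝓝 ((0 : N ℓ), p₀) ×ˢ 𝓝 (0 : X0 ℓ), G z = G z₀ ↔ ψ z.1 = z.2 := by
    rw [← nhds_prod_eq]
    exact hd.eventually_apply_eq_iff_implicitFunctionOfProdDomain hinv
  have htend : Tendsto ψ (𝓝 (0, p₀)) (𝓝 0) := hd.tendsto_implicitFunctionOfProdDomain hinv
  have hψ0 : ψ (0, p₀) = 0 := (nhds_prod_eq (x := ((0 : N ℓ), p₀)) (y := (0 : X0 ℓ)) ▸ hiff).self_of_nhds.mp rfl
  -- The strict derivative of `ψ` gives a Lipschitz bound, hence continuity, on a whole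
  -- neighbourhood.
  obtain ⟨K, S, hS, hlip⟩ :=
    (hd.hasStrictFDerivAt_implicitFunctionOfProdDomain hinv).exists_lipschitzOnWith
  -- `PY` becomes `Y`. The product `U × V` is then shrunk so that `ψ` maps into `Y` and the
  -- equivalence holds for all of `Y`.
  obtain ⟨PW, hW, PY, hY, hWY⟩ := eventually_prod_iff.mp hiff
  have hmem : ∀ᶠ z in 𝓝 ((0 : N ℓ), p₀), PW z ∧ PY (ψ z) ∧ z ∈ S ∧ z.2 ∈ paramSpace :=
    hW.and ((htend.eventually hY).and ((show ∀ᶠ z in 𝓝 ((0 : N ℓ), p₀), z ∈ S from hS).and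
      (continuousAt_snd.eventually (mem_interior_iff_mem_nhds.mp hp))))
  obtain ⟨U, hU, V, hV, hUV⟩ := mem_nhds_prod_iff.mp hmem
  have hUV' : ∀ v ∈ U, ∀ p ∈ V, PW (v, p) ∧ PY (ψ (v, p)) ∧ (v, p) ∈ S ∧ p ∈ paramSpace :=
    fun v hv p hp => hUV (mk_mem_prod hv hp)
  exact ⟨{
    U := U
    V := V
    Y := {y | PY y}
    U_mem := hU
    V_mem := hV
    V_subset := fun p hp => (hUV' 0 (mem_of_mem_nhds hU) p hp).2.2.2
    Y_mem := hY
    ψ := fun v p => ψ (v, p)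
    ψ_zero := hψ0
    ψ_cont := hlip.continuousOn.mono fun z hz => (hUV' z.1 hz.1 z.2 hz.2).2.2.1
    ψ_mem := fun v hv p hp => (hUV' v hv p hp).2.1
    ψ_unique := fun v hv p hp y hy => by
      rw [proj0_field_eq_zero_iff hℓ, eq_comm (a := y)]
      have h := hWY (hUV' v hv p hp).1 hy
      rwa [hGz] at h }⟩

/-! ### Equivariance -/

theorem integral_mode_shift (ℓ : ℕ) (z : UnitAddCircle) (f : H10) :
    ∫ x, sinMode ℓ x * f (x + z) = cosMode ℓ z * (∫ x, sinMode ℓ x * f x) -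
      sinMode ℓ z * ∫ x, cosMode ℓ x * f x := by
  have h := integral_add_right_eq_self (μ := (volume : Measure UnitAddCircle))
    (fun x => sinMode ℓ (x + -z) * f x) z
  simp only [add_neg_cancel_right] at h
  rw [h, ← integral_const_mul, ← integral_const_mul,
    ← integral_sub ((f.integrable_mul _).const_mul _) ((f.integrable_mul _).const_mul _)]
  refine integral_congr_ae (ae_of_all _ fun x => ?_)
  simp only [sinMode_add, sinMode_neg, cosMode_neg]
  ring

theorem integral_mode_shift' (ℓ : ℕ) (z : UnitAddCircle) (f : H10) :
    ∫ x, cosMode ℓ x * f (x + z) = cosMode ℓ z * (∫ x, cosMode ℓ x * f x) +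
      sinMode ℓ z * ∫ x, sinMode ℓ x * f x := by
  have h := integral_add_right_eq_self (μ := (volume : Measure UnitAddCircle))
    (fun x => cosMode ℓ (x + -z) * f x) z
  simp only [add_neg_cancel_right] at h
  rw [h, ← integral_const_mul, ← integral_const_mul,
    ← integral_add ((f.integrable_mul _).const_mul _) ((f.integrable_mul _).const_mul _)]
  refine integral_congr_ae (ae_of_all _ fun x => ?_)
  simp only [cosMode_add, sinMode_neg, cosMode_neg]
  ring

theorem H10.integrable_mul_shift (φ : C(UnitAddCircle, ℝ)) (f : H10) (z : UnitAddCircle) :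
    Integrable fun x => φ x * f (x + z) := by
  have h : Continuous fun x => φ x * f (x + z) :=
    φ.continuous.mul (f.toCont.continuous.comp (continuous_add_const z))
  exact h.integrable_of_hasCompactSupport (HasCompactSupport.of_compactSpace _)

/-- The zero mean of `φ` kills the constant `-f z` of the rotation; for the cosine mode this is
where `ℓ ≥ 1` matters. -/
theorem integral_mul_rotate (φ : C(UnitAddCircle, ℝ)) (hφ : ∫ x, φ x = 0) (f : H10)
    (z : UnitAddCircle) : ∫ x, φ x * rotate z f x = ∫ x, φ x * f (x + z) := by
  simp only [rotate_apply, mul_sub]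
  rw [integral_sub (f.integrable_mul_shift φ z) ((integrable_C φ).mul_const _),
    integral_mul_const, hφ, zero_mul, sub_zero]

theorem z1_rotate (ℓ : ℕ) (z : UnitAddCircle) (f : H10) :
    z1 ℓ (rotate z f) = cosMode ℓ z * z1 ℓ f + sinMode ℓ z * z2 ℓ f := by
  rw [z1, integral_mul_rotate _ (integral_sinMode ℓ), integral_mode_shift, z1, z2]
  ring

theorem z2_rotate {ℓ : ℕ} (hℓ : 1 ≤ ℓ) (z : UnitAddCircle) (f : H10) :
    z2 ℓ (rotate z f) = -sinMode ℓ z * z1 ℓ f + cosMode ℓ z * z2 ℓ f := by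
  rw [z2, integral_mul_rotate _ ((integral_cosMode ℓ).trans (if_neg (by omega))),
    integral_mode_shift', z1, z2]
  ring

theorem rotate_mem_X0 {ℓ : ℕ} (hℓ : 1 ≤ ℓ) (z : UnitAddCircle) {v : H10} (hv : v ∈ X0 ℓ) :
    rotate z v ∈ X0 ℓ := by
  obtain ⟨h1, h2⟩ := z_eq_zero_of_mem_X0 hℓ hv
  refine mem_X0_of_z_eq_zero hℓ ?_ ?_
  · rw [z1_rotate, h1, h2, mul_zero, mul_zero, add_zero]
  · rw [z2_rotate hℓ, h1, h2, mul_zero, mul_zero, add_zero]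

/-! ### The circle action in the coordinates `(a, b)` -/

theorem coe_nvec (ℓ : ℕ) (x : Fin 2 → ℝ) : (nvec ℓ x : H10) = x 0 • u ℓ + x 1 • w ℓ := rfl

theorem nvec_apply (ℓ : ℕ) (x : Fin 2 → ℝ) (t : UnitAddCircle) :
    (nvec ℓ x : H10) t = x 0 * sinMode ℓ t + x 1 * (1 - cosMode ℓ t) := rfl

theorem rot_mulVec_zero (ℓ : ℕ) (φ : ℝ) (x : Fin 2 → ℝ) :
    (rot ℓ φ).mulVec x 0 = cosMode ℓ φ * x 0 + sinMode ℓ φ * x 1 := by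
  simp [rot, Matrix.mulVec, dotProduct, Fin.sum_univ_two]

theorem rot_mulVec_one (ℓ : ℕ) (φ : ℝ) (x : Fin 2 → ℝ) :
    (rot ℓ φ).mulVec x 1 = -sinMode ℓ φ * x 0 + cosMode ℓ φ * x 1 := by
  simp [rot, Matrix.mulVec, dotProduct, Fin.sum_univ_two]

theorem cosMode_sq_add_sinMode_sq (ℓ : ℕ) (t : UnitAddCircle) :
    cosMode ℓ t ^ 2 + sinMode ℓ t ^ 2 = 1 := by
  induction t using QuotientAddGroup.induction_on with | H t => ?_
  exact Real.cos_sq_add_sin_sq _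

theorem rot_mulVec_norm (ℓ : ℕ) (φ : ℝ) (x : Fin 2 → ℝ) :
    (rot ℓ φ).mulVec x 0 ^ 2 + (rot ℓ φ).mulVec x 1 ^ 2 = x 0 ^ 2 + x 1 ^ 2 := by
  rw [rot_mulVec_zero, rot_mulVec_one]
  linear_combination (x 0 ^ 2 + x 1 ^ 2) * cosMode_sq_add_sinMode_sq ℓ (φ : UnitAddCircle)

theorem rotate_nvec (ℓ : ℕ) (φ : ℝ) (x : Fin 2 → ℝ) :
    rotate (φ : UnitAddCircle) (nvec ℓ x) = nvec ℓ ((rot ℓ φ).mulVec x) := by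
  refine H10.ext fun t => ?_
  rw [rotate_apply, nvec_apply, nvec_apply, nvec_apply, rot_mulVec_zero, rot_mulVec_one,
    sinMode_add, cosMode_add]
  ring

theorem z1_Q {ℓ : ℕ} (hℓ : 1 ≤ ℓ) (f : UnitAddCircle → ℝ) : z1 ℓ (Q ℓ f) = z1 ℓ f := by
  have h : Q ℓ f = (z1 ℓ f • u ℓ + z2 ℓ f • w ℓ : H10) := rfl
  rw [h, ← z1L_apply, map_add, map_smul, map_smul, z1L_apply, z1L_apply, z1_u hℓ, z1_w, if_pos rfl]
  simp

theorem z2_Q {ℓ : ℕ} (hℓ : 1 ≤ ℓ) (f : UnitAddCircle → ℝ) : z2 ℓ (Q ℓ f) = z2 ℓ f := by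
  have h : Q ℓ f = (z1 ℓ f • u ℓ + z2 ℓ f • w ℓ : H10) := rfl
  rw [h, ← z2L_apply, map_add, map_smul, map_smul, z2L_apply, z2L_apply, z2_w hℓ, z2_u, if_pos rfl]
  simp

theorem continuous_nvec (ℓ : ℕ) : Continuous (nvec ℓ) := by
  refine Continuous.subtype_mk ?_ _
  exact ((continuous_apply 0).smul continuous_const).add ((continuous_apply 1).smul continuous_const)

theorem nvec_zero (ℓ : ℕ) : nvec ℓ 0 = 0 := by
  refine Subtype.ext ?_
  rw [coe_nvec]
  simp

theorem coe_field (q : ℕ) (v : H10) (p : Param) :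
    (field q v p : UnitAddCircle → ℝ) = Fq q v p := funext (field_apply q v p)

/-- The kernel of `proj0` is `N`, on which the rotation acts by the matrix `rot`. -/
theorem proj0_rotate_eq_zero {ℓ : ℕ} (hℓ : 1 ≤ ℓ) (z : UnitAddCircle) {v : H10}
    (h : proj0 hℓ v = 0) : proj0 hℓ (rotate z v) = 0 := by
  have hv : v = z1 ℓ v • u ℓ + z2 ℓ v • w ℓ := by
    have h' := congrArg Subtype.val h
    rw [coe_proj0] at h'
    rw [← sub_eq_zero, ← sub_sub]
    exact h'
  obtain ⟨φ, rfl⟩ := QuotientAddGroup.mk_surjective z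
  have hn : v = nvec ℓ ![z1 ℓ v, z2 ℓ v] := hv
  have hr : rotate (φ : UnitAddCircle) v = nvec ℓ ((rot ℓ φ).mulVec ![z1 ℓ v, z2 ℓ v]) := by
    rw [← rotate_nvec, ← hn]
  refine Subtype.ext ?_
  rw [coe_proj0]
  change rotate (φ : UnitAddCircle) v - z1 ℓ (rotate (φ : UnitAddCircle) v) • u ℓ -
    z2 ℓ (rotate (φ : UnitAddCircle) v) • w ℓ = 0
  rw [z1_rotate, z2_rotate hℓ, hr, coe_nvec, rot_mulVec_zero, rot_mulVec_one, sub_sub]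
  exact sub_self _

/-! ### Equivariance of the implicit function and of the reduced map -/

namespace LSReduction

variable {q ℓ : ℕ} {p₀ : Param}

theorem hatPhi_eq (hℓ : 1 ≤ ℓ) (L : LSReduction q ℓ p₀) (p : ℝ → Param) (x : Fin 2 → ℝ) (s : ℝ) :
    L.hatPhi p x s = ![z1 ℓ (field q (nvec ℓ x + L.ψ (nvec ℓ x) (p s)) (p s)),
      z2 ℓ (field q (nvec ℓ x + L.ψ (nvec ℓ x) (p s)) (p s))] := by
  rw [hatPhi, Phi, z1_Q hℓ, z2_Q hℓ, coe_field]

/-- Equivariance of the implicit function of a Lyapunov–Schmidt reduction. -/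
theorem ψ_rotate (hℓ : 1 ≤ ℓ) (L : LSReduction q ℓ p₀) {x : Fin 2 → ℝ} {p : Param} {φ : ℝ}
    (hx : nvec ℓ x ∈ L.U) (hx' : nvec ℓ ((rot ℓ φ).mulVec x) ∈ L.U) (hp : p ∈ L.V)
    (hY : (⟨rotate φ (L.ψ (nvec ℓ x) p), rotate_mem_X0 hℓ _ (L.ψ (nvec ℓ x) p).2⟩ : X0 ℓ) ∈ L.Y) :
    (L.ψ (nvec ℓ ((rot ℓ φ).mulVec x)) p : H10) = rotate φ (L.ψ (nvec ℓ x) p) := by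
  refine (congrArg Subtype.val ((L.ψ_unique _ hx' p hp _ hY).mp ?_)).symm
  rw [proj0_field_eq_zero_iff hℓ]
  have h := (L.ψ_unique _ hx p hp _ (L.ψ_mem _ hx p hp)).mpr rfl
  rw [proj0_field_eq_zero_iff hℓ] at h
  have h' := proj0_rotate_eq_zero hℓ (φ : UnitAddCircle) h
  rwa [← field_rotate, map_add, rotate_nvec] at h'

theorem hatPhi_rotate (hℓ : 1 ≤ ℓ) (L : LSReduction q ℓ p₀) {x : Fin 2 → ℝ} {p : ℝ → Param}
    {s φ : ℝ} (h : (L.ψ (nvec ℓ ((rot ℓ φ).mulVec x)) (p s) : H10) =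
      rotate φ (L.ψ (nvec ℓ x) (p s))) :
    L.hatPhi p ((rot ℓ φ).mulVec x) s = (rot ℓ φ).mulVec (L.hatPhi p x s) := by
  rw [hatPhi_eq hℓ, hatPhi_eq hℓ, h, ← rotate_nvec, ← map_add, field_rotate, z1_rotate,
    z2_rotate hℓ]
  ext i
  fin_cases i
  · exact (rot_mulVec_zero ℓ φ ![_, _]).symm
  · exact (rot_mulVec_one ℓ φ ![_, _]).symm

/-- By continuity `ψ` is small near `(0, p₀)`, so its rotations stay in `Y`. The Euclidean condition
on `x` is invariant under `rot`, so one radius serves all angles. -/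
theorem exists_equivariant (hℓ : 1 ≤ ℓ) (L : LSReduction q ℓ p₀) :
    ∃ ρ > 0, ∃ V ∈ 𝓝 p₀, V ⊆ L.V ∧ ∀ x : Fin 2 → ℝ, x 0 ^ 2 + x 1 ^ 2 < ρ ^ 2 →
      nvec ℓ x ∈ L.U ∧ ∀ p ∈ V, ∀ φ : ℝ,
        (L.ψ (nvec ℓ ((rot ℓ φ).mulVec x)) p : H10) = rotate φ (L.ψ (nvec ℓ x) p) := by
  obtain ⟨η, hη, hball⟩ := Metric.mem_nhds_iff.mp L.Y_mem
  have hψ : Tendsto (fun z : N ℓ × Param => L.ψ z.1 z.2) (𝓝 (0, p₀)) (𝓝 0) := by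
    have h := L.ψ_cont.continuousAt (prod_mem_nhds L.U_mem L.V_mem)
    rwa [ContinuousAt, L.ψ_zero] at h
  have hn : Tendsto (nvec ℓ) (𝓝 0) (𝓝 0) := by
    have h := (continuous_nvec ℓ).tendsto 0
    rwa [nvec_zero] at h
  -- The radius `η / 3` compensates for the factor 3 in `norm_rotate_le`.
  have hev : ∀ᶠ z in 𝓝 ((0 : N ℓ), p₀),
      z ∈ L.U ×ˢ L.V ∧ L.ψ z.1 z.2 ∈ Metric.ball (0 : X0 ℓ) (η / 3) :=
    (show ∀ᶠ z in 𝓝 ((0 : N ℓ), p₀), z ∈ L.U ×ˢ L.V from prod_mem_nhds L.U_mem L.V_mem).and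
      (hψ.eventually (Metric.ball_mem_nhds _ (by positivity)))
  obtain ⟨U', hU', V', hV', hUV⟩ := mem_nhds_prod_iff.mp hev
  obtain ⟨ρ, hρ, hρU⟩ := Metric.mem_nhds_iff.mp (hn hU')
  have hmem : ∀ x : Fin 2 → ℝ, x 0 ^ 2 + x 1 ^ 2 < ρ ^ 2 → nvec ℓ x ∈ U' := fun x hx => by
    refine hρU ?_
    -- The norm on `Fin 2 → ℝ` is the maximum norm, which the Euclidean norm dominates.
    rw [mem_ball_zero_iff, pi_norm_lt_iff hρ]
    intro i
    rw [Real.norm_eq_abs]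
    refine abs_lt_of_sq_lt_sq (lt_of_le_of_lt ?_ hx) hρ.le
    fin_cases i
    · exact le_add_of_nonneg_right (sq_nonneg _)
    · exact le_add_of_nonneg_left (sq_nonneg _)
  refine ⟨ρ, hρ, V', hV', fun p hp => (hUV (mk_mem_prod (mem_of_mem_nhds hU') hp)).1.2,
    fun x hx => ⟨(hUV (mk_mem_prod (hmem x hx) (mem_of_mem_nhds hV'))).1.1, fun p hp φ => ?_⟩⟩
  have hx' : nvec ℓ ((rot ℓ φ).mulVec x) ∈ U' := hmem _ (by rwa [rot_mulVec_norm])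
  have h1 := hUV (mk_mem_prod (hmem x hx) hp)
  have h2 := hUV (mk_mem_prod hx' hp)
  refine L.ψ_rotate hℓ h1.1.1 h2.1.1 h1.1.2 (hball ?_)
  have h3 : ‖(L.ψ (nvec ℓ x) p : H10)‖ < η / 3 := mem_ball_zero_iff.mp h1.2
  rw [mem_ball_zero_iff]
  refine (norm_rotate_le (φ : UnitAddCircle) (L.ψ (nvec ℓ x) p : H10)).trans_lt ?_
  linarith

end LSReduction

end TwistedStates

end

theorem mainTheorem2 (q ℓ : ℕ) (hℓ : 1 ≤ ℓ) (δ : ℝ) (hδ : 0 < δ) (p : ℝ → TwistedStates.Param)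
    (hp : ContDiffOn ℝ ∞ p (Ioo (-δ) δ))
    (hint : ∀ s ∈ Ioo (-δ) δ, p s ∈ interior TwistedStates.paramSpace)
    (hzero : TwistedStates.c1 q ℓ (p 0) = 0)
    (hgap : ∃ ε > 0, ∀ s ∈ Ioo (-δ) δ, ∀ k : ℕ, 1 ≤ k → k ≠ ℓ →
      TwistedStates.c1 q k (p s) ∉ Ioo (-ε) ε)
    (hiso : ∀ s ∈ Ioo (-δ) δ, ¬ MapClusterPt (TwistedStates.c1 q ℓ (p s)) atTop
      (fun k : ℕ => TwistedStates.c1 q k (p s)))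
    (hspeed : deriv (fun s => TwistedStates.c1 q ℓ (p s)) 0 ≠ 0) :
    Nonempty (TwistedStates.LSReduction q ℓ (p 0)) ∧
    ∀ L : TwistedStates.LSReduction q ℓ (p 0), ∃ ε > 0, ε ≤ δ ∧
      ∀ x : Fin 2 → ℝ, x 0 ^ 2 + x 1 ^ 2 < ε ^ 2 → ∀ s ∈ Ioo (-ε) ε,
        TwistedStates.nvec ℓ x ∈ L.U ∧ p s ∈ L.V ∧
        ∀ φ : ℝ, L.hatPhi p ((TwistedStates.rot ℓ φ).mulVec x) s =
          (TwistedStates.rot ℓ φ).mulVec (L.hatPhi p x s) := by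
  have h0 : (0 : ℝ) ∈ Ioo (-δ) δ := ⟨neg_lt_zero.mpr hδ, hδ⟩
  constructor
  · obtain ⟨ε, hε, hc⟩ := hgap
    refine TwistedStates.nonempty_lsReduction hℓ (hint 0 h0) hε fun k hk hkl => ?_
    by_contra! h
    exact hc 0 h0 k hk hkl (abs_lt.mp h)
  · intro L
    obtain ⟨ρ, hρ, V, hV, hVL, hequi⟩ := L.exists_equivariant hℓ
    have hcont : ContinuousAt p 0 :=
      hp.continuousOn.continuousAt (Ioo_mem_nhds h0.1 h0.2)
    obtain ⟨σ, hσ, hσV⟩ := Metric.mem_nhds_iff.mp (hcont hV)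
    -- `ρ` controls `(a, b)`, `σ` keeps `p s` in `V`, and `δ` bounds the domain of the curve.
    refine ⟨min ρ (min σ δ), lt_min hρ (lt_min hσ hδ),
      (min_le_right _ _).trans (min_le_right _ _), fun x hx s hs => ?_⟩
    have hε : 0 < min ρ (min σ δ) := lt_min hρ (lt_min hσ hδ)
    have hxρ : x 0 ^ 2 + x 1 ^ 2 < ρ ^ 2 :=
      hx.trans_le (pow_le_pow_left₀ hε.le (min_le_left _ _) 2)
    have hpV : p s ∈ V := hσV (by
      rw [mem_ball_zero_iff, Real.norm_eq_abs]
      exact (abs_lt.mpr hs).trans_le ((min_le_right _ _).trans (min_le_left _ _)))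
    exact ⟨(hequi x hxρ).1, hVL hpV, fun φ => L.hatPhi_rotate hℓ ((hequi x hxρ).2 _ hpV φ)⟩
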